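/- Let $D_2$ be the Dyck language on two pairs of brackets, that is, the language over $\{a_1,a_2,\bar a_1,\bar a_2\}$ generated by the grammar $S\to SS\mid\varepsilon\mid a_1S\bar a_1\mid a_2S\bar a_2$. Let $\mathrm{NRR}(D_2)$ be the following decision problem: given (a description of) a nondeterministic finite automaton $\mathcal A$ over this alphabet, with $\varepsilon$-transitions allowed, decide whether $L(\mathcal A)\cap D_2\neq\varnothing$. Then $\mathrm{NRR}(D_2)$ is $\mathbf P$-complete under deterministic log-space reductions: it is decidable in deterministic polynomial time, and every language $L$ over a finite alphabet that is decidable in deterministic polynomial time admits a function $f$, computable by a deterministic Turing machine in logarithmic space, such that for all words $w$, $w\in L$ if and only if $f(w)\in\mathrm{NRR}(D_2)$. -/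

import Mathlib

/-! ## Turing machines, polynomial time, deterministic logarithmic space -/

/-- What the input head can see: the left end marker, an input letter, or the right end marker. -/
inductive InputSymbol (A : Type) : Type
  | leftEnd
  | letter (a : A)
  | rightEnd

/-- Head moves. -/
inductive HeadMove : Type
  | left
  | stay
  | right

/-- A deterministic Turing machine with a two-way read-only input tape (with end markers),
finitely many one-way infinite read-write work tapes and a one-way write-only output tape.
If the transition function is undefined (`none`), the machine halts. Otherwise it yields the new
state, the move of the input head, for each work tape the letter to write and the move, and at most
one letter that is appended to the output. -/
structure OfflineTM (A B : Type) where
  /-- number of work tapes -/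
  tapes : ℕ
  /-- work alphabet -/
  Γ : Type
  finite_Γ : Finite Γ
  /-- the blank letter of the work alphabet -/
  blank : Γ
  /-- states of the finite control -/
  Q : Type
  finite_Q : Finite Q
  /-- initial state -/
  start : Q
  /-- transition function -/
  δ : Q → InputSymbol A → (Fin tapes → Γ) →
    Option (Q × HeadMove × (Fin tapes → Γ × HeadMove) × Option B)

namespace OfflineTM

variable {A B : Type}

/-- The symbol at position `i` of the input tape: position `0` holds the left end marker, positions
`1, …, |w|` hold the letters of `w`, position `|w| + 1` holds the right end marker. -/
def inputAt (w : List A) : ℕ → InputSymbol A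
  | 0 => .leftEnd
  | i + 1 =>
    match w[i]? with
    | some a => .letter a
    | none => .rightEnd

/-- Configurations of the machine (the input word is kept separately, as it never changes). -/
structure Cfg (M : OfflineTM A B) where
  state : M.Q
  inputHead : ℕ
  heads : Fin M.tapes → ℕ
  work : Fin M.tapes → ℕ → M.Γ
  output : List B

/-- The initial configuration: input head on the left end marker, blank work tapes with their heads
on the first cell, empty output. -/
def init (M : OfflineTM A B) : M.Cfg where
  state := M.start
  inputHead := 0
  heads := fun _ => 0
  work := fun _ _ => M.blank
  output := []

/-- Move of a head on a one-way infinite tape; a left move from the first cell has no effect. -/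
def moveHead : HeadMove → ℕ → ℕ
  | .left, i => i - 1
  | .stay, i => i
  | .right, i => i + 1

/-- One step on the input `w`; `none` if the machine halts. The input head never moves beyond the
end markers. -/
def step (M : OfflineTM A B) (w : List A) (c : M.Cfg) : Option M.Cfg :=
  match M.δ c.state (inputAt w c.inputHead) (fun j => c.work j (c.heads j)) with
  | none => none
  | some (q, d, act, o) => some
      { state := q
        inputHead := min (moveHead d c.inputHead) (w.length + 1)
        heads := fun j => moveHead (act j).2 (c.heads j)
        work := fun j => Function.update (c.work j) (c.heads j) (act j).1
        output := c.output ++ o.toList }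

/-- The configuration after `t` steps on the input `w` (a halted machine keeps its configuration). -/
def cfgAt (M : OfflineTM A B) (w : List A) : ℕ → M.Cfg
  | 0 => M.init
  | t + 1 => (M.step w (M.cfgAt w t)).getD (M.cfgAt w t)

/-- On the input `w`, the machine has halted after at most `t` steps with output `out`. -/
def HaltsWithin (M : OfflineTM A B) (w : List A) (t : ℕ) (out : List B) : Prop :=
  M.step w (M.cfgAt w t) = none ∧ (M.cfgAt w t).output = out

/-- On the input `w`, only the first `s` cells of each work tape are ever visited. -/
def UsesSpace (M : OfflineTM A B) (w : List A) (s : ℕ) : Prop :=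
  ∀ t j, (M.cfgAt w t).heads j < s

end OfflineTM

open Classical in
/-- The class **P**: some deterministic Turing machine halts on every input `w` after at most
`p(|w|)` steps, `p` a fixed polynomial, and outputs the truth value of `w ∈ L`. -/
def InP {A : Type} [Finite A] (L : Language A) : Prop :=
  ∃ (M : OfflineTM A Bool) (p : Polynomial ℕ),
    ∀ w : List A, M.HaltsWithin w (p.eval w.length) [decide (w ∈ L)]

/-- Functions computable in deterministic logarithmic space. The space is counted on the work tapes
only. -/
def LogSpaceComputable {A B : Type} [Finite A] [Finite B] (f : List A → List B) : Prop :=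
  ∃ (M : OfflineTM A B) (c : ℕ), ∀ w : List A,
    (∃ t, M.HaltsWithin w t (f w)) ∧ M.UsesSpace w (c * (Nat.log 2 w.length + 1))

/-- Deterministic log-space (many-one) reducibility. -/
def LogSpaceReducible {A B : Type} [Finite A] [Finite B] (L : Language A) (L' : Language B) : Prop :=
  ∃ f : List A → List B, LogSpaceComputable f ∧ ∀ w, w ∈ L ↔ f w ∈ L'

/-- **P**-completeness under deterministic log-space reductions. -/
def IsPComplete {B : Type} [Finite B] (L : Language B) : Prop :=
  InP L ∧ ∀ (A : Type) [Finite A] (L' : Language A), InP L' → LogSpaceReducible L' L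

/-! ## Dyck languages -/

/-- The alphabet with the letters `a_i` (`opening i`) and `ā_i` (`closing i`), `i < n`. -/
inductive DyckLetter (n : ℕ) : Type
  | opening (i : Fin n)
  | closing (i : Fin n)

instance (n : ℕ) : Finite (DyckLetter n) :=
  Finite.of_surjective (Sum.elim DyckLetter.opening DyckLetter.closing : Fin n ⊕ Fin n → DyckLetter n)
    (by rintro (i | i); exacts [⟨.inl i, rfl⟩, ⟨.inr i, rfl⟩])

open Classical in
/-- The rules `S → S S | ε | a_1 S ā_1 | ⋯ | a_n S ā_n`, with `()` as the only nonterminal `S`. -/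
noncomputable def dyckRules (n : ℕ) : Finset (ContextFreeRule (DyckLetter n) Unit) :=
  {⟨(), [.nonterminal (), .nonterminal ()]⟩, ⟨(), []⟩} ∪
    Finset.univ.image fun i : Fin n =>
      ⟨(), [.terminal (.opening i), .nonterminal (), .terminal (.closing i)]⟩

/-- The grammar of the Dyck language. -/
noncomputable abbrev dyckGrammar (n : ℕ) : ContextFreeGrammar (DyckLetter n) where
  NT := Unit
  initial := ()
  rules := dyckRules n

/-- The Dyck language on `n` pairs of brackets. -/
noncomputable def dyckLanguage (n : ℕ) : Language (DyckLetter n) :=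
  (dyckGrammar n).language

/-! ## Nondeterministic automata and their descriptions -/

/-- A nondeterministic finite automaton with `ε`-transitions over the alphabet `α`, given by finite
data: the states are `0, …, numStates - 1`; a transition `(q, some a, p)` reads the letter `a`,
a transition `(q, none, p)` is an `ε`-transition. -/
structure NFADescription (α : Type) where
  numStates : ℕ
  start : Fin numStates
  accepting : List (Fin numStates)
  transitions : List (Fin numStates × Option α × Fin numStates)

/-- The alphabet in which automata over `α` are written down. -/
inductive DescSymbol (α : Type) : Type
  | tick
  | init
  | acc
  | edge
  | label (o : Option α)

instance (α : Type) [Finite α] : Finite (DescSymbol α) :=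
  Finite.of_surjective
    (Sum.elim ![.tick, .init, .acc, .edge] .label : Fin 4 ⊕ Option α → DescSymbol α)
    (by
      rintro (_ | _ | _ | _ | o)
      exacts [⟨.inl 0, rfl⟩, ⟨.inl 1, rfl⟩, ⟨.inl 2, rfl⟩, ⟨.inl 3, rfl⟩, ⟨.inr o, rfl⟩])

namespace NFADescription

variable {α : Type}

/-- The automaton that is described. -/
def toεNFA (D : NFADescription α) : εNFA α (Fin D.numStates) where
  step q o := {p | (q, o, p) ∈ D.transitions}
  start := {D.start}
  accept := {q | q ∈ D.accepting}

/-- The language recognized by the automaton. -/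
def language (D : NFADescription α) : Language α := D.toεNFA.accepts

/-- The tally representation of a number. -/
def tally (α : Type) (k : ℕ) : List (DescSymbol α) := List.replicate k .tick

/-- The word that describes the automaton: the number of states, the initial state, the list of
accepting states, the list of transitions, with numbers in unary. -/
def encode (D : NFADescription α) : List (DescSymbol α) :=
  tally α D.numStates ++ .init :: tally α D.start.val ++
    D.accepting.flatMap (fun q : Fin D.numStates => .acc :: tally α q.val) ++
    D.transitions.flatMap (fun (q, o, p) => .edge :: tally α q.val ++ .label o :: tally α p.val)

theorem tally_append_inj {a b : ℕ} {l l' : List (DescSymbol α)}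
    (hl : l.head? ≠ some .tick) (hl' : l'.head? ≠ some .tick)
    (h : tally α a ++ l = tally α b ++ l') : a = b ∧ l = l' := by
  induction a generalizing b with
  | zero =>
    cases b with
    | zero => exact ⟨rfl, by simpa [tally] using h⟩
    | succ b => subst_vars; simp_all [tally, List.replicate_succ]
  | succ a ih =>
    cases b with
    | zero => simp [tally, List.replicate_succ] at h; subst h; simp at hl'
    | succ b =>
      obtain ⟨h1, h2⟩ := ih (b := b) (by simpa [tally, List.replicate_succ] using h)
      exact ⟨by omega, h2⟩

theorem trans_inj {n : ℕ} (t t' : List (Fin n × Option α × Fin n))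
    (h : t.flatMap (fun e => DescSymbol.edge :: tally α e.1 ++ .label e.2.1 :: tally α e.2.2) =
      t'.flatMap (fun e => DescSymbol.edge :: tally α e.1 ++ .label e.2.1 :: tally α e.2.2)) :
    t = t' := by
  have hd : ∀ s : List (Fin n × Option α × Fin n), (s.flatMap (fun e : Fin n × Option α × Fin n => DescSymbol.edge ::
      tally α e.1 ++ .label e.2.1 :: tally α e.2.2)).head? ≠ some .tick := by
    rintro (_ | ⟨e, s⟩) <;> simp
  induction t generalizing t' with
  | nil => cases t' with
    | nil => rfl
    | cons e t' => simp at h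
  | cons e t ih => cases t' with
    | nil => simp at h
    | cons e' t' =>
      obtain ⟨q, o, p⟩ := e
      obtain ⟨q', o', p'⟩ := e'
      simp only [List.flatMap_cons, List.cons_append, List.append_assoc, List.cons.injEq,
        true_and] at h
      obtain ⟨h1, h2⟩ := tally_append_inj (by simp) (by simp) h
      simp only [List.cons.injEq, DescSymbol.label.injEq] at h2
      obtain ⟨h3, h4⟩ := tally_append_inj (hd _) (hd _) h2.2
      rw [ih _ h4, Fin.ext h1, Fin.ext h3, h2.1]

/-- A word describes at most one automaton. -/
theorem encode_injective : Function.Injective (encode (α := α)) := by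
  rintro ⟨n, s, a, t⟩ ⟨n', s', a', t'⟩ hh
  have h := hh
  simp only [encode, List.append_assoc, List.cons_append] at h
  obtain ⟨rfl, hh1⟩ := tally_append_inj (by simp) (by simp) h
  clear h; have h := hh1
  simp only [List.cons.injEq, true_and] at h
  have hd : ∀ s : List (Fin n × Option α × Fin n), (s.flatMap (fun e : Fin n × Option α × Fin n => DescSymbol.edge ::
      (tally α e.1 ++ .label e.2.1 :: tally α e.2.2))).head? ≠ some .tick := by
    rintro (_ | ⟨e, s⟩) <;> simp
  have hd' : ∀ (a : List (Fin n)) (s : List (Fin n × Option α × Fin n)),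
      (a.flatMap (fun q : Fin n => DescSymbol.acc :: tally α q.val) ++ s.flatMap (fun e => DescSymbol.edge ::
      (tally α e.1 ++ .label e.2.1 :: tally α e.2.2))).head? ≠ some .tick := by
    rintro (_ | ⟨e, s⟩) s
    · simpa using hd s
    · simp
  obtain ⟨h1, h⟩ := tally_append_inj (hd' _ _) (hd' _ _) h
  rename_i h3
  clear h3
  have : a = a' ∧ t = t' := by
    clear h1 hh1 hh
    induction a generalizing a' with
    | nil => cases a' with
      | nil => exact ⟨rfl, trans_inj _ _ (by simpa using h)⟩
      | cons q a' =>
        cases t with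
        | nil => simp at h
        | cons => simp at h
    | cons q a ih => cases a' with
      | nil =>
        cases t' with
        | nil => simp at h
        | cons => simp at h
      | cons q' a' =>
        simp only [List.flatMap_cons, List.cons_append, List.append_assoc, List.cons.injEq,
          true_and] at h
        obtain ⟨h1, h2⟩ := tally_append_inj (hd' _ _) (hd' _ _) h
        obtain ⟨rfl, rfl⟩ := ih _ h2
        rw [Fin.ext h1]; exact ⟨rfl, rfl⟩
  rw [Fin.ext h1, this.1, this.2]

end NFADescription

/-! ## Nondeterministic regular realizability -/

/-- The automata whose language meets the filter `F`. -/
def NRR {α : Type} (F : Language α) : Set (NFADescription α) :=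
  {D | ∃ w, w ∈ D.language ∧ w ∈ F}

/-- The decision problem `NRR(F)` as a language: the set of descriptions of the automata in
`NRR F`. -/
def NRRProblem {α : Type} (F : Language α) : Language (DescSymbol α) :=
  {x | ∃ D ∈ NRR F, D.encode = x}

/-! Both halves rest on balanced reachability. By `mem_NRR_dyckLanguage_iff`, the language of an
automaton meets the Dyck language iff some accepting state is related to the initial state by
`DyckPath`, the least reflexive and transitive relation that contains the ε-edges and is closed
under enclosing a path between an opening edge and the closing edge of the same index.

Membership in P is saturation. Put an ε-loop at every vertex, and whenever there are edges q → x → y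
→ p whose middle label is ε and whose outer labels are both ε or a matching pair of brackets, add an
ε-edge from q to p. A sweep over all quadruples that changes the graph adds one of at most m²
ε-edges, so m² sweeps reach a fixed point (`sweepEdges_saturated`), and its ε-edges are exactly the
balanced paths (`mem_saturated_iff`). Numbers are unary, so m = |w| + 1 exceeds the number of
states. A parser rejects the words that describe no automaton.

For hardness, the computation of a polynomial-time decider is laid out on a grid of time and tape
cells, and its local consistency is expressed by Horn clauses with two premises about the corners of
a unit square. The fact `acc`, carried back to the point (0, 0), is derivable iff the input is
accepted (`derives_acc_iff_mem`). Searching for a derivation is a recursive procedure: to prove a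
fact, choose a rule, prove its first premise, return, prove its second premise, return. Its return
stack holds only rules, of which there are finitely many, since the offsets in a popped rule tell
how to move back to the right grid point. Hence the procedure is a finite automaton with
polynomially many states, grid points times a finite set, whose letters are pushes and pops.
Balanced paths from "prove the goal" to "goal done" correspond to derivations
(`dyckPath_iff_hornDerives`). Writing the index of a rule in unary with an end letter reduces the
stack alphabet to two letters, hence two pairs of brackets. The transitions are so regular that
nested loops over the grid print them.

To avoid handling transition tables, both algorithms are written in a language of bounded loops,
`LoopProg`, which is compiled to machines (`simulates_compile`). Counters are kept in bijective
binary on work tapes. A counter grows by at most one per unit of time (`exec_val_le`), so polynomial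
running time leaves every counter with logarithmically many digits. This gives `LoopProg.inP`, and
`LoopProg.logSpaceComputable` if the random access memory is not used. -/

/-! ## Structured programs for offline Turing machines -/

/-- The part of a configuration that is not the state. -/
structure Memory (B Γ : Type) (k : ℕ) where
  inputHead : ℕ
  heads : Fin k → ℕ
  work : Fin k → ℕ → Γ
  output : List B

/-- What a machine does in one step, apart from the change of the state. -/
abbrev TapeAction (B Γ : Type) (k : ℕ) := HeadMove × (Fin k → Γ × HeadMove) × Option B

/-- Structured programs whose instructions are single steps of an offline Turing machine. -/
inductive WhileProg (A B Γ : Type) (k : ℕ) : Type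
  | act (f : InputSymbol A → (Fin k → Γ) → TapeAction B Γ k)
  | seq (p q : WhileProg A B Γ k)
  | ite (b : InputSymbol A → (Fin k → Γ) → Bool) (p q : WhileProg A B Γ k)
  | while (b : InputSymbol A → (Fin k → Γ) → Bool) (p : WhileProg A B Γ k)

namespace Memory

variable {A B Γ : Type} {k : ℕ}

/-- The letters under the heads of the work tapes. -/
def read (m : Memory B Γ k) : Fin k → Γ := fun j => m.work j (m.heads j)

/-- The effect of an action. -/
def apply (w : List A) (m : Memory B Γ k) (a : TapeAction B Γ k) : Memory B Γ k where
  inputHead := min (OfflineTM.moveHead a.1 m.inputHead) (w.length + 1)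
  heads := fun j => OfflineTM.moveHead (a.2.1 j).2 (m.heads j)
  work := fun j => Function.update (m.work j) (m.heads j) (a.2.1 j).1
  output := m.output ++ a.2.2.toList

/-- The action that changes nothing. -/
def idle (g : Fin k → Γ) : TapeAction B Γ k := (.stay, fun j => (g j, .stay), none)

/-- Tests are executed as steps that leave the memory alone. The range hypothesis is needed because
every step clips the input head. -/
theorem apply_idle {w : List A} {m : Memory B Γ k} (h : m.inputHead ≤ w.length + 1) :
    m.apply w (idle m.read) = m := by
  cases m
  simp_all [apply, idle, read, OfflineTM.moveHead]

end Memory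

namespace WhileProg

variable {A B Γ : Type} {k : ℕ}

/-- The input head is in its range, and the heads on the work tapes satisfy `P`. -/
def Ok (w : List A) (P : (Fin k → ℕ) → Prop) (m : Memory B Γ k) : Prop :=
  P m.heads ∧ m.inputHead ≤ w.length + 1

/-- `Exec w P p m t m'`: started in `m`, the program `p` ends in `m'` after `t` steps, and all
memories on the way satisfy `Ok w P`. -/
inductive Exec (w : List A) (P : (Fin k → ℕ) → Prop) :
    WhileProg A B Γ k → Memory B Γ k → ℕ → Memory B Γ k → Prop
  | act {f m} : Ok w P m →
      Exec w P (act f) m 1 (m.apply w (f (OfflineTM.inputAt w m.inputHead) m.read))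
  | seq {p q m t m₁ t' m'} : Exec w P p m t m₁ → Exec w P q m₁ t' m' →
      Exec w P (seq p q) m (t + t') m'
  | ite_true {b p q m t m'} : Ok w P m → b (OfflineTM.inputAt w m.inputHead) m.read = true →
      Exec w P p m t m' → Exec w P (ite b p q) m (t + 1) m'
  | ite_false {b p q m t m'} : Ok w P m → b (OfflineTM.inputAt w m.inputHead) m.read = false →
      Exec w P q m t m' → Exec w P (ite b p q) m (t + 1) m'
  | while_false {b p m} : Ok w P m → b (OfflineTM.inputAt w m.inputHead) m.read = false →
      Exec w P (.while b p) m 1 m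
  | while_true {b p m t m₁ t' m'} : Ok w P m →
      b (OfflineTM.inputAt w m.inputHead) m.read = true →
      Exec w P p m t m₁ → Exec w P (.while b p) m₁ t' m' → Exec w P (.while b p) m (t + t' + 1) m'

/-- The control states of a program. -/
def States : WhileProg A B Γ k → Type
  | .act _ => Unit
  | .seq p q => States p ⊕ States q
  | .ite _ p q => Option (States p ⊕ States q)
  | .while _ p => Option (States p)

theorem finite_states : ∀ p : WhileProg A B Γ k, Finite (States p)
  | .act _ => inferInstanceAs (Finite Unit)
  | .seq p q => by
    have := finite_states p; have := finite_states q
    exact inferInstanceAs (Finite (States p ⊕ States q))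
  | .ite _ p q => by
    have := finite_states p; have := finite_states q
    exact inferInstanceAs (Finite (Option (States p ⊕ States q)))
  | .while _ p => by
    have := finite_states p
    exact inferInstanceAs (Finite (Option (States p)))

/-- The control state in which a program begins. -/
def entry : (p : WhileProg A B Γ k) → States p
  | .act _ => ()
  | .seq p _ => .inl (entry p)
  | .ite _ _ _ => none
  | .while _ _ => none

/-- The transition function of a program; the new state `none` means that the program ends. -/
def trans : (p : WhileProg A B Γ k) → States p → InputSymbol A → (Fin k → Γ) →
    Option (States p) × TapeAction B Γ k
  | .act f, _, a, g => (none, f a g)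
  | .seq p q, .inl s, a, g =>
    let r := trans p s a g
    (some (r.1.elim (.inr (entry q)) .inl), r.2)
  | .seq _ q, .inr s, a, g => ((trans q s a g).1.map .inr, (trans q s a g).2)
  | .ite b p q, none, a, g =>
    (some (some (bif b a g then .inl (entry p) else .inr (entry q))), Memory.idle g)
  | .ite _ p _, some (.inl s), a, g =>
    ((trans p s a g).1.map fun s => some (.inl s), (trans p s a g).2)
  | .ite _ _ q, some (.inr s), a, g =>
    ((trans q s a g).1.map fun s => some (.inr s), (trans q s a g).2)
  | .while b p, none, a, g => (bif b a g then some (some (entry p)) else none, Memory.idle g)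
  | .while _ p, some s, a, g => (some (trans p s a g).1, (trans p s a g).2)

/-- `Runs w P p s m t m'`: from the control state `s` and the memory `m`, the program `p` ends
after `t` steps with the memory `m'`. -/
inductive Runs (w : List A) (P : (Fin k → ℕ) → Prop) (p : WhileProg A B Γ k) :
    States p → Memory B Γ k → ℕ → Memory B Γ k → Prop
  | exit {s m a} : Ok w P m → trans p s (OfflineTM.inputAt w m.inputHead) m.read = (none, a) →
      Runs w P p s m 1 (m.apply w a)
  | step {s m a s' t m'} : Ok w P m →
      trans p s (OfflineTM.inputAt w m.inputHead) m.read = (some s', a) →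
      Runs w P p s' (m.apply w a) t m' → Runs w P p s m (t + 1) m'

variable {w : List A} {P : (Fin k → ℕ) → Prop}

/-- For a component whose exit is also the exit of the whole construct: the embedding commutes with
the transition functions, exits included. -/
theorem Runs.map {p q : WhileProg A B Γ k} (ι : States p → States q)
    (hι : ∀ s a g, trans q (ι s) a g = ((trans p s a g).1.map ι, (trans p s a g).2))
    {s m t m'} (h : Runs w P p s m t m') : Runs w P q (ι s) m t m' := by
  induction h with
  | exit h1 h2 => exact .exit h1 (by rw [hι, h2]; rfl)
  | step h1 h2 _ ih => exact .step h1 (by rw [hι, h2]; rfl) ih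

/-- For a component after which control passes on: its last step, instead of leaving the program,
enters `e`, so no extra step is spent and the times add up. -/
theorem Runs.continue {p q : WhileProg A B Γ k} (ι : States p → States q) (e : States q)
    (hι : ∀ s a g, trans q (ι s) a g = (some ((trans p s a g).1.elim e ι), (trans p s a g).2))
    {s m t m₁ t' m'} (h : Runs w P p s m t m₁) (h' : Runs w P q e m₁ t' m') :
    Runs w P q (ι s) m (t + t') m' := by
  induction h with
  | exit h1 h2 =>
    rw [add_comm]
    exact .step h1 (by rw [hι, h2]; rfl) h'
  | step h1 h2 _ ih =>
    rw [add_right_comm]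
    exact .step h1 (by rw [hι, h2]; rfl) (ih h')

/-- Each construct combines the two embeddings `Runs.map` and `Runs.continue`; a test contributes
one idle step. -/
theorem Exec.runs {p : WhileProg A B Γ k} {m t m'} (h : Exec w P p m t m') :
    Runs w P p (entry p) m t m' := by
  induction h with
  | act h => exact .exit h rfl
  | seq _ _ ih₁ ih₂ =>
    exact Runs.continue (q := .seq _ _) Sum.inl (Sum.inr (entry _)) (fun s a g => rfl) ih₁
      (Runs.map (q := .seq _ _) Sum.inr (fun s a g => rfl) ih₂)
  | @ite_true b p q m t m' hm hb _ ih =>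
    refine .step (p := .ite b p q) (s' := some (.inl (entry p))) hm (a := Memory.idle m.read) ?_ ?_
    · simp [entry, trans, hb]
    · rw [Memory.apply_idle hm.2]
      exact Runs.map (q := .ite b p q) (fun s => some (.inl s)) (fun s a g => rfl) ih
  | @ite_false b p q m t m' hm hb _ ih =>
    refine .step (p := .ite b p q) (s' := some (.inr (entry q))) hm (a := Memory.idle m.read) ?_ ?_
    · simp [entry, trans, hb]
    · rw [Memory.apply_idle hm.2]
      exact Runs.map (q := .ite b p q) (fun s => some (.inr s)) (fun s a g => rfl) ih
  | @while_false b p m hm hb =>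
    have := Runs.exit (p := .while b p) (s := none) (a := Memory.idle m.read) hm (by simp [trans, hb])
    rwa [Memory.apply_idle hm.2] at this
  | @while_true b p m t m₁ t' m' hm hb _ _ ih₁ ih₂ =>
    refine .step (p := .while b p) (s' := some (entry p)) hm (a := Memory.idle m.read) ?_ ?_
    · simp [entry, trans, hb]
    · rw [Memory.apply_idle hm.2]
      refine Runs.continue (q := .while b p) some none (fun s a g => ?_) ih₁ ih₂
      simp only [trans]
      cases (trans p s a g).1 <;> rfl

/-- The machine that executes a program. -/
def machine [Finite Γ] (blank : Γ) (p : WhileProg A B Γ k) : OfflineTM A B where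
  tapes := k
  Γ := Γ
  finite_Γ := inferInstance
  blank := blank
  Q := Option (States p)
  finite_Q := by have := finite_states p; infer_instance
  start := some (entry p)
  δ q a g := q.map fun s => ((trans p s a g).1, (trans p s a g).2)

/-- The configuration with a given state and memory. -/
def cfg [Finite Γ] {blank : Γ} {p : WhileProg A B Γ k} (s : Option (States p)) (m : Memory B Γ k) :
    (machine blank p).Cfg where
  state := s
  inputHead := m.inputHead
  heads := m.heads
  work := m.work
  output := m.output

/-- The memory in which a machine begins. -/
def initMemory (B : Type) (k : ℕ) (blank : Γ) : Memory B Γ k :=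
  ⟨0, fun _ => 0, fun _ _ => blank, []⟩

theorem step_some [Finite Γ] {blank : Γ} {p : WhileProg A B Γ k} (s : States p)
    (m : Memory B Γ k) : (machine blank p).step w (cfg (some s) m) =
      some (cfg (trans p s (OfflineTM.inputAt w m.inputHead) m.read).1
        (m.apply w (trans p s (OfflineTM.inputAt w m.inputHead) m.read).2)) := rfl

/-- The state `none` has no transition, so the last configuration persists; this is why the head
condition, with `hP` for the final memory, holds at all later times and yields a space bound. -/
theorem Runs.cfgAt [Finite Γ] {blank : Γ} {p : WhileProg A B Γ k} {s m t m'}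
    (h : Runs w P p s m t m') (hP : P m'.heads) (n : ℕ)
    (hn : (machine blank p).cfgAt w n = cfg (some s) m) :
    (machine blank p).cfgAt w (n + t) = cfg none m' ∧
      ∀ i, n ≤ i → P ((machine blank p).cfgAt w i).heads := by
  induction h generalizing n with
  | @exit s m a h1 h2 =>
    have h3 : (machine blank p).cfgAt w (n + 1) = cfg none (m.apply w a) := by
      rw [OfflineTM.cfgAt, hn, step_some, h2]; rfl
    refine ⟨h3, fun i hi => ?_⟩
    obtain rfl | hi := hi.eq_or_lt
    · rw [hn]; exact h1.1
    · suffices (machine blank p).cfgAt w i = cfg none (m.apply w a) by rw [this]; exact hP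
      induction i, Nat.succ_le_of_lt hi using Nat.le_induction with
      | base => exact h3
      | succ i hi' ih => rw [OfflineTM.cfgAt, ih (by omega) (by omega)]; rfl
  | @step s m a s' t m' h1 h2 _ ih =>
    have h3 : (machine blank p).cfgAt w (n + 1) = cfg (some s') (m.apply w a) := by
      rw [OfflineTM.cfgAt, hn, step_some, h2]; rfl
    obtain ⟨h4, h5⟩ := ih hP _ h3
    refine ⟨by rw [← h4]; congr 1; omega, fun i hi => ?_⟩
    obtain rfl | hi := hi.eq_or_lt
    · rw [hn]; exact h1.1
    · exact h5 i hi

/-- The machine of a program does what the program does. -/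
theorem Exec.machine [Finite Γ] {blank : Γ} {p : WhileProg A B Γ k} {t m'}
    (h : Exec w P p (initMemory B k blank) t m') (hP : P m'.heads) :
    (∀ t', t ≤ t' → (machine blank p).HaltsWithin w t' m'.output) ∧
      ∀ i, P ((WhileProg.machine blank p).cfgAt w i).heads := by
  obtain ⟨h1, h2⟩ := h.runs.cfgAt (blank := blank) hP 0 rfl
  rw [zero_add] at h1
  refine ⟨fun t' ht' => ?_, fun i => h2 i (Nat.zero_le _)⟩
  suffices (WhileProg.machine blank p).cfgAt w t' = cfg none m' by
    rw [OfflineTM.HaltsWithin, this]; exact ⟨rfl, rfl⟩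
  induction t', ht' using Nat.le_induction with
  | base => exact h1
  | succ i hi' ih => rw [OfflineTM.cfgAt, ih]; rfl

end WhileProg

/-! ## Binary counters on work tapes -/

/-- The digits of the bijective binary numeration; `blank` lies beyond the last digit. -/
inductive Digit : Type
  | blank
  | one
  | two

instance : Finite Digit :=
  Finite.of_surjective (![.blank, .one, .two] : Fin 3 → Digit)
    (by rintro (_ | _ | _); exacts [⟨0, rfl⟩, ⟨1, rfl⟩, ⟨2, rfl⟩])

instance : DecidableEq Digit
  | .blank, .blank | .one, .one | .two, .two => isTrue rfl
  | .blank, .one | .blank, .two | .one, .blank | .one, .two | .two, .blank | .two, .one =>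
    isFalse nofun

/-- The digits of `v`, least significant digit first. -/
def digitAt : ℕ → ℕ → Digit
  | v, 0 => if v = 0 then .blank else if v % 2 = 1 then .one else .two
  | v, i + 1 => digitAt ((v - 1) / 2) i

theorem digitAt_zero_left (i : ℕ) : digitAt 0 i = .blank := by
  induction i with
  | zero => rfl
  | succ i ih => exact ih

@[simp] theorem digitAt_odd_zero (u : ℕ) : digitAt (2 * u + 1) 0 = .one := by
  simp [digitAt, Nat.add_mod]

@[simp] theorem digitAt_even_zero (u : ℕ) : digitAt (2 * u + 2) 0 = .two := by
  simp [digitAt]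

@[simp] theorem digitAt_odd_succ (u i : ℕ) : digitAt (2 * u + 1) (i + 1) = digitAt u i := by
  simp [digitAt]

@[simp] theorem digitAt_even_succ (u i : ℕ) : digitAt (2 * u + 2) (i + 1) = digitAt u i := by
  rw [digitAt]; congr 1; omega

@[simp] theorem digitAt_one_zero : digitAt 1 0 = .one := rfl

/-- The case distinction of bijective binary numeration: no digits, lowest digit one, lowest digit
two. Numerals are unique and have no leading zeros, so zero is recognised by looking at a single
cell. -/
theorem eq_zero_or_odd_or_even (v : ℕ) : v = 0 ∨ (∃ u, v = 2 * u + 1) ∨ ∃ u, v = 2 * u + 2 := by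
  rcases v.even_or_odd' with ⟨u, rfl | rfl⟩
  · rcases u with _ | u
    · exact .inl rfl
    · exact .inr (.inr ⟨u, by ring⟩)
  · exact .inr (.inl ⟨u, rfl⟩)

theorem digitAt_eq_blank_iff (v : ℕ) : digitAt v 0 = .blank ↔ v = 0 := by
  unfold digitAt; split_ifs <;> simp_all

/-- The letters on the work tapes: a digit, a mark for the first cell, a value of the finite
register and a cell of the random access memory. Each tape uses only some of these components. -/
abbrev TapeLetter (R C : Type) := (Digit × Bool) × R × C

namespace Memory

variable {A B Γ : Type} {k : ℕ}

/-- Replace head position and contents of one tape. -/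
def setTape (m : Memory B Γ k) (t : Fin k) (h : ℕ) (f : ℕ → Γ) : Memory B Γ k :=
  { m with heads := Function.update m.heads t h, work := Function.update m.work t f }

theorem setTape_self (m : Memory B Γ k) (t : Fin k) : m.setTape t (m.heads t) (m.work t) = m := by
  simp [setTape]

@[simp] theorem read_setTape (m : Memory B Γ k) (t : Fin k) (h : ℕ) (f : ℕ → Γ) :
    (m.setTape t h f).read t = f h := by simp [setTape, read]

end Memory

namespace WhileProg

variable {A B : Type} {k : ℕ}

/-- A step that concerns one work tape only. -/
def onTape {Γ : Type} (t : Fin k) (F : Γ → Γ × HeadMove) : WhileProg A B Γ k :=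
  .act fun _ g => (.stay, fun i => if i = t then F (g t) else (g i, .stay), none)

theorem exec_onTape {Γ : Type} {w : List A} {P : (Fin k → ℕ) → Prop} {t : Fin k}
    {F : Γ → Γ × HeadMove} {m : Memory B Γ k} {h : ℕ} {f : ℕ → Γ}
    (hm : Ok w P (m.setTape t h f)) :
    Exec w P (onTape t F) (m.setTape t h f) 1
      (m.setTape t (OfflineTM.moveHead (F (f h)).2 h) (Function.update f h (F (f h)).1)) := by
  have h1 := hm.2
  have e : m.setTape t (OfflineTM.moveHead (F (f h)).2 h) (Function.update f h (F (f h)).1) =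
      (m.setTape t h f).apply w ((fun _ g => (.stay, fun i => if i = t then F (g t) else (g i, .stay),
        none) : InputSymbol A → (Fin k → Γ) → TapeAction B Γ k)
        (OfflineTM.inputAt w (m.setTape t h f).inputHead) (m.setTape t h f).read) := by
    simp only [Memory.setTape, Memory.apply, Memory.read, OfflineTM.moveHead] at h1 ⊢
    congr 1
    · omega
    · ext i; by_cases hi : i = t
      · subst hi; simp
      · simp [hi]
    · ext i; by_cases hi : i = t
      · subst hi; simp
      · simp [hi]
    · simp
  rw [e]
  exact .act hm

variable {R C : Type}

/-- Write a digit. -/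
def putDigit (d : Digit) (g : TapeLetter R C) : TapeLetter R C := ((d, g.1.2), g.2)

/-- Move the head of a tape to the first cell. -/
def goHome (t : Fin k) : WhileProg A B (TapeLetter R C) k :=
  .while (fun _ g => !(g t).1.2) (onTape t fun g => (g, .left))

/-- Add one to the number on a tape. -/
def incTape (t : Fin k) : WhileProg A B (TapeLetter R C) k :=
  .seq (.seq
    (.while (fun _ g => (g t).1.1 = .two) (onTape t fun g => (putDigit .one g, .right)))
    (onTape t fun g => (putDigit (if g.1.1 = .blank then .one else .two) g, .stay)))
  (goHome t)

/-- Subtract one from a positive number on a tape, the head being left anywhere. -/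
def borrowTape (t : Fin k) : WhileProg A B (TapeLetter R C) k :=
  .seq (.while (fun _ g => (g t).1.1 = .one) (onTape t fun g => (putDigit .two g, .right)))
    (.ite (fun _ g => (g t).1.1 = .two) (onTape t fun g => (putDigit .one g, .stay))
      (.seq (onTape t fun g => (g, .left)) (onTape t fun g => (putDigit .blank g, .stay))))

/-- Subtract one from the number on a tape, unless it is zero. -/
def decTape (t : Fin k) : WhileProg A B (TapeLetter R C) k :=
  .ite (fun _ g => (g t).1.1 = .blank) (onTape t fun g => (g, .stay))
    (.seq (borrowTape t) (goHome t))

variable {w : List A} {P : (Fin k → ℕ) → Prop} {t : Fin k} {m : Memory B (TapeLetter R C) k} {b : ℕ}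

/-- Work tapes have no end marker; the mark in the first cell is what stops the walk to the left. -/
theorem exec_goHome {f : ℕ → TapeLetter R C} (hf : ∀ i, (f i).1.2 = decide (i = 0)) {h : ℕ}
    (hh : h < b) (hP : ∀ h < b, ∀ f, Ok w P (m.setTape t h f)) :
    Exec w P (goHome t) (m.setTape t h f) (2 * h + 1) (m.setTape t 0 f) := by
  induction h with
  | zero => exact .while_false (hP _ hh _) (by simp [hf])
  | succ h ih =>
    have h1 := exec_onTape (F := fun g => (g, .left)) (hP _ hh f)
    simp only [OfflineTM.moveHead, Nat.add_sub_cancel, Function.update_eq_self] at h1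
    have := Exec.while_true (hP _ hh f) (by simp [hf]) h1 (ih (by omega))
    rwa [show 1 + (2 * h + 1) + 1 = 2 * (h + 1) + 1 by ring] at this

/-- Induction on the value of the digits from position `h` on: a digit two becomes one and carries
into the remaining numeral, which represents `u` for `v = 2 * u + 2`. The hypothesis `hv` forces `h
< b`. -/
theorem exec_carry {f : ℕ → TapeLetter R C} {v h : ℕ} (hf : ∀ i, (f (h + i)).1.1 = digitAt v i)
    (hv : (v + 2) * 2 ^ h ≤ 2 ^ b) (hP : ∀ h < b, ∀ f, Ok w P (m.setTape t h f)) :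
    ∃ T h' f', Exec w P (.seq
      (.while (fun _ g => (g t).1.1 = .two) (onTape t fun g => (putDigit .one g, .right)))
      (onTape t fun g => (putDigit (if g.1.1 = .blank then .one else .two) g, .stay)))
      (m.setTape t h f) T (m.setTape t h' f') ∧ T ≤ 2 * (b - h) ∧ h' < b ∧
      (∀ i, (f' (h + i)).1.1 = digitAt (v + 1) i) ∧ (∀ i < h, f' i = f i) ∧
      ∀ i, (f' i).1.2 = (f i).1.2 := by
  have hb : h < b := by
    refine (Nat.pow_lt_pow_iff_right (a := 2) (by norm_num)).1 (lt_of_lt_of_le ?_ hv)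
    have := Nat.pos_of_ne_zero (pow_ne_zero h (two_ne_zero (α := ℕ)))
    nlinarith
  induction v using Nat.strong_induction_on generalizing h f with
  | _ v ih =>
  have h0 := hf 0
  rw [add_zero] at h0
  by_cases hd : digitAt v 0 = .two
  · obtain ⟨u, rfl⟩ : ∃ u, v = 2 * u + 2 := by
      rcases eq_zero_or_odd_or_even v with rfl | ⟨u, rfl⟩ | ⟨u, rfl⟩
      · simp [digitAt_zero_left] at hd
      · simp at hd
      · exact ⟨u, rfl⟩
    set f₁ := Function.update f h (putDigit .one (f h)) with hf₁
    have h1 := exec_onTape (F := fun g => (putDigit .one g, .right)) (hP h hb f)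
    -- The bound is exactly invariant under a carry: `(2 * u + 2 + 2) * 2 ^ h = (u + 2) * 2 ^ (h +
    -- 1)`.
    have hv' : (u + 2) * 2 ^ (h + 1) ≤ 2 ^ b := by rw [pow_succ]; linarith
    obtain ⟨T, h', f', hE, hT, hh', hi1, hi2, hi3⟩ := ih u (by omega) (f := f₁) (h := h + 1)
      (fun i => by
        rw [hf₁, Function.update_of_ne (by omega), add_assoc, add_comm 1, hf,
          digitAt_even_succ]) hv'
      (by
        refine (Nat.pow_lt_pow_iff_right (a := 2) (by norm_num)).1 (lt_of_lt_of_le ?_ hv')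
        have := Nat.pos_of_ne_zero (pow_ne_zero (h + 1) (two_ne_zero (α := ℕ)))
        nlinarith)
    cases hE with
    | seq hE1 hE2 =>
    rename_i T1 m1 T2
    refine ⟨_, h', f', .seq (.while_true (hP h hb f) (by simp [h0, hd]) h1 hE1) hE2, by omega,
      hh', fun i => ?_, fun i hi => ?_, fun i => ?_⟩
    · cases i with
      | zero =>
        rw [add_zero, hi2 _ (by omega), hf₁, Function.update_self,
          show 2 * u + 2 + 1 = 2 * (u + 1) + 1 by ring, digitAt_odd_zero]
        rfl
      | succ i =>
        rw [show 2 * u + 2 + 1 = 2 * (u + 1) + 1 by ring, digitAt_odd_succ, ← hi1]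
        congr 3; omega
    · rw [hi2 _ (by omega), hf₁, Function.update_of_ne (by omega)]
    · rw [hi3, hf₁]
      by_cases h : i = h
      · subst h; rw [Function.update_self]; rfl
      · rw [Function.update_of_ne h]
  · refine ⟨_, h, _, .seq (.while_false (hP h hb f) (by simp [h0, hd]))
      (exec_onTape (hP h hb f)), by omega, hb, fun i => ?_, fun i hi => ?_, fun i => ?_⟩
    · rcases eq_zero_or_odd_or_even v with rfl | ⟨u, rfl⟩ | ⟨u, rfl⟩
      · cases i with
        | zero => rw [add_zero, Function.update_self, h0]; simp [putDigit, digitAt_zero_left]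
        | succ i => rw [Function.update_of_ne (by omega), hf]; rfl
      · cases i with
        | zero => rw [add_zero, Function.update_self, h0]; simp [putDigit]
        | succ i => rw [Function.update_of_ne (by omega), hf]; simp
      · simp at hd
    · rw [Function.update_of_ne (by omega)]
    · by_cases h : i = h
      · subst h; rw [Function.update_self]; rfl
      · rw [Function.update_of_ne h]

/-- The contents of a tape that holds the number `v`. -/
def HoldsNat (v : ℕ) (f : ℕ → TapeLetter R C) : Prop :=
  ∀ i, (f i).1 = (digitAt v i, decide (i = 0))

theorem exec_incTape {f : ℕ → TapeLetter R C} {v : ℕ} (hf : HoldsNat v f) (hv : v + 2 ≤ 2 ^ b)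
    (hP : ∀ h < b, ∀ f, Ok w P (m.setTape t h f)) :
    ∃ T f', Exec w P (incTape t) (m.setTape t 0 f) T (m.setTape t 0 f') ∧ T ≤ 4 * b + 7 ∧
      HoldsNat (v + 1) f' := by
  obtain ⟨T, h', f', hE, hT, hh', hi1, -, hi3⟩ := exec_carry (f := f) (v := v) (h := 0)
    (fun i => by rw [zero_add, hf]) (by simpa using hv) hP
  have h3 : ∀ i, (f' i).1.2 = decide (i = 0) := fun i => by rw [hi3, hf]
  refine ⟨_, f', .seq hE (exec_goHome h3 hh' hP), by omega, fun i => ?_⟩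
  rw [← h3, ← hi1, zero_add]

/-- For `v = 2 * u + 1` the digit one becomes two and one is borrowed from `u`. Here `(v + 1) * 2 ^
h = (u + 1) * 2 ^ (h + 1)` is the invariant quantity that keeps the head below `b`. -/
theorem exec_borrowTape {f : ℕ → TapeLetter R C} {v h : ℕ} (hv0 : v ≠ 0)
    (hf : ∀ i, (f (h + i)).1.1 = digitAt v i)
    (hv : (v + 1) * 2 ^ h < 2 ^ b) (hP : ∀ h < b, ∀ f, Ok w P (m.setTape t h f)) :
    ∃ T h' f', Exec w P (borrowTape t)
      (m.setTape t h f) T (m.setTape t h' f') ∧ T ≤ 2 * (b - h) + 4 ∧ h' < b ∧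
      (∀ i, (f' (h + i)).1.1 = digitAt (v - 1) i) ∧ (∀ i < h, f' i = f i) ∧
      ∀ i, (f' i).1.2 = (f i).1.2 := by
  have hb : h < b := by
    refine (Nat.pow_lt_pow_iff_right (a := 2) (by norm_num)).1 (lt_of_le_of_lt ?_ hv)
    have := Nat.pos_of_ne_zero (pow_ne_zero h (two_ne_zero (α := ℕ)))
    nlinarith
  induction v using Nat.strong_induction_on generalizing h f with
  | _ v ih =>
  have h0 := hf 0
  rw [add_zero] at h0
  by_cases hd : digitAt v 0 = .two
  · refine ⟨_, h, _, .seq (.while_false (hP h hb f) (by simp [h0, hd]))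
      (.ite_true (hP h hb f) (by simp [h0, hd]) (exec_onTape (hP h hb f))), by omega, hb,
      fun i => ?_, fun i hi => ?_, fun i => ?_⟩
    · obtain ⟨u, rfl⟩ : ∃ u, v = 2 * u + 2 := by
        rcases eq_zero_or_odd_or_even v with rfl | ⟨u, rfl⟩ | ⟨u, rfl⟩
        · simp at hv0
        · simp at hd
        · exact ⟨u, rfl⟩
      cases i with
      | zero =>
        rw [add_zero, Function.update_self]
        simp only [putDigit, Nat.add_succ_sub_one, digitAt_odd_zero]
      | succ i =>
        rw [Function.update_of_ne (by omega), hf]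
        simp
    · rw [Function.update_of_ne (by omega)]
    · by_cases h : i = h
      · subst h; rw [Function.update_self]; rfl
      · rw [Function.update_of_ne h]
  · obtain ⟨u, rfl⟩ : ∃ u, v = 2 * u + 1 := by
      rcases eq_zero_or_odd_or_even v with rfl | ⟨u, rfl⟩ | ⟨u, rfl⟩
      · simp at hv0
      · exact ⟨u, rfl⟩
      · simp at hd
    set f₁ := Function.update f h (putDigit .two (f h)) with hf₁
    have h1 := exec_onTape (F := fun g => (putDigit .two g, .right)) (hP h hb f)
    have hf₁' : ∀ i, (f₁ (h + 1 + i)).1.1 = digitAt u i := fun i => by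
      rw [hf₁, Function.update_of_ne (by omega), add_assoc, add_comm 1, hf, digitAt_odd_succ]
    have hb' : h + 1 < b := by
      refine (Nat.pow_lt_pow_iff_right (a := 2) (by norm_num)).1 (lt_of_le_of_lt ?_ hv)
      have := Nat.pos_of_ne_zero (pow_ne_zero h (two_ne_zero (α := ℕ)))
      rw [pow_succ]
      nlinarith
    -- If nothing lies above, there is nothing to borrow from: the blank in the next cell reveals
    -- this, the head steps back and erases the digit two just written, and the numeral gets
    -- shorter.
    by_cases hu : u = 0
    · subst hu
      have h2 : (f₁ (h + 1)).1.1 = .blank := by simpa [digitAt] using hf₁' 0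
      have h3 := exec_onTape (F := fun g => (g, .left)) (hP _ hb' f₁)
      simp only [OfflineTM.moveHead, Nat.add_sub_cancel, Function.update_eq_self] at h3
      have hw : decide (((m.setTape t (h + 1) f₁).read t).1.1 = .one) = false := by simp [h2]
      have hw' : decide (((m.setTape t (h + 1) f₁).read t).1.1 = .two) = false := by simp [h2]
      refine ⟨_, h, _, .seq (.while_true (hP h hb f) (by simp [h0]) h1
        (.while_false (hP _ hb' _) hw))
        (.ite_false (hP _ hb' _) hw'
          (.seq h3 (exec_onTape (hP h hb f₁)))), by omega, hb, fun i => ?_, fun i hi => ?_,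
        fun i => ?_⟩
      · rw [show 2 * 0 + 1 - 1 = 0 by rfl, digitAt_zero_left]
        cases i with
        | zero => rw [add_zero, Function.update_self]; rfl
        | succ i =>
          rw [Function.update_of_ne (by omega), hf₁, Function.update_of_ne (by omega), hf,
            digitAt_odd_succ, digitAt_zero_left]
      · rw [Function.update_of_ne (by omega), hf₁, Function.update_of_ne (by omega)]
      · by_cases h : i = h
        · subst h; rw [Function.update_self, hf₁, Function.update_self]; rfl
        · rw [Function.update_of_ne h, hf₁, Function.update_of_ne h]
    · obtain ⟨T, h', f', hE, hT, hh', hi1, hi2, hi3⟩ := ih u (by omega) hu (f := f₁) (h := h + 1)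
        hf₁' (lt_of_le_of_lt (by rw [pow_succ]; nlinarith) hv) hb'
      cases hE with
      | seq hE1 hE2 =>
      refine ⟨_, h', f', .seq (.while_true (hP h hb f) (by simp [h0]) h1 hE1) hE2, by omega,
        hh', fun i => ?_, fun i hi => ?_, fun i => ?_⟩
      · obtain ⟨x, rfl⟩ : ∃ x, u = x + 1 := ⟨u - 1, by omega⟩
        cases i with
        | zero =>
          rw [add_zero, hi2 _ (by omega), hf₁, Function.update_self,
            show 2 * (x + 1) + 1 - 1 = 2 * x + 2 by omega, digitAt_even_zero]
          rfl
        | succ i =>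
          rw [show 2 * (x + 1) + 1 - 1 = 2 * x + 2 by omega, digitAt_even_succ,
            show x = x + 1 - 1 by rfl, ← hi1]
          congr 3; omega
      · rw [hi2 _ (by omega), hf₁, Function.update_of_ne (by omega)]
      · rw [hi3, hf₁]
        by_cases h : i = h
        · subst h; rw [Function.update_self]; rfl
        · rw [Function.update_of_ne h]

theorem exec_decTape {f : ℕ → TapeLetter R C} {v : ℕ} (hf : HoldsNat v f) (hv : v + 2 ≤ 2 ^ b)
    (hP : ∀ h < b, ∀ f, Ok w P (m.setTape t h f)) :
    ∃ T f', Exec w P (decTape t) (m.setTape t 0 f) T (m.setTape t 0 f') ∧ T ≤ 4 * b + 7 ∧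
      HoldsNat (v - 1) f' := by
  have hb : 0 < b := by
    rcases b.eq_zero_or_pos with rfl | h
    · simp at hv
    · exact h
  have h0 : (f 0).1.1 = digitAt v 0 := by rw [hf]
  by_cases hv0 : v = 0
  · subst hv0
    have h3 := exec_onTape (F := fun g => (g, .stay)) (hP 0 hb f)
    simp only [OfflineTM.moveHead, Function.update_eq_self] at h3
    exact ⟨_, f, .ite_true (hP 0 hb f) (by simp [h0, digitAt_zero_left]) h3, by omega, hf⟩
  · obtain ⟨T, h', f', hE, hT, hh', hi1, -, hi3⟩ := exec_borrowTape (f := f) (v := v) (h := 0) hv0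
      (fun i => by rw [zero_add, hf]) (by simpa using show v + 1 < 2 ^ b from hv) hP
    have h3 : ∀ i, (f' i).1.2 = decide (i = 0) := fun i => by rw [hi3, hf]
    refine ⟨_, f', .ite_false (hP 0 hb f) (by simp [h0, digitAt_eq_blank_iff, hv0])
      (.seq hE (exec_goHome h3 hh' hP)), by omega, fun i => ?_⟩
    rw [← h3, ← hi1, zero_add]

end WhileProg

/-! ## A language of bounded loops -/

/-- Programs with counters `0, …, K` (the counter `0` is reserved), a register with values in `R`,
a two-way read-only input, a random access memory with cells in `C` that is accessed through a
pointer, and bounded loops as the only loops. -/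
inductive LoopProg (A B R C : Type) (K : ℕ) : Type
  | loc (f : InputSymbol A → R → C → R × C × HeadMove × HeadMove × Option B)
  | inc (x : Fin (K + 1))
  | dec (x : Fin (K + 1))
  | copy (y x : Fin (K + 1))
  | seq (p q : LoopProg A B R C K)
  | ite (b : InputSymbol A → R → C → Bool) (p q : LoopProg A B R C K)
  | ifz (x : Fin (K + 1)) (p q : LoopProg A B R C K)
  | loop (a x : Fin (K + 1)) (p : LoopProg A B R C K)

/-- The states on which programs with bounded loops act. -/
structure LoopState (B R C : Type) (K : ℕ) where
  val : Fin (K + 1) → ℕ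
  pos : ℕ
  ptr : ℕ
  mem : ℕ → C
  reg : R
  out : List B

namespace LoopState

variable {A B R C : Type} {K : ℕ}

/-- Set a counter. -/
def set (s : LoopState B R C K) (x : Fin (K + 1)) (n : ℕ) : LoopState B R C K :=
  { s with val := Function.update s.val x n }

@[simp] theorem val_set (s : LoopState B R C K) (x : Fin (K + 1)) (n : ℕ) :
    (s.set x n).val = Function.update s.val x n := rfl
@[simp] theorem pos_set (s : LoopState B R C K) (x : Fin (K + 1)) (n : ℕ) :
    (s.set x n).pos = s.pos := rfl
@[simp] theorem ptr_set (s : LoopState B R C K) (x : Fin (K + 1)) (n : ℕ) :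
    (s.set x n).ptr = s.ptr := rfl

theorem set_self (s : LoopState B R C K) (x : Fin (K + 1)) : s.set x (s.val x) = s := by
  simp [set]

theorem set_set (s : LoopState B R C K) (x : Fin (K + 1)) (n n' : ℕ) :
    (s.set x n).set x n' = s.set x n' := by
  simp [set]

theorem set_comm (s : LoopState B R C K) {x y : Fin (K + 1)} (h : x ≠ y) (n n' : ℕ) :
    (s.set x n).set y n' = (s.set y n').set x n := by
  simp [set, Function.update_comm h]

/-- The effect of a local step. -/
def localStep (w : List A) (s : LoopState B R C K)
    (r : R × C × HeadMove × HeadMove × Option B) : LoopState B R C K where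
  val := s.val
  pos := min (OfflineTM.moveHead r.2.2.1 s.pos) (w.length + 1)
  ptr := OfflineTM.moveHead r.2.2.2.1 s.ptr
  mem := Function.update s.mem s.ptr r.2.1
  reg := r.1
  out := s.out ++ r.2.2.2.2.toList

end LoopState

namespace LoopProg

variable {A B R C : Type} {K : ℕ}

/-- Apply `F (n - 1), …, F 0` in this order. -/
def iterDown {S : Type} (F : ℕ → S → S) : ℕ → S → S
  | 0, s => s
  | n + 1, s => iterDown F n (F n s)

/-- The sum of the costs `T` during `iterDown F`. -/
def sumDown {S : Type} (F : ℕ → S → S) (T : ℕ → S → ℕ) : ℕ → S → ℕ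
  | 0, _ => 0
  | n + 1, s => T n s + sumDown F T n (F n s)

/-- What a program does; in a loop the counter `a` runs downwards from `x - 1` to `0`. -/
def exec (w : List A) : LoopProg A B R C K → LoopState B R C K → LoopState B R C K
  | loc f, s => s.localStep w (f (OfflineTM.inputAt w s.pos) s.reg (s.mem s.ptr))
  | inc x, s => s.set x (s.val x + 1)
  | dec x, s => s.set x (s.val x - 1)
  | copy y x, s => s.set y (s.val x)
  | seq p q, s => exec w q (exec w p s)
  | ite b p q, s =>
    bif b (OfflineTM.inputAt w s.pos) s.reg (s.mem s.ptr) then exec w p s else exec w q s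
  | ifz x p q, s => if s.val x = 0 then exec w p s else exec w q s
  | loop a x p, s => (iterDown (fun n s => exec w p (s.set a n)) (s.val x) s).set a 0

/-- The time that a program takes, if changing or testing a counter takes one unit of time. -/
def time (w : List A) : LoopProg A B R C K → LoopState B R C K → ℕ
  | loc _, _ => 1
  | inc _, _ => 1
  | dec _, _ => 1
  | copy y x, s => s.val y + 5 * s.val x + 3
  | seq p q, s => time w p s + time w q (exec w p s)
  | ite b p q, s =>
    1 + bif b (OfflineTM.inputAt w s.pos) s.reg (s.mem s.ptr) then time w p s else time w q s
  | ifz x p q, s => 1 + if s.val x = 0 then time w p s else time w q s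
  | loop a x p, s => s.val a + 5 * s.val x + 4 + sumDown (fun n s => exec w p (s.set a n))
      (fun n s => time w p (s.set a n) + 2) (s.val x) s

/-- The program does not change the counter `j`. -/
def NoWrite (j : Fin (K + 1)) : LoopProg A B R C K → Prop
  | loc _ => True
  | inc x => j ≠ x
  | dec x => j ≠ x
  | copy y _ => j ≠ y
  | seq p q => NoWrite j p ∧ NoWrite j q
  | ite _ p q => NoWrite j p ∧ NoWrite j q
  | ifz _ p q => NoWrite j p ∧ NoWrite j q
  | loop a _ p => j ≠ a ∧ NoWrite j p

/-- The program does not use the reserved counter, and does not change loop counters otherwise. -/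
def WellFormed : LoopProg A B R C K → Prop
  | loc _ => True
  | inc x => x ≠ 0
  | dec x => x ≠ 0
  | copy y x => y ≠ 0 ∧ x ≠ 0 ∧ y ≠ x
  | seq p q => WellFormed p ∧ WellFormed q
  | ite _ p q => WellFormed p ∧ WellFormed q
  | ifz x p q => x ≠ 0 ∧ WellFormed p ∧ WellFormed q
  | loop a x p => a ≠ 0 ∧ x ≠ 0 ∧ a ≠ x ∧ NoWrite a p ∧ WellFormed p

/-- The pointer stays in the set `Z`. -/
def KeepsPtr (Z : ℕ → Prop) : LoopProg A B R C K → Prop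
  | loc f => ∀ a r c i, Z i → Z (OfflineTM.moveHead (f a r c).2.2.2.1 i)
  | inc _ => True
  | dec _ => True
  | copy _ _ => True
  | seq p q => KeepsPtr Z p ∧ KeepsPtr Z q
  | ite _ p q => KeepsPtr Z p ∧ KeepsPtr Z q
  | ifz _ p q => KeepsPtr Z p ∧ KeepsPtr Z q
  | loop _ _ p => KeepsPtr Z p

theorem keepsPtr_true (p : LoopProg A B R C K) : p.KeepsPtr fun _ => True := by
  induction p <;> simp_all [KeepsPtr]

theorem iterDown_invariant {S : Type} (F : ℕ → S → S) (I : ℕ → S → Prop)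
    {n : ℕ} (hF : ∀ m < n, ∀ s, I (m + 1) s → I m (F m s)) {s : S} (h : I n s) :
    I 0 (iterDown F n s) := by
  induction n generalizing s with
  | zero => exact h
  | succ n ih => exact ih (fun m hm => hF m (by omega)) (hF n (by omega) s h)

theorem exec_val_of_noWrite {w : List A} {j : Fin (K + 1)} {p : LoopProg A B R C K}
    (hp : p.NoWrite j) (s : LoopState B R C K) : (exec w p s).val j = s.val j := by
  induction p generalizing s with
  | loc f => rfl
  | inc x => exact Function.update_of_ne hp _ _
  | dec x => exact Function.update_of_ne hp _ _
  | copy y x => exact Function.update_of_ne hp _ _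
  | seq p q ihp ihq => rw [exec, ihq hp.2, ihp hp.1]
  | ite b p q ihp ihq =>
    rw [exec]
    cases b (OfflineTM.inputAt w s.pos) s.reg (s.mem s.ptr)
    · exact ihq hp.2 s
    · exact ihp hp.1 s
  | ifz x p q ihp ihq =>
    rw [exec]
    split_ifs
    · exact ihp hp.1 s
    · exact ihq hp.2 s
  | loop a x p ih =>
    rw [exec, LoopState.val_set, Function.update_of_ne hp.1]
    refine iterDown_invariant _ (fun _ (s' : LoopState B R C K) => s'.val j = s.val j) (fun m _ s' h => ?_) rfl
    rw [ih hp.2, LoopState.val_set, Function.update_of_ne hp.1, h]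

/-- The cost of the remaining rounds is kept as slack, and each round consumes only its own share.
The index `n` is bounded along with the values because a round may store it in the loop counter. -/
theorem iterDown_val_bound {F : ℕ → LoopState B R C K → LoopState B R C K}
    {T : ℕ → LoopState B R C K → ℕ}
    (h : ∀ n (s : LoopState B R C K) (b : ℕ), (∀ j, s.val j + T n s ≤ b) → n + T n s ≤ b →
      ∀ j, (F n s).val j ≤ b)
    (n : ℕ) (s : LoopState B R C K) (b : ℕ) (hs : ∀ j, s.val j + sumDown F T n s ≤ b)
    (hn : n + sumDown F T n s ≤ b) : ∀ j, (iterDown F n s).val j ≤ b := by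
  induction n generalizing s with
  | zero => simpa [sumDown, iterDown] using hs
  | succ n ih =>
    simp only [sumDown] at hs hn
    refine ih (F n s) (fun j => ?_) (by omega)
    have := h n s (b - sumDown F T n (F n s)) (fun j => by have := hs j; omega) (by omega) j
    have := hs j
    omega

/-- In a unit of time the counters grow by at most one. -/
theorem exec_val_le {w : List A} (p : LoopProg A B R C K) (s : LoopState B R C K) (b : ℕ)
    (hs : ∀ j, s.val j + time w p s ≤ b) : ∀ j, (exec w p s).val j ≤ b := by
  have hupd : ∀ (s : LoopState B R C K) x n, (∀ j, s.val j ≤ b) → n ≤ b →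
      ∀ j, (s.set x n).val j ≤ b := by
    intro s x n h1 h2 j
    rw [LoopState.val_set, Function.update_apply]
    split_ifs
    exacts [h2, h1 j]
  have hs' : ∀ j, s.val j ≤ b := fun j => by have := hs j; omega
  induction p generalizing s b with
  | loc f => exact fun j => hs' j
  | inc x => exact hupd _ _ _ hs' (hs x)
  | dec x => exact hupd _ _ _ hs' (by have := hs' x; omega)
  | copy y x => exact hupd _ _ _ hs' (hs' x)
  | seq p q ihp ihq =>
    rw [exec]
    simp only [time] at hs
    have h1 : ∀ j, (exec w p s).val j ≤ b - time w q (exec w p s) := fun j =>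
      ihp s _ (fun j => by have := hs j; omega)
        (fun s x n h1 h2 j => by
          rw [LoopState.val_set, Function.update_apply]; split_ifs; exacts [h2, h1 j])
        (fun j => by have := hs j; omega) j
    have h2 : ∀ j, (exec w p s).val j + time w q (exec w p s) ≤ b := fun j => by
      have := h1 j; have := hs j; omega
    exact ihq _ b h2 hupd (fun j => by have := h2 j; omega)
  | ite c p q ihp ihq =>
    rw [exec]
    simp only [time] at hs
    revert hs
    cases c (OfflineTM.inputAt w s.pos) s.reg (s.mem s.ptr) <;> intro hs
    · exact ihq s b (fun j => by have := hs j; simp only [cond_false] at this; omega) hupd hs'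
    · exact ihp s b (fun j => by have := hs j; simp only [cond_true] at this; omega) hupd hs'
  | ifz x p q ihp ihq =>
    rw [exec]
    simp only [time] at hs
    split_ifs with h
    · simp only [h, if_true] at hs
      exact ihp s b (fun j => by have := hs j; omega) hupd hs'
    · simp only [h, if_false] at hs
      exact ihq s b (fun j => by have := hs j; omega) hupd hs'
  | loop a x p ih =>
    refine hupd _ _ _ ?_ (Nat.zero_le _)
    simp only [time] at hs
    -- This also bounds the indices assigned to the counter `a`, which are less than the value of
    -- `x`.
    have hx := hs x
    refine iterDown_val_bound (T := fun n s => time w p (s.set a n) + 2) (fun n s b h1 h2 => ?_) _ _ _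
      (fun j => by have := hs j; omega) (by omega)
    have h3 : ∀ j, (s.set a n).val j + time w p (s.set a n) ≤ b := fun j => by
      rw [LoopState.val_set, Function.update_apply]
      split_ifs
      · omega
      · have := h1 j; omega
    exact ih _ b h3 (fun s x n h1 h2 j => by
          rw [LoopState.val_set, Function.update_apply]; split_ifs; exacts [h2, h1 j])
      (fun j => by have := h3 j; omega)

/-! ### Compilation -/

/-- The work tape that holds the counter `x`. -/
abbrev tapeOf (x : Fin (K + 1)) : Fin (K + 3) := x.succ.succ

/-- The test whether a counter is positive. -/
def isPos (x : Fin (K + 1)) : InputSymbol A → (Fin (K + 3) → TapeLetter R C) → Bool :=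
  fun _ g => !decide ((g (tapeOf x)).1.1 = .blank)

/-- Copy a counter, with the help of the reserved counter. -/
def copyProg (y x : Fin (K + 1)) : WhileProg A B (TapeLetter R C) (K + 3) :=
  .seq (.while (isPos y) (.decTape (tapeOf y)))
    (.seq
      (.while (isPos x) (.seq (.decTape (tapeOf x))
        (.seq (.incTape (tapeOf y)) (.incTape (tapeOf 0)))))
      (.while (isPos 0) (.seq (.decTape (tapeOf 0)) (.incTape (tapeOf x)))))

/-- The translation into programs for Turing machines. -/
def compile : LoopProg A B R C K → WhileProg A B (TapeLetter R C) (K + 3)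
  | loc f => .act fun a g =>
    let r := f a (g 1).2.1 (g 0).2.2
    (r.2.2.1, fun i => if i = 0 then (((g i).1, (g i).2.1, r.2.1), r.2.2.2.1)
      else if i = 1 then (((g i).1, r.1, (g i).2.2), .stay) else (g i, .stay), r.2.2.2.2)
  | inc x => .incTape (tapeOf x)
  | dec x => .decTape (tapeOf x)
  | copy y x => copyProg y x
  | seq p q => .seq (compile p) (compile q)
  | ite b p q => .ite (fun a g => b a (g 1).2.1 (g 0).2.2) (compile p) (compile q)
  | ifz x p q => .ite (isPos x) (compile q) (compile p)
  | loop a x p => .seq (copyProg a x) (.while (isPos a) (.seq (.decTape (tapeOf a)) (compile p)))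

/-- The memory `m` represents the state `s`. -/
structure Represents (s : LoopState B R C K) (m : Memory B (TapeLetter R C) (K + 3)) : Prop where
  pos : m.inputHead = s.pos
  out : m.output = s.out
  ptr : m.heads 0 = s.ptr
  mem : ∀ i, (m.work 0 i).2.2 = s.mem i
  regHead : m.heads 1 = 0
  reg : (m.work 1 0).2.1 = s.reg
  heads : ∀ j, m.heads (tapeOf j) = 0
  val : ∀ j, WhileProg.HoldsNat (s.val j) (m.work (tapeOf j))

/-- The condition on the heads: counters use at most `b` cells, and the pointer stays in `Z`. -/
def HeadsOk (b : ℕ) (Z : ℕ → Prop) (h : Fin (K + 3) → ℕ) : Prop :=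
  (∀ j : Fin (K + 1), h (tapeOf j) < b) ∧ h 1 = 0 ∧ Z (h 0)

variable {w : List A} {b : ℕ} {Z : ℕ → Prop}

/-- Conditions under which the programs are executed. -/
structure Fits (w : List A) (b : ℕ) (Z : ℕ → Prop) (s : LoopState B R C K) : Prop where
  val : ∀ j, s.val j + 2 ≤ 2 ^ b
  ptr : Z s.ptr
  pos : s.pos ≤ w.length + 1

theorem Fits.pos_bound {s : LoopState B R C K} (h : Fits w b Z s) : 0 < b := by
  rcases b.eq_zero_or_pos with rfl | hb
  · have := h.val 0; simp at this
  · exact hb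

theorem Fits.set {s : LoopState B R C K} (h : Fits w b Z s) {x : Fin (K + 1)} {n : ℕ}
    (hn : n + 2 ≤ 2 ^ b) : Fits w b Z (s.set x n) where
  val j := by
    rw [LoopState.val_set, Function.update_apply]
    split_ifs
    exacts [hn, h.val j]
  ptr := h.ptr
  pos := h.pos

variable {s : LoopState B R C K} {m : Memory B (TapeLetter R C) (K + 3)}

theorem Represents.ok (h : Represents s m) (hs : Fits w b Z s) :
    WhileProg.Ok w (HeadsOk b Z) m := by
  refine ⟨⟨fun j => ?_, h.regHead, ?_⟩, ?_⟩
  · rw [h.heads]; exact hs.pos_bound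
  · rw [h.ptr]; exact hs.ptr
  · rw [h.pos]; exact hs.pos

theorem tapeOf_ne_zero (x : Fin (K + 1)) : tapeOf x ≠ 0 := Fin.succ_ne_zero _
theorem tapeOf_ne_one (x : Fin (K + 1)) : tapeOf x ≠ 1 := by
  intro h; rw [← Fin.succ_zero_eq_one] at h; exact Fin.succ_ne_zero _ (Fin.succ_injective _ h)

theorem Represents.ok_setTape (h : Represents s m) (hs : Fits w b Z s) (x : Fin (K + 1)) :
    ∀ i < b, ∀ f, WhileProg.Ok w (HeadsOk b Z) (m.setTape (tapeOf x) i f) := by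
  intro i hi f
  have h1 := h.ok hs
  refine ⟨⟨fun j => ?_, ?_, ?_⟩, h1.2⟩
  · simp only [Memory.setTape, Function.update_apply]
    split_ifs
    exacts [hi, h1.1.1 j]
  · simp only [Memory.setTape]
    rw [Function.update_of_ne (tapeOf_ne_one x).symm]; exact h1.1.2.1
  · simp only [Memory.setTape]
    rw [Function.update_of_ne (tapeOf_ne_zero x).symm]; exact h1.1.2.2

theorem Represents.setTape (h : Represents s m) {x : Fin (K + 1)} {n : ℕ}
    {f : ℕ → TapeLetter R C} (hf : WhileProg.HoldsNat n f) :
    Represents (s.set x n) (m.setTape (tapeOf x) 0 f) where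
  pos := h.pos
  out := h.out
  ptr := by
    simp only [Memory.setTape]
    rw [Function.update_of_ne (tapeOf_ne_zero x).symm]; exact h.ptr
  mem := by
    simp only [Memory.setTape]
    rw [Function.update_of_ne (tapeOf_ne_zero x).symm]; exact h.mem
  regHead := by
    simp only [Memory.setTape]
    rw [Function.update_of_ne (tapeOf_ne_one x).symm]; exact h.regHead
  reg := by
    simp only [Memory.setTape]
    rw [Function.update_of_ne (tapeOf_ne_one x).symm]; exact h.reg
  heads j := by
    simp only [Memory.setTape, Function.update_apply]
    split_ifs
    exacts [rfl, h.heads j]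
  val j := by
    simp only [Memory.setTape, LoopState.val_set]
    by_cases hj : j = x
    · subst hj; simpa using hf
    · rw [Function.update_of_ne hj, Function.update_of_ne]
      · exact h.val j
      · exact fun h => hj (Fin.succ_injective _ (Fin.succ_injective _ h))

theorem Represents.isPos (h : Represents s m) (x : Fin (K + 1)) (a : InputSymbol A) :
    isPos x a m.read = decide (s.val x ≠ 0) := by
  have := h.val x 0
  simp [LoopProg.isPos, Memory.read, h.heads, this, digitAt_eq_blank_iff]

/-- The time in which a machine simulates one unit of time. -/
def unit (b : ℕ) : ℕ := 4 * b + 8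

/-- `Simulates w b Z p s T s'`: on every memory that represents `s`, the program `p` ends in at most
`T` steps with a memory that represents `s'`. -/
def Simulates (w : List A) (b : ℕ) (Z : ℕ → Prop) (p : WhileProg A B (TapeLetter R C) (K + 3))
    (s : LoopState B R C K) (T : ℕ) (s' : LoopState B R C K) : Prop :=
  ∀ m, Represents s m → ∃ t ≤ T, ∃ m', WhileProg.Exec w (HeadsOk b Z) p m t m' ∧ Represents s' m'

theorem simulates_incTape (hs : Fits w b Z s) (x : Fin (K + 1)) :
    Simulates w b Z (.incTape (tapeOf x)) s (4 * b + 7) (s.set x (s.val x + 1)) := by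
  intro m hm
  obtain ⟨T, f, h1, h2, h3⟩ := WhileProg.exec_incTape (hm.val x) (hs.val x) (hm.ok_setTape hs x)
  rw [← hm.heads x, Memory.setTape_self, hm.heads] at h1
  exact ⟨T, h2, _, h1, hm.setTape h3⟩

theorem simulates_decTape (hs : Fits w b Z s) (x : Fin (K + 1)) :
    Simulates w b Z (.decTape (tapeOf x)) s (4 * b + 7) (s.set x (s.val x - 1)) := by
  intro m hm
  obtain ⟨T, f, h1, h2, h3⟩ := WhileProg.exec_decTape (hm.val x) (hs.val x) (hm.ok_setTape hs x)
  rw [← hm.heads x, Memory.setTape_self, hm.heads] at h1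
  exact ⟨T, h2, _, h1, hm.setTape h3⟩

theorem Simulates.seq {p q : WhileProg A B (TapeLetter R C) (K + 3)} {s s₁ s' : LoopState B R C K}
    {T T' : ℕ} (hp : Simulates w b Z p s T s₁) (hq : Simulates w b Z q s₁ T' s') :
    Simulates w b Z (.seq p q) s (T + T') s' := by
  intro m hm
  obtain ⟨t, ht, m₁, h1, h2⟩ := hp m hm
  obtain ⟨t', ht', m', h3, h4⟩ := hq m₁ h2
  exact ⟨t + t', by omega, m', .seq h1 h3, h4⟩

theorem Simulates.mono {p : WhileProg A B (TapeLetter R C) (K + 3)} {s s' : LoopState B R C K}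
    {T T' : ℕ} (hp : Simulates w b Z p s T s') (h : T ≤ T') : Simulates w b Z p s T' s' := by
  intro m hm
  obtain ⟨t, ht, m₁, h1, h2⟩ := hp m hm
  exact ⟨t, by omega, m₁, h1, h2⟩

/-- Simulation of a loop that runs until the counter `x` is zero. -/
theorem simulates_while {p : WhileProg A B (TapeLetter R C) (K + 3)} (x : Fin (K + 1))
    (I : ℕ → LoopState B R C K → ℕ → LoopState B R C K → Prop)
    (hfit : ∀ n s T s', I n s T s' → Fits w b Z s ∧ s.val x = n)
    (h0 : ∀ s T s', I 0 s T s' → s' = s)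
    (hI : ∀ n s T s', I (n + 1) s T s' → ∃ T₁ s₁ T₂, Simulates w b Z p s T₁ s₁ ∧ I n s₁ T₂ s' ∧
      T₁ + T₂ + 1 ≤ T)
    (n : ℕ) {s s' : LoopState B R C K} {T : ℕ} (h : I n s T s') :
    Simulates w b Z (.while (isPos x) p) s (T + 1) s' := by
  induction n generalizing s T with
  | zero =>
    obtain rfl := h0 _ _ _ h
    obtain ⟨h1, h2⟩ := hfit _ _ _ _ h
    intro m hm
    refine ⟨1, by omega, m, .while_false (hm.ok h1) ?_, hm⟩
    rw [hm.isPos, h2]; rfl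
  | succ n ih =>
    obtain ⟨h1, h2⟩ := hfit _ _ _ _ h
    obtain ⟨T₁, s₁, T₂, h3, h4, h5⟩ := hI _ _ _ _ h
    intro m hm
    obtain ⟨t, ht, m₁, h6, h7⟩ := h3 m hm
    obtain ⟨t', ht', m', h8, h9⟩ := ih h4 m₁ h7
    refine ⟨_, ?_, m', .while_true (hm.ok h1) ?_ h6 h8, h9⟩
    · omega
    · rw [hm.isPos, h2]; simp

theorem simulates_clear (hs : Fits w b Z s) (y : Fin (K + 1)) :
    Simulates w b Z (.while (isPos y) (.decTape (tapeOf y))) s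
      (s.val y * unit b + 1) (s.set y 0) := by
  refine simulates_while y (fun n s T s' => Fits w b Z s ∧ s.val y = n ∧ T = n * unit b ∧
    s' = s.set y 0) (fun n s T s' h => ⟨h.1, h.2.1⟩) (fun s T s' h => ?_) (fun n s T s' h => ?_)
    (s.val y) ⟨hs, rfl, rfl, rfl⟩
  · rw [h.2.2.2, ← h.2.1, LoopState.set_self]
  · obtain ⟨h1, h2, rfl, rfl⟩ := h
    have := h1.val y
    refine ⟨_, _, n * unit b, simulates_decTape h1 y, ⟨h1.set (by omega), ?_, rfl, ?_⟩, ?_⟩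
    · simp [h2]
    · rw [LoopState.set_set]
    · simp only [unit]; ring_nf; omega

/-- Reading a counter destroys it: `x` is emptied into `y` and the reserved counter simultaneously,
then refilled from the reserved counter. Clearing `y` costs one operation per unit of `y`, and the
two transfers cost three and two per unit of `x`, which explains the coefficients in `time`. -/
theorem simulates_copyProg (hs : Fits w b Z s) (h0 : s.val 0 = 0) {y x : Fin (K + 1)}
    (hy : y ≠ 0) (hx : x ≠ 0) (hyx : y ≠ x) :
    Simulates w b Z (copyProg y x) s ((s.val y + 5 * s.val x + 3) * unit b)
      (s.set y (s.val x)) := by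
  have hb := hs.val
  have h1 := simulates_clear hs y
  have hsy : Fits w b Z (s.set y 0) := hs.set (by have := hb y; omega)
  have h2 : Simulates w b Z (.while (isPos x) (.seq (.decTape (tapeOf x))
        (.seq (.incTape (tapeOf y)) (.incTape (tapeOf 0))))) (s.set y 0) (s.val x * (3 * unit b) + 1)
        (((s.set x 0).set y (s.val x)).set 0 (s.val x)) := by
    -- Invariant of the first transfer: `n` units are left in `x`, and the others are both in `y`
    -- and in the reserved counter.
    refine simulates_while x (fun n s₁ T s' => n ≤ s.val x ∧
      s₁ = ((s.set x n).set y (s.val x - n)).set 0 (s.val x - n) ∧ T = n * (3 * unit b) ∧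
      s' = ((s.set x 0).set y (s.val x)).set 0 (s.val x))
      (fun n s₁ T s' h => ?_) (fun s₁ T s' h => ?_) (fun n s₁ T s' h => ?_) (s.val x)
      ⟨le_rfl, ?_, rfl, rfl⟩
    · obtain ⟨h1, rfl, -, -⟩ := h
      have := hb x
      refine ⟨((hs.set ?_).set ?_).set ?_, ?_⟩
      · omega
      · omega
      · omega
      · simp [Function.update_of_ne hx, Function.update_of_ne hyx.symm]
    · obtain ⟨-, rfl, -, rfl⟩ := h; simp
    · obtain ⟨h1, rfl, rfl, rfl⟩ := h
      have hbx := hb x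
      have e0 := (hs.set (x := x) (n := n + 1) (by omega)).set (x := y) (n := s.val x - (n + 1))
        (by omega)
      have e1 := e0.set (x := 0) (n := s.val x - (n + 1)) (by omega)
      have d1 := simulates_decTape e1 x
      have e2 := e1.set (x := x) (n := n) (by omega)
      have d2 := simulates_incTape e2 y
      have e3 := e2.set (x := y) (n := s.val x - n) (by omega)
      have d3 := simulates_incTape e3 0
      simp only [LoopState.val_set, Function.update_of_ne hx, Function.update_of_ne hyx.symm,
        Function.update_self, Nat.add_sub_cancel] at d1
      simp only [LoopState.val_set, Function.update_of_ne hy, Function.update_of_ne hyx,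
        Function.update_self, show s.val x - (n + 1) + 1 = s.val x - n by omega] at d2
      simp only [LoopState.val_set, Function.update_of_ne hy.symm, Function.update_of_ne hx.symm,
        Function.update_self, show s.val x - (n + 1) + 1 = s.val x - n by omega] at d3
      refine ⟨_, _, _, d1.seq (d2.seq d3), ⟨by omega, ?_, rfl, rfl⟩, ?_⟩
      · simp only [LoopState.set, LoopState.mk.injEq, and_true]
        funext j
        grind [Function.update_apply]
      · simp only [unit]; ring_nf; omega
    · simp only [LoopState.set, LoopState.mk.injEq, and_true]
      funext j
      grind [Function.update_apply]
  have h3 : Simulates w b Z (.while (isPos 0) (.seq (.decTape (tapeOf 0)) (.incTape (tapeOf x))))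
      (((s.set x 0).set y (s.val x)).set 0 (s.val x)) (s.val x * (2 * unit b) + 1)
      (s.set y (s.val x)) := by
    -- Invariant of the second transfer: `n` units are left in the reserved counter, the others are
    -- back in `x`.
    refine simulates_while 0 (fun n s₁ T s' => n ≤ s.val x ∧
      s₁ = ((s.set x (s.val x - n)).set y (s.val x)).set 0 n ∧ T = n * (2 * unit b) ∧
      s' = s.set y (s.val x))
      (fun n s₁ T s' h => ?_) (fun s₁ T s' h => ?_) (fun n s₁ T s' h => ?_) (s.val x)
      ⟨le_rfl, ?_, rfl, rfl⟩
    · obtain ⟨h1, rfl, -, -⟩ := h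
      have := hb x
      refine ⟨((hs.set ?_).set ?_).set ?_, ?_⟩
      · omega
      · omega
      · omega
      · simp
    · obtain ⟨-, rfl, -, rfl⟩ := h
      simp only [LoopState.set, LoopState.mk.injEq, and_true]
      funext j
      grind [Function.update_apply]
    · obtain ⟨h1, rfl, rfl, rfl⟩ := h
      have hbx := hb x
      have e0 := (hs.set (x := x) (n := s.val x - (n + 1)) (by omega)).set (x := y) (n := s.val x)
        (by omega)
      have e1 := e0.set (x := 0) (n := n + 1) (by omega)
      have d1 := simulates_decTape e1 0
      have e2 := e1.set (x := 0) (n := n) (by omega)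
      have d2 := simulates_incTape e2 x
      simp only [LoopState.val_set, Function.update_self, Nat.add_sub_cancel] at d1
      simp only [LoopState.val_set, Function.update_of_ne hx, Function.update_of_ne hyx.symm,
        Function.update_self, show s.val x - (n + 1) + 1 = s.val x - n by omega] at d2
      refine ⟨_, _, _, d1.seq d2, ⟨by omega, ?_, rfl, rfl⟩, ?_⟩
      · simp only [LoopState.set, LoopState.mk.injEq, and_true]
        funext j
        grind [Function.update_apply]
      · simp only [unit]; ring_nf; omega
    · simp
  refine (h1.seq (h2.seq h3)).mono ?_
  simp only [unit]; ring_nf; omega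

theorem simulates_loc (hs : Fits w b Z s)
    (f : InputSymbol A → R → C → R × C × HeadMove × HeadMove × Option B) :
    Simulates w b Z (compile (loc f)) s 1 (exec w (loc f) s) := by
  intro m hm
  refine ⟨1, le_rfl, _, .act (hm.ok hs), ?_⟩
  have e1 : (m.read 1).2.1 = s.reg := by rw [Memory.read, hm.regHead, hm.reg]
  have e2 : (m.read 0).2.2 = s.mem s.ptr := by rw [Memory.read, hm.ptr, hm.mem]
  simp only [e1, e2, hm.pos, exec]
  generalize f (OfflineTM.inputAt w s.pos) s.reg (s.mem s.ptr) = r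
  constructor
  · simp [Memory.apply, LoopState.localStep, hm.pos]
  · simp [Memory.apply, LoopState.localStep, hm.out]
  · simp [Memory.apply, LoopState.localStep, hm.ptr]
  · intro i
    simp only [Memory.apply, LoopState.localStep, if_true, hm.ptr]
    by_cases hi : i = s.ptr
    · subst hi; simp
    · simp [Function.update_of_ne hi, hm.mem]
  · simp [Memory.apply, OfflineTM.moveHead, hm.regHead]
  · simp [Memory.apply, LoopState.localStep, hm.regHead]
  · intro j
    simp [Memory.apply, OfflineTM.moveHead, hm.heads, tapeOf_ne_one]
  · intro j
    simp only [Memory.apply, LoopState.localStep, hm.heads, tapeOf_ne_zero, tapeOf_ne_one, if_false]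
    rw [Memory.read, hm.heads, Function.update_eq_self]
    exact hm.val j

theorem exec_pos_le (p : LoopProg A B R C K) (hs : s.pos ≤ w.length + 1) :
    (exec w p s).pos ≤ w.length + 1 := by
  induction p generalizing s with
  | loc f => exact min_le_right _ _
  | inc x => exact hs
  | dec x => exact hs
  | copy y x => exact hs
  | seq p q ihp ihq => exact ihq (ihp hs)
  | ite c p q ihp ihq =>
    rw [exec]
    cases c (OfflineTM.inputAt w s.pos) s.reg (s.mem s.ptr)
    exacts [ihq hs, ihp hs]
  | ifz x p q ihp ihq =>
    rw [exec]
    split_ifs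
    exacts [ihp hs, ihq hs]
  | loop a x p ih =>
    rw [exec, LoopState.pos_set]
    exact iterDown_invariant (fun n s => exec w p (s.set a n))
      (fun _ (s' : LoopState B R C K) => s'.pos ≤ w.length + 1)
      (fun m _ s' h => ih h) hs

theorem exec_ptr (p : LoopProg A B R C K) (hp : p.KeepsPtr Z) (hs : Z s.ptr) :
    Z (exec w p s).ptr := by
  induction p generalizing s with
  | loc f => exact hp _ _ _ _ hs
  | inc x => exact hs
  | dec x => exact hs
  | copy y x => exact hs
  | seq p q ihp ihq => exact ihq hp.2 (ihp hp.1 hs)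
  | ite c p q ihp ihq =>
    rw [exec]
    cases c (OfflineTM.inputAt w s.pos) s.reg (s.mem s.ptr)
    exacts [ihq hp.2 hs, ihp hp.1 hs]
  | ifz x p q ihp ihq =>
    rw [exec]
    split_ifs
    exacts [ihp hp.1 hs, ihq hp.2 hs]
  | loop a x p ih =>
    rw [exec, LoopState.ptr_set]
    exact iterDown_invariant (fun n s => exec w p (s.set a n))
      (fun _ (s' : LoopState B R C K) => Z s'.ptr) (fun m _ s' h => ih hp h) hs

theorem noWrite_zero {p : LoopProg A B R C K} (hp : p.WellFormed) : p.NoWrite 0 := by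
  induction p <;> simp_all [WellFormed, NoWrite, ne_comm]

/-- A counter gains at most one per unit of time (`exec_val_le`), so bounding initial value plus
running time is enough. -/
theorem fits_exec {p : LoopProg A B R C K} (hZ : p.KeepsPtr Z) (hs : Fits w b Z s)
    (ht : ∀ j, s.val j + time w p s + 2 ≤ 2 ^ b) : Fits w b Z (exec w p s) where
  val j := by
    have := exec_val_le (w := w) p s (2 ^ b - 2) (fun j => by have := ht j; omega) j
    have := ht j
    omega
  ptr := exec_ptr p hZ hs.ptr
  pos := exec_pos_le p hs.pos

/-- The hypothesis `ht` bounds value plus remaining time. This sum does not increase as the program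
proceeds, so the hypothesis is inherited by every subprogram and no intermediate counter outgrows
its `b` cells. -/
theorem simulates_compile {p : LoopProg A B R C K} (hp : p.WellFormed) (hZ : p.KeepsPtr Z)
    (hs : Fits w b Z s) (h0 : s.val 0 = 0) (ht : ∀ j, s.val j + time w p s + 2 ≤ 2 ^ b) :
    Simulates w b Z (compile p) s (time w p s * unit b) (exec w p s) := by
  induction p generalizing s with
  | loc f => exact (simulates_loc hs f).mono (by simp [time, unit])
  | inc x => exact (simulates_incTape hs x).mono (by simp [time, unit])
  | dec x => exact (simulates_decTape hs x).mono (by simp [time, unit])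
  | copy y x => exact simulates_copyProg hs h0 hp.1 hp.2.1 hp.2.2
  | seq p q ihp ihq =>
    simp only [time] at ht
    have h1 := ihp hp.1 hZ.1 hs h0 (fun j => by have := ht j; omega)
    have h2 := ihq hp.2 hZ.2 (s := exec w p s)
      (fits_exec hZ.1 hs (fun j => by have := ht j; omega))
      (by rw [exec_val_of_noWrite (noWrite_zero hp.1), h0])
      (fun j => by
        have := exec_val_le (w := w) p s (2 ^ b - 2 - time w q (exec w p s))
          (fun j => by have := ht j; omega) j
        have := ht j
        omega)
    refine (h1.seq h2).mono ?_
    rw [time, add_mul]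
  | ite c p q ihp ihq =>
    intro m hm
    have e1 : (m.read 1).2.1 = s.reg := by rw [Memory.read, hm.regHead, hm.reg]
    have e2 : (m.read 0).2.2 = s.mem s.ptr := by rw [Memory.read, hm.ptr, hm.mem]
    have hu : 1 ≤ unit b := by simp [unit]
    simp only [time, exec] at ht ⊢
    cases hc : c (OfflineTM.inputAt w s.pos) s.reg (s.mem s.ptr)
    · simp only [hc, cond_false] at ht ⊢
      obtain ⟨t, h1, m', h2, h3⟩ := ihq hp.2 hZ.2 hs h0 (fun j => by have := ht j; omega) m hm
      exact ⟨_, by rw [add_mul]; omega, m', .ite_false (hm.ok hs)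
        (by rw [e1, e2, hm.pos, hc]) h2, h3⟩
    · simp only [hc, cond_true] at ht ⊢
      obtain ⟨t, h1, m', h2, h3⟩ := ihp hp.1 hZ.1 hs h0 (fun j => by have := ht j; omega) m hm
      exact ⟨_, by rw [add_mul]; omega, m', .ite_true (hm.ok hs)
        (by rw [e1, e2, hm.pos, hc]) h2, h3⟩
  | ifz x p q ihp ihq =>
    intro m hm
    have hu : 1 ≤ unit b := by simp [unit]
    simp only [time, exec] at ht ⊢
    by_cases hc : s.val x = 0
    · simp only [hc, if_true] at ht ⊢
      obtain ⟨t, h1, m', h2, h3⟩ := ihp hp.2.1 hZ.1 hs h0 (fun j => by have := ht j; omega) m hm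
      exact ⟨_, by rw [add_mul]; omega, m', .ite_false (hm.ok hs)
        (by rw [hm.isPos, hc]; rfl) h2, h3⟩
    · simp only [hc, if_false] at ht ⊢
      obtain ⟨t, h1, m', h2, h3⟩ := ihq hp.2.2 hZ.2 hs h0 (fun j => by have := ht j; omega) m hm
      exact ⟨_, by rw [add_mul]; omega, m', .ite_true (hm.ok hs)
        (by rw [hm.isPos]; simpa using hc) h2, h3⟩
  | loop a x p ih =>
    obtain ⟨ha0, hx0, hax, hap, hp⟩ := hp
    have h1 := simulates_copyProg hs h0 ha0 hx0 hax
    set F := fun n (s : LoopState B R C K) => exec w p (s.set a n) with hF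
    set T := fun n (s : LoopState B R C K) => time w p (s.set a n) + 2 with hT
    have htime : time w (loop a x p) s = s.val a + 5 * s.val x + 4 + sumDown F T (s.val x) s := rfl
    have hloop : Simulates w b Z (.while (isPos a) (.seq (.decTape (tapeOf a)) (compile p)))
        (s.set a (s.val x)) (sumDown F T (s.val x) s * unit b + 1) (exec w (loop a x p) s) := by
      -- Here `s₀` is the argument of `iterDown`; the value it has at `a` is overwritten and plays
      -- no role in the semantics.
      refine simulates_while a (fun n s₁ T₁ s' => ∃ s₀ : LoopState B R C K, s₁ = s₀.set a n ∧
        Fits w b Z s₁ ∧ s₀.val 0 = 0 ∧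
        (∀ j, s₀.val j + sumDown F T n s₀ + 2 ≤ 2 ^ b) ∧ n + sumDown F T n s₀ + 2 ≤ 2 ^ b ∧
        T₁ = sumDown F T n s₀ * unit b ∧ s' = (iterDown F n s₀).set a 0)
        (fun n s₁ T₁ s' h => ?_) (fun s₁ T₁ s' h => ?_) (fun n s₁ T₁ s' h => ?_) (s.val x)
        ⟨s, rfl, hs.set (hs.val x), h0, ?_, ?_, rfl, rfl⟩
      · obtain ⟨s₀, rfl, h2, -⟩ := h
        exact ⟨h2, by simp⟩
      · obtain ⟨s₀, rfl, h2, -, -, -, -, rfl⟩ := h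
        rfl
      · obtain ⟨s₀, rfl, h2, h3, h4, h5, rfl, rfl⟩ := h
        have hsum : sumDown F T (n + 1) s₀ =
            time w p (s₀.set a n) + 2 + sumDown F T n (F n s₀) := rfl
        rw [hsum] at h4 h5
        have d1 := simulates_decTape h2 a
        simp only [LoopState.val_set, Function.update_self, Nat.add_sub_cancel,
          LoopState.set_set] at d1
        have h6 : Fits w b Z (s₀.set a n) := by
          have := h2.set (x := a) (n := n) (by omega)
          rwa [LoopState.set_set] at this
        have h7 : ∀ j, (s₀.set a n).val j + time w p (s₀.set a n) + 2 +
            sumDown F T n (F n s₀) ≤ 2 ^ b := fun j => by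
          rw [LoopState.val_set, Function.update_apply]
          have := h4 j
          split_ifs <;> omega
        have d2 := ih hp hZ h6 (by simp [Function.update_of_ne ha0.symm, h3])
          (fun j => by have := h7 j; omega)
        -- The body does not write `a`, so after a round the counter still holds `n`, as the next
        -- instance of the invariant demands.
        have hva : (F n s₀).val a = n := by
          rw [hF]; simp only; rw [exec_val_of_noWrite hap]; simp
        have hv : ∀ j, (F n s₀).val j + sumDown F T n (F n s₀) + 2 ≤ 2 ^ b := fun j => by
          have := exec_val_le (w := w) p (s₀.set a n) (2 ^ b - 2 - sumDown F T n (F n s₀))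
            (fun j => by have := h7 j; omega) j
          have := h7 j
          simp only [hF] at *
          omega
        refine ⟨_, _, _, d1.seq d2, ⟨F n s₀, ?_, ?_, ?_, hv, by omega, rfl, rfl⟩, ?_⟩
        · have := LoopState.set_self (F n s₀) a
          rw [hva] at this
          exact this.symm
        · exact fits_exec hZ h6 (fun j => by have := h7 j; omega)
        · simp only [hF]
          rw [exec_val_of_noWrite (noWrite_zero hp)]
          simp [Function.update_of_ne ha0.symm, h3]
        · rw [hsum]; simp only [unit]; ring_nf; omega
      · intro j
        have := ht j
        rw [htime] at this
        omega
      · have := ht x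
        rw [htime] at this
        omega
    refine (h1.seq hloop).mono ?_
    rw [htime]
    simp only [unit]
    ring_nf
    omega

end LoopProg

/-! ### Complete programs, and polynomial bounds -/

namespace LoopProg

variable {A B R C : Type} {K : ℕ}

/-- The test for the right end marker. -/
def isRightEnd : InputSymbol A → Bool
  | .rightEnd => true
  | _ => false

/-- The test for the left end marker. -/
def isLeftEnd : InputSymbol A → Bool
  | .leftEnd => true
  | _ => false

theorem isRightEnd_inputAt (w : List A) (i : ℕ) :
    isRightEnd (OfflineTM.inputAt w i) = decide (w.length < i) := by
  cases i with
  | zero => rfl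
  | succ i =>
    rw [OfflineTM.inputAt]
    by_cases h : i < w.length
    · rw [List.getElem?_eq_getElem h]; simp [isRightEnd]; omega
    · rw [List.getElem?_eq_none (by omega)]; simp [isRightEnd]; omega

theorem isLeftEnd_inputAt (w : List A) (i : ℕ) :
    isLeftEnd (OfflineTM.inputAt w i) = decide (i = 0) := by
  cases i with
  | zero => rfl
  | succ i =>
    rw [OfflineTM.inputAt]
    cases w[i]? <;> simp [isLeftEnd]

/-- The step that moves the input head and does nothing else. -/
def moveInput (d : HeadMove) : LoopProg A B R C K := .loc fun _ r c => (r, c, d, .stay, none)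

/-- The state in which a program is started: the counter `x` holds the number of letters of the
input plus one. -/
def initState (B : Type) (r : R) (c : C) (x : Fin (K + 1)) (w : List A) : LoopState B R C K where
  val := Function.update (fun _ => 0) x (w.length + 1)
  pos := 0
  ptr := 0
  mem := fun _ => c
  reg := r
  out := []

/-- The blank letter for given initial values of the register and of the cells. -/
def blankLetter (r : R) (c : C) : TapeLetter R C := ((.blank, false), r, c)

/-- Mark the first cell of the tapes of the counters. -/
def markHome : WhileProg A B (TapeLetter R C) (K + 3) :=
  .act fun _ g => (.stay, fun i => (((.blank, decide (i ≠ 0 ∧ i ≠ 1)), (g i).2), .stay), none)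

/-- A complete program: measure the input, then execute `p`. -/
def toWhile (x : Fin (K + 1)) (p : LoopProg A B R C K) : WhileProg A B (TapeLetter R C) (K + 3) :=
  .seq markHome
    (.seq (.while (fun a _ => !isRightEnd a)
        (.seq (compile (moveInput .right)) (.incTape (tapeOf x))))
      (.seq (.while (fun a _ => !isLeftEnd a) (compile (moveInput .left))) (compile p)))

variable {w : List A} {b : ℕ} {Z : ℕ → Prop}

/-- The state while the input is measured. -/
def measureState (B : Type) (r : R) (c : C) (x : Fin (K + 1)) (i n : ℕ) : LoopState B R C K where
  val := Function.update (fun _ => 0) x n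
  pos := i
  ptr := 0
  mem := fun _ => c
  reg := r
  out := []

theorem exec_moveInput (d : HeadMove) (s : LoopState B R C K) :
    exec w (moveInput d) s = { s with pos := min (OfflineTM.moveHead d s.pos) (w.length + 1) } := by
  simp [exec, moveInput, LoopState.localStep, OfflineTM.moveHead]

theorem fits_measureState {r : R} {c : C} {x : Fin (K + 1)} (hZ : Z 0)
    (hb : w.length + 3 ≤ 2 ^ b) {i n : ℕ} (hi : i ≤ w.length + 1) (hn : n ≤ w.length + 1) :
    Fits w b Z (measureState B r c x i n) where
  val j := by
    simp only [measureState, Function.update_apply]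
    split_ifs <;> omega
  ptr := hZ
  pos := hi

/-- Blank tapes already represent zeros, apart from the marks of the first cells. Tapes 0 and 1 hold
no counters and stay unmarked. -/
theorem represents_markHome (w : List A) (r : R) (c : C) (x : Fin (K + 1)) (hZ : Z 0) (hb : 0 < b) :
    ∃ m, WhileProg.Exec w (HeadsOk b Z) (markHome (A := A) (B := B) (K := K))
      (WhileProg.initMemory B (K + 3) (blankLetter r c)) 1 m ∧
      Represents (measureState B r c x 0 0) m := by
  refine ⟨_, .act ⟨⟨fun j => hb, rfl, hZ⟩, by simp [WhileProg.initMemory]⟩, ?_⟩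
  constructor
  · simp [Memory.apply, WhileProg.initMemory, OfflineTM.moveHead, measureState]
  · simp [Memory.apply, WhileProg.initMemory, measureState]
  · simp [Memory.apply, WhileProg.initMemory, OfflineTM.moveHead, measureState]
  · intro i
    simp only [Memory.apply, WhileProg.initMemory, measureState, Memory.read, Function.update_apply]
    split_ifs <;> simp [blankLetter]
  · simp [Memory.apply, WhileProg.initMemory, OfflineTM.moveHead]
  · simp [Memory.apply, WhileProg.initMemory, measureState, Memory.read, blankLetter]
  · intro j; simp [Memory.apply, WhileProg.initMemory, OfflineTM.moveHead]
  · intro j i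
    simp only [Memory.apply, WhileProg.initMemory, measureState, Memory.read, Function.update_apply]
    rw [show (if j = x then 0 else 0) = 0 by simp, digitAt_zero_left]
    by_cases hi : i = 0 <;> simp [hi, blankLetter, tapeOf_ne_one]

/-- Induction on the number `k` of moves still to be made. From the left to the right end marker
there are `w.length + 1` moves, hence the value that the counter receives. -/
theorem simulates_measure (r : R) (c : C) {x : Fin (K + 1)} (hZ : Z 0)
    (hb : w.length + 3 ≤ 2 ^ b) : Simulates w b Z (.while (fun a _ => !isRightEnd a)
      (.seq (compile (moveInput .right)) (.incTape (tapeOf x))))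
      (measureState B r c x 0 0) ((w.length + 1) * (unit b + 1) + 1)
      (measureState B r c x (w.length + 1) (w.length + 1)) := by
  suffices h : ∀ k ≤ w.length + 1, Simulates w b Z (.while (fun a _ => !isRightEnd a)
      (.seq (compile (moveInput .right)) (.incTape (tapeOf x))))
      (measureState B r c x (w.length + 1 - k) (w.length + 1 - k)) (k * (unit b + 1) + 1)
      (measureState B r c x (w.length + 1) (w.length + 1)) by
    simpa using h (w.length + 1) le_rfl
  intro k
  induction k with
  | zero =>
    intro _ m hm
    refine ⟨1, by omega, m, .while_false (hm.ok (fits_measureState hZ hb le_rfl le_rfl)) ?_, hm⟩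
    rw [hm.pos, isRightEnd_inputAt]
    simp [measureState]
  | succ k ih =>
    intro hk m hm
    have hf := fits_measureState (B := B) (r := r) (c := c) (x := x) hZ hb
      (i := w.length + 1 - (k + 1)) (n := w.length + 1 - (k + 1)) (by omega) (by omega)
    have h1 := simulates_loc hf (fun _ r c => (r, c, .right, .stay, none))
    change Simulates w b Z (compile (moveInput .right)) _ 1 (exec w (moveInput .right) _) at h1
    rw [exec_moveInput] at h1
    have hf' := fits_measureState (B := B) (r := r) (c := c) (x := x) hZ hb
      (i := w.length + 1 - k) (n := w.length + 1 - (k + 1)) (by omega) (by omega)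
    have e1 : ({ measureState B r c x (w.length + 1 - (k + 1)) (w.length + 1 - (k + 1)) with
        pos := min (OfflineTM.moveHead .right (measureState B r c x (w.length + 1 - (k + 1))
          (w.length + 1 - (k + 1))).pos) (w.length + 1) } : LoopState B R C K) =
        measureState B r c x (w.length + 1 - k) (w.length + 1 - (k + 1)) := by
      simp only [measureState, OfflineTM.moveHead]
      congr 1
      omega
    rw [e1] at h1
    have h2 := simulates_incTape hf' x
    have e2 : (measureState B r c x (w.length + 1 - k) (w.length + 1 - (k + 1))).set x
        ((measureState B r c x (w.length + 1 - k) (w.length + 1 - (k + 1))).val x + 1) =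
        measureState B r c x (w.length + 1 - k) (w.length + 1 - k) := by
      simp only [LoopState.set, measureState, Function.update_self, Function.update_idem]
      congr 2
      omega
    rw [e2] at h2
    obtain ⟨t, h3, m₁, h4, h5⟩ := h1.seq h2 m hm
    obtain ⟨t', h6, m', h7, h8⟩ := ih (by omega) m₁ h5
    refine ⟨_, ?_, m', .while_true (hm.ok hf) ?_ h4 h7, h8⟩
    · simp only [unit] at *; ring_nf at *; omega
    · rw [hm.pos, isRightEnd_inputAt]
      simp [measureState]

theorem simulates_rewind (r : R) (c : C) {x : Fin (K + 1)} (hZ : Z 0)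
    (hb : w.length + 3 ≤ 2 ^ b) : Simulates w b Z (.while (fun a _ => !isLeftEnd a)
      (compile (moveInput .left)))
      (measureState B r c x (w.length + 1) (w.length + 1)) ((w.length + 1) * 2 + 1)
      (initState B r c x w) := by
  suffices h : ∀ k ≤ w.length + 1, Simulates w b Z (.while (fun a _ => !isLeftEnd a)
      (compile (moveInput .left))) (measureState B r c x k (w.length + 1)) (k * 2 + 1)
      (initState B r c x w) from h _ le_rfl
  intro k
  induction k with
  | zero =>
    intro _ m hm
    refine ⟨1, by omega, m, .while_false (hm.ok (fits_measureState hZ hb (by omega) le_rfl)) ?_, hm⟩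
    rw [hm.pos, isLeftEnd_inputAt]
    simp [measureState]
  | succ k ih =>
    intro hk m hm
    have hf := fits_measureState (B := B) (r := r) (c := c) (x := x) hZ hb
      (i := k + 1) (n := w.length + 1) (by omega) (by omega)
    have h1 := simulates_loc hf (fun _ r c => (r, c, .left, .stay, none))
    change Simulates w b Z (compile (moveInput .left)) _ 1 (exec w (moveInput .left) _) at h1
    rw [exec_moveInput] at h1
    have e1 : ({ measureState B r c x (k + 1) (w.length + 1) with
        pos := min (OfflineTM.moveHead .left (measureState B r c x (k + 1)
          (w.length + 1)).pos) (w.length + 1) } : LoopState B R C K) =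
        measureState B r c x k (w.length + 1) := by
      simp only [measureState, OfflineTM.moveHead]
      congr 1
      omega
    rw [e1] at h1
    obtain ⟨t, h3, m₁, h4, h5⟩ := h1 m hm
    obtain ⟨t', h6, m', h7, h8⟩ := ih (by omega) m₁ h5
    refine ⟨_, ?_, m', .while_true (hm.ok hf) ?_ h4 h7, h8⟩
    · omega
    · rw [hm.pos, isLeftEnd_inputAt]
      simp [measureState]

/-- The machine of a program does what the program does. -/
theorem exec_toWhile {r : R} {c : C} {x : Fin (K + 1)} {p : LoopProg A B R C K}
    (hx : x ≠ 0) (hp : p.WellFormed) (hZ : Z 0) (hpZ : p.KeepsPtr Z)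
    (hb : w.length + 1 + time w p (initState B r c x w) + 2 ≤ 2 ^ b) :
    ∃ t ≤ (w.length + 1 + time w p (initState B r c x w) + 4) * (unit b + 3), ∃ m',
      WhileProg.Exec w (HeadsOk b Z) (toWhile x p)
        (WhileProg.initMemory B (K + 3) (blankLetter r c)) t m' ∧
      m'.output = (exec w p (initState B r c x w)).out ∧ HeadsOk b Z m'.heads := by
  have hb' : w.length + 3 ≤ 2 ^ b := by omega
  have hf : Fits w b Z (initState B r c x w) :=
    fits_measureState (i := 0) (n := w.length + 1) hZ hb' (by omega) le_rfl
  have ht : ∀ j, (initState B r c x w).val j + time w p (initState B r c x w) + 2 ≤ 2 ^ b := by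
    intro j
    simp only [initState, Function.update_apply] at hb ⊢
    split_ifs <;> omega
  obtain ⟨m, h1, h2⟩ := represents_markHome (B := B) w r c x hZ hf.pos_bound
  have h3 := (simulates_measure r c (x := x) hZ hb').seq ((simulates_rewind (B := B) r c hZ hb').seq
    (simulates_compile hp hpZ hf (by simp [initState, Function.update_of_ne hx.symm]) ht))
  obtain ⟨t, h4, m', h5, h6⟩ := h3 m h2
  refine ⟨_, ?_, m', .seq h1 h5, h6.out, (h6.ok (fits_exec hpZ hf ht)).1⟩
  have hu : 0 ≤ w.length * unit b := Nat.zero_le _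
  ring_nf at *
  omega

end LoopProg

/-! ### Polynomial bounds -/

/-- A function that is bounded by a polynomial. -/
def PolyBounded (f : ℕ → ℕ) : Prop := ∃ k, ∀ n, f n ≤ (n + k) ^ k

namespace PolyBounded

variable {f g : ℕ → ℕ}

theorem id : PolyBounded fun n => n := ⟨1, fun n => by simp⟩

theorem const (c : ℕ) : PolyBounded fun _ => c := by
  refine ⟨c + 1, fun n => ?_⟩
  calc c ≤ (n + (c + 1)) ^ 1 := by rw [pow_one]; omega
    _ ≤ _ := Nat.pow_le_pow_right (by omega) (by omega)

theorem mul (hf : PolyBounded f) (hg : PolyBounded g) : PolyBounded fun n => f n * g n := by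
  obtain ⟨k, hk⟩ := hf
  obtain ⟨l, hl⟩ := hg
  refine ⟨k + l, fun n => ?_⟩
  rw [pow_add]
  exact Nat.mul_le_mul ((hk n).trans (Nat.pow_le_pow_left (by omega) _))
    ((hl n).trans (Nat.pow_le_pow_left (by omega) _))

/-- The summand 2 in the new constant makes the base at least 2, so one more factor of the base
absorbs the doubling. -/
theorem add (hf : PolyBounded f) (hg : PolyBounded g) : PolyBounded fun n => f n + g n := by
  obtain ⟨k, hk⟩ := hf
  obtain ⟨l, hl⟩ := hg
  refine ⟨k + l + 2, fun n => ?_⟩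
  have h1 : (n + k) ^ k ≤ (n + (k + l + 2)) ^ (k + l) :=
    (Nat.pow_le_pow_left (by omega) _).trans (Nat.pow_le_pow_right (by omega) (by omega))
  have h2 : (n + l) ^ l ≤ (n + (k + l + 2)) ^ (k + l) :=
    (Nat.pow_le_pow_left (by omega) _).trans (Nat.pow_le_pow_right (by omega) (by omega))
  calc f n + g n ≤ (n + (k + l + 2)) ^ (k + l) * 2 := by have := hk n; have := hl n; omega
    _ ≤ (n + (k + l + 2)) ^ (k + l) * (n + (k + l + 2)) := Nat.mul_le_mul_left _ (by omega)
    _ = (n + (k + l + 2)) ^ (k + l + 1) := (pow_succ _ _).symm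
    _ ≤ _ := Nat.pow_le_pow_right (by omega) (by omega)

theorem pow (hf : PolyBounded f) (k : ℕ) : PolyBounded fun n => f n ^ k := by
  induction k with
  | zero => simpa using const 1
  | succ k ih => simpa [pow_succ] using ih.mul hf

theorem eval (p : Polynomial ℕ) : PolyBounded fun n => p.eval n := by
  induction p using Polynomial.induction_on with
  | C a => simpa using const a
  | add p q hp hq => simpa using hp.add hq
  | monomial n a _ => simpa using (const a).mul (id.pow (n + 1))

/-- The logarithm of a polynomially bounded function. -/
theorem le_two_pow (hf : PolyBounded f) : ∃ c, 0 < c ∧ ∀ n, f n ≤ 2 ^ (c * (Nat.log 2 n + 1)) := by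
  obtain ⟨k, hk⟩ := hf
  refine ⟨(k + 1) * k + 1, by omega, fun n => (hk n).trans ?_⟩
  have h1 : n < 2 ^ (Nat.log 2 n + 1) := Nat.lt_pow_succ_log_self (by norm_num) n
  have h2 : k < 2 ^ k := Nat.lt_two_pow_self
  have h3 : n + k ≤ 2 ^ ((k + 1) * (Nat.log 2 n + 1)) := by
    calc n + k ≤ 2 ^ (Nat.log 2 n + 1) * 2 ^ k := by nlinarith
      _ = 2 ^ (Nat.log 2 n + 1 + k) := (pow_add _ _ _).symm
      _ ≤ _ := Nat.pow_le_pow_right (by norm_num) (by nlinarith [Nat.zero_le (k * Nat.log 2 n)])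
  calc (n + k) ^ k ≤ (2 ^ ((k + 1) * (Nat.log 2 n + 1))) ^ k := Nat.pow_le_pow_left h3 k
    _ = 2 ^ ((k + 1) * (Nat.log 2 n + 1) * k) := (pow_mul _ _ _).symm
    _ ≤ _ := Nat.pow_le_pow_right (by norm_num) (by nlinarith)

end PolyBounded

/-! ### From bounded loops to polynomial time and logarithmic space -/

namespace LoopProg

variable {A B R C : Type} {K : ℕ}

/-- A program that runs in polynomial time and computes the characteristic function of a language
shows that the language is in **P**. -/
theorem inP [Finite A] [Finite R] [Finite C] {L : Language A} (r : R) (c : C) {x : Fin (K + 1)} (hx : x ≠ 0)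
    {p : LoopProg A Bool R C K} (hp : p.WellFormed) {T : ℕ → ℕ} (hT : PolyBounded T)
    (h : ∀ w, time w p (initState Bool r c x w) ≤ T w.length)
    (hL : ∀ w, ∃ b, (exec w p (initState Bool r c x w)).out = [b] ∧ (b = true ↔ w ∈ L)) :
    InP L := by
  have hP : PolyBounded fun n => (n + 1 + T n + 4) * (unit (n + 1 + T n + 2) + 3) := by
    have h1 : PolyBounded fun n => n + 1 + T n :=
      (PolyBounded.id.add (PolyBounded.const 1)).add hT
    exact (h1.add (PolyBounded.const 4)).mul
      ((((PolyBounded.const 4).mul (h1.add (PolyBounded.const 2))).add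
        (PolyBounded.const 8)).add (PolyBounded.const 3))
  obtain ⟨k, hk⟩ := hP
  refine ⟨WhileProg.machine (blankLetter r c) (toWhile x p),
    (Polynomial.X + Polynomial.C k) ^ k, fun w => ?_⟩
  -- Since every number is below its own power of two, a polynomial number `b` of cells per counter
  -- surely suffices, and the time bound needs no better.
  obtain ⟨t, ht, m', h1, h2, h3⟩ := exec_toWhile (w := w) (r := r) (c := c)
    (b := w.length + 1 + T w.length + 2) (Z := fun _ => True) hx hp trivial (keepsPtr_true p)
    ((Nat.add_le_add_right (Nat.add_le_add_left (h w) _) _).trans Nat.lt_two_pow_self.le)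
  have h4 := (h1.machine (blank := blankLetter r c) h3).1
    (((Polynomial.X + Polynomial.C k) ^ k : Polynomial ℕ).eval w.length) (by
      refine ht.trans (le_trans ?_ ((hk w.length).trans (by simp)))
      exact Nat.mul_le_mul_right _ (by have := h w; omega))
  obtain ⟨b, hb, hb'⟩ := hL w
  rw [h2, hb] at h4
  convert h4 using 2
  by_cases hw : w ∈ L
  · rw [hb'.2 hw]; simpa using hw
  · have : b = false := by rw [Bool.eq_false_iff]; exact fun h => hw (hb'.1 h)
    rw [this]; simpa using hw

/-- A program that runs in polynomial time and does not move the pointer computes a function in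
deterministic logarithmic space. -/
theorem logSpaceComputable [Finite A] [Finite B] [Finite R] [Finite C] {f : List A → List B} (r : R) (c : C)
    {x : Fin (K + 1)} (hx : x ≠ 0) {p : LoopProg A B R C K} (hp : p.WellFormed)
    (hpZ : p.KeepsPtr (· = 0)) {T : ℕ → ℕ} (hT : PolyBounded T)
    (h : ∀ w, time w p (initState B r c x w) ≤ T w.length)
    (hf : ∀ w, (exec w p (initState B r c x w)).out = f w) :
    LogSpaceComputable f := by
  have hP : PolyBounded fun n => n + 1 + T n + 2 :=
    ((PolyBounded.id.add (PolyBounded.const 1)).add hT).add (PolyBounded.const 2)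
  obtain ⟨k, hk0, hk⟩ := hP.le_two_pow
  refine ⟨WhileProg.machine (blankLetter r c) (toWhile x p), k, fun w => ?_⟩
  -- Logarithmically many cells hold all counter values, and with the pointer confined to 0 the
  -- memory tape contributes a single cell.
  obtain ⟨t, ht, m', h1, h2, h3⟩ := exec_toWhile (w := w) (r := r) (c := c) (Z := (· = 0)) hx hp rfl
    hpZ (le_trans (by have := h w; omega) (hk w.length))
  obtain ⟨h4, h5⟩ := h1.machine (blank := blankLetter r c) h3
  refine ⟨⟨t, ?_⟩, fun i j => ?_⟩
  · rw [← hf, ← h2]; exact h4 t le_rfl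
  · obtain ⟨h6, h7, h8⟩ := h5 i
    have hpos : 0 < k * (Nat.log 2 w.length + 1) := Nat.mul_pos hk0 (by omega)
    change Fin (K + 3) at j
    refine Fin.cases (by rw [h8]; exact hpos) (fun j => ?_) j
    refine Fin.cases ?_ (fun j => h6 j) j
    rw [Fin.succ_zero_eq_one, h7]; exact hpos

/-! ### Static bounds on the running time -/

/-- The counters whose values are increased belong to `X`, and no others depend on them. -/
def Growth (X : Fin (K + 1) → Prop) : LoopProg A B R C K → Prop
  | loc _ => True
  | inc x => X x
  | dec _ => True
  | copy y x => ¬X y ∧ ¬X x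
  | seq p q => Growth X p ∧ Growth X q
  | ite _ p q => Growth X p ∧ Growth X q
  | ifz _ p q => Growth X p ∧ Growth X q
  | loop a x p => ¬X a ∧ ¬X x ∧ Growth X p

/-- A bound on the time if the counters outside of `X` are bounded by `v`. -/
def cost (v : ℕ) : LoopProg A B R C K → ℕ
  | loc _ => 1
  | inc _ => 1
  | dec _ => 1
  | copy _ _ => v + 5 * v + 3
  | seq p q => cost v p + cost v q
  | ite _ p q => 1 + (cost v p + cost v q)
  | ifz _ p q => 1 + (cost v p + cost v q)
  | loop _ _ p => v + 5 * v + 4 + v * (cost v p + 2)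

theorem polyBounded_cost (p : LoopProg A B R C K) : PolyBounded fun v => cost v p := by
  have c := PolyBounded.const
  have i := PolyBounded.id
  induction p with
  | loc f => exact c 1
  | inc x => exact c 1
  | dec x => exact c 1
  | copy y x => exact (i.add ((c 5).mul i)).add (c 3)
  | seq p q ihp ihq => exact ihp.add ihq
  | ite _ p q ihp ihq => exact (c 1).add (ihp.add ihq)
  | ifz _ p q ihp ihq => exact (c 1).add (ihp.add ihq)
  | loop a x p ih => exact ((i.add ((c 5).mul i)).add (c 4)).add (i.mul (ih.add (c 2)))

theorem sumDown_le {S : Type} (F : ℕ → S → S) (T : ℕ → S → ℕ) (I : ℕ → S → Prop) (c : ℕ)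
    {n : ℕ} (hF : ∀ m < n, ∀ s, I (m + 1) s → I m (F m s) ∧ T m s ≤ c) {s : S} (h : I n s) :
    sumDown F T n s ≤ n * c := by
  induction n generalizing s with
  | zero => simp [sumDown]
  | succ n ih =>
    have h1 := hF n (by omega) s h
    have h2 := ih (fun m hm => hF m (by omega)) h1.1
    rw [sumDown]
    linarith

/-- Counters outside of `X` are never incremented and receive copies only from each other, so they
keep the bound `v`; the lengths of all loops and copies are governed by them. -/
theorem growth_bound {w : List A} {X : Fin (K + 1) → Prop} {p : LoopProg A B R C K}
    (hp : p.Growth X) {v : ℕ} {s : LoopState B R C K} (hs : ∀ j, ¬X j → s.val j ≤ v) :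
    (∀ j, ¬X j → (exec w p s).val j ≤ v) ∧ time w p s ≤ cost v p := by
  have hset : ∀ (s : LoopState B R C K) x n, (∀ j, ¬X j → s.val j ≤ v) → (¬X x → n ≤ v) →
      ∀ j, ¬X j → (s.set x n).val j ≤ v := by
    intro s x n h1 h2 j hj
    rw [LoopState.val_set, Function.update_apply]
    split_ifs with h
    exacts [h2 (h ▸ hj), h1 j hj]
  induction p generalizing s with
  | loc f => exact ⟨hs, le_rfl⟩
  | inc x => exact ⟨hset _ _ _ hs fun h => absurd hp h, le_rfl⟩
  | dec x => exact ⟨hset _ _ _ hs fun h => by have := hs x h; omega, le_rfl⟩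
  | copy y x =>
    refine ⟨hset _ _ _ hs fun h => hs x hp.2, ?_⟩
    have h1 := hs y hp.1
    have h2 := hs x hp.2
    simp only [time, cost]
    omega
  | seq p q ihp ihq =>
    obtain ⟨h1, h2⟩ := ihp hp.1 hs
    obtain ⟨h3, h4⟩ := ihq hp.2 h1
    exact ⟨h3, by simp only [time, cost]; omega⟩
  | ite c p q ihp ihq =>
    simp only [time, exec, cost]
    obtain ⟨h1, h2⟩ := ihp hp.1 hs
    obtain ⟨h3, h4⟩ := ihq hp.2 hs
    cases c (OfflineTM.inputAt w s.pos) s.reg (s.mem s.ptr) <;>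
      simp only [cond_true, cond_false]
    exacts [⟨h3, by omega⟩, ⟨h1, by omega⟩]
  | ifz x p q ihp ihq =>
    simp only [time, exec, cost]
    obtain ⟨h1, h2⟩ := ihp hp.1 hs
    obtain ⟨h3, h4⟩ := ihq hp.2 hs
    split_ifs
    exacts [⟨h1, by omega⟩, ⟨h3, by omega⟩]
  | loop a x p ih =>
    obtain ⟨ha, hx, hp⟩ := hp
    have hxv := hs x hx
    have hstep : ∀ m < s.val x, ∀ s' : LoopState B R C K, (∀ j, ¬X j → s'.val j ≤ v) →
        (∀ j, ¬X j → (exec w p (s'.set a m)).val j ≤ v) ∧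
          time w p (s'.set a m) + 2 ≤ cost v p + 2 := by
      intro m hm s' h
      obtain ⟨h1, h2⟩ := ih (s := s'.set a m) hp (hset _ _ _ h fun _ => by omega)
      exact ⟨h1, by omega⟩
    constructor
    · refine hset _ _ _ ?_ fun _ => Nat.zero_le _
      exact iterDown_invariant (fun n s => exec w p (s.set a n))
        (fun _ (s' : LoopState B R C K) => ∀ j, ¬X j → s'.val j ≤ v)
        (fun m hm s' h => (hstep m hm s' h).1) hs
    · simp only [time, cost]
      have h1 := sumDown_le (fun n s => exec w p (s.set a n))
        (fun n s => time w p (s.set a n) + 2)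
        (fun _ (s' : LoopState B R C K) => ∀ j, ¬X j → s'.val j ≤ v) _ hstep hs
      have h2 := Nat.mul_le_mul_right (cost v p + 2) hxv
      have h3 := hs a ha
      omega

end LoopProg

/-! ## Dyck words and balanced paths -/

/-- The words of the Dyck language. -/
inductive IsDyck {n : ℕ} : List (DyckLetter n) → Prop
  | nil : IsDyck []
  | append {u v} : IsDyck u → IsDyck v → IsDyck (u ++ v)
  | bracket (i : Fin n) {u} : IsDyck u → IsDyck ([.opening i] ++ u ++ [.closing i])

/-- The terminal words that arise from a sentential form by replacing the nonterminals by words of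
the Dyck language. -/
inductive DyckExpansion {n : ℕ} : List (Symbol (DyckLetter n) Unit) → List (DyckLetter n) → Prop
  | nil : DyckExpansion [] []
  | terminal (a) {u w} : DyckExpansion u w → DyckExpansion (.terminal a :: u) (a :: w)
  | nonterminal {v u w} : IsDyck v → DyckExpansion u w →
      DyckExpansion (.nonterminal () :: u) (v ++ w)

/-- One derivation step undone: the words chosen for the nonterminals on the right-hand side of the
rule are recombined by the corresponding constructor of `IsDyck`. -/
theorem DyckExpansion.of_rewrites {n : ℕ} {r : ContextFreeRule (DyckLetter n) Unit}
    (hr : r ∈ dyckRules n) {u u' : List (Symbol (DyckLetter n) Unit)} (h : r.Rewrites u u')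
    {w : List (DyckLetter n)} (hw : DyckExpansion u' w) : DyckExpansion u w := by
  induction h generalizing w with
  | head s =>
    simp only [dyckRules, Finset.mem_union, Finset.mem_insert, Finset.mem_singleton,
      Finset.mem_image, Finset.mem_univ, true_and] at hr
    rcases hr with (rfl | rfl) | ⟨i, rfl⟩
    · rcases hw with _ | _ | ⟨h1, hw⟩
      rcases hw with _ | _ | ⟨h2, hw⟩
      rw [← List.append_assoc]
      exact .nonterminal (h1.append h2) hw
    · exact .nonterminal .nil hw
    · rcases hw with _ | ⟨_, hw⟩ | _
      rcases hw with _ | _ | ⟨h2, hw⟩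
      rcases hw with _ | ⟨_, hw⟩ | _
      have := DyckExpansion.nonterminal (h2.bracket i) hw
      simpa using this
  | cons x _ ih =>
    rcases hw with _ | ⟨_, hw⟩ | ⟨h1, hw⟩
    exacts [.terminal _ (ih hw), .nonterminal h1 (ih hw)]

theorem derives_of_isDyck {n : ℕ} {w : List (DyckLetter n)} (h : IsDyck w) :
    (dyckGrammar n).Derives [.nonterminal ()] (w.map .terminal) := by
  have hrule : ∀ r ∈ dyckRules n, (dyckGrammar n).Produces [.nonterminal ()] r.output := by
    intro r hr
    exact ⟨r, hr, by simpa using ContextFreeRule.Rewrites.head (r := r) []⟩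
  induction h with
  | nil =>
    exact .single (hrule ⟨(), []⟩ (by simp [dyckRules]))
  | append _ _ ih₁ ih₂ =>
    have h1 : (dyckGrammar n).Produces [.nonterminal ()] [.nonterminal (), .nonterminal ()] :=
      hrule ⟨(), [.nonterminal (), .nonterminal ()]⟩ (by simp [dyckRules])
    rw [List.map_append]
    exact (ContextFreeGrammar.Produces.single h1).trans
      ((ih₁.append_right [.nonterminal ()]).trans (ih₂.append_left _))
  | bracket i _ ih =>
    have h1 : (dyckGrammar n).Produces [.nonterminal ()]
        [.terminal (.opening i), .nonterminal (), .terminal (.closing i)] :=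
      hrule ⟨(), [.terminal (.opening i), .nonterminal (), .terminal (.closing i)]⟩
        (by simp [dyckRules])
    rw [List.map_append, List.map_append]
    exact (ContextFreeGrammar.Produces.single h1).trans
      ((ih.append_left [.terminal (.opening i)]).append_right [.terminal (.closing i)])

theorem mem_dyckLanguage {n : ℕ} {w : List (DyckLetter n)} : w ∈ dyckLanguage n ↔ IsDyck w := by
  constructor
  · intro h
    -- Induction from the terminal end of the derivation: the terminal word expands to itself, and
    -- expansions are pulled back along each step.
    have key : ∀ u : List (Symbol (DyckLetter n) Unit),
        (dyckGrammar n).Derives u (w.map .terminal) → DyckExpansion u w := by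
      intro u hu
      induction hu using Relation.ReflTransGen.head_induction_on with
      | refl =>
        clear h
        induction w with
        | nil => exact .nil
        | cons a w ih => exact .terminal a ih
      | head h1 _ ih =>
        obtain ⟨r, hr, h1⟩ := h1
        exact .of_rewrites hr h1 ih
    rcases key _ h with _ | _ | ⟨h1, h2⟩
    cases h2
    simpa using h1
  · exact derives_of_isDyck

/-- Paths that are labelled by a word of the Dyck language, in a graph with labelled edges. -/
inductive DyckPath {n : ℕ} {S : Type} (E : S → Option (DyckLetter n) → S → Prop) : S → S → Prop
  | refl (q) : DyckPath E q q
  | eps {q p} : E q none p → DyckPath E q p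
  | trans {q r p} : DyckPath E q r → DyckPath E r p → DyckPath E q p
  | bracket (i) {q q' p' p} : E q (some (.opening i)) q' → DyckPath E q' p' →
      E p' (some (.closing i)) p → DyckPath E q p

/-- The edges of an automaton. -/
def NFADescription.Edge {α : Type} (D : NFADescription α) (q : Fin D.numStates) (o : Option α)
    (p : Fin D.numStates) : Prop := (q, o, p) ∈ D.transitions

section
variable {n : ℕ} (D : NFADescription (DyckLetter n))

theorem DyckPath.of_isPath_replicate {q p : Fin D.numStates} {k : ℕ}
    (h : D.toεNFA.IsPath q p (List.replicate k none)) : DyckPath D.Edge q p := by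
  induction k generalizing q with
  | zero =>
    rw [List.replicate_zero, εNFA.isPath_nil] at h
    rw [h]; exact .refl _
  | succ k ih =>
    rcases h with _ | ⟨t, _, _, _, _, h1, h2⟩
    exact .trans (.eps h1) (ih h2)

/-- The path spells some `x` that becomes `w` after deleting the ε-labels. A decomposition of `w`
lifts to one of `x`, hence of the path, and the ε-labels next to a bracket form ε-paths that are
attached by transitivity. -/
theorem DyckPath.of_isPath {w : List (DyckLetter n)} (hw : IsDyck w) {q p : Fin D.numStates}
    {x : List (Option (DyckLetter n))} (hx : x.reduceOption = w) (h : D.toεNFA.IsPath q p x) :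
    DyckPath D.Edge q p := by
  induction hw generalizing q p x with
  | nil =>
    obtain ⟨k, rfl⟩ := List.reduceOption_eq_nil_iff _ |>.1 hx
    exact .of_isPath_replicate D h
  | append _ _ ih₁ ih₂ =>
    obtain ⟨y, z, rfl, hy, hz⟩ := List.reduceOption_eq_append_iff _ _ _ |>.1 hx
    obtain ⟨r, h1, h2⟩ := (D.toεNFA.isPath_append).1 h
    exact (ih₁ hy h1).trans (ih₂ hz h2)
  | bracket i _ ih =>
    obtain ⟨y, z, rfl, hy, hz⟩ := List.reduceOption_eq_append_iff _ _ _ |>.1 hx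
    obtain ⟨y, y', rfl, hy, hy'⟩ := List.reduceOption_eq_append_iff _ _ _ |>.1 hy
    obtain ⟨k, l, rfl⟩ := List.reduceOption_eq_singleton_iff _ _ |>.1 hy
    obtain ⟨k', l', rfl⟩ := List.reduceOption_eq_singleton_iff _ _ |>.1 hz
    obtain ⟨r, h1, h2⟩ := (D.toεNFA.isPath_append).1 h
    obtain ⟨r', h3, h4⟩ := (D.toεNFA.isPath_append).1 h1
    obtain ⟨s, h5, h6⟩ := (D.toεNFA.isPath_append).1 h3
    obtain ⟨s', h7, h8⟩ := (D.toεNFA.isPath_append).1 h2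
    rcases h6 with _ | ⟨t, _, _, _, _, h9, h10⟩
    rcases h8 with _ | ⟨t', _, _, _, _, h11, h12⟩
    refine .trans (.of_isPath_replicate D h5) (.trans (.bracket i h9 ?_ h11)
      (.of_isPath_replicate D h12))
    exact .trans (.of_isPath_replicate D h10) (.trans (ih hy' h4) (.of_isPath_replicate D h7))

theorem DyckPath.exists_isPath {q p : Fin D.numStates} (h : DyckPath D.Edge q p) :
    ∃ x, IsDyck x.reduceOption ∧ D.toεNFA.IsPath q p x := by
  induction h with
  | refl q => exact ⟨[], .nil, .nil q⟩
  | eps h => exact ⟨[none], .nil, (D.toεNFA.isPath_singleton).2 h⟩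
  | trans _ _ ih₁ ih₂ =>
    obtain ⟨x, h1, h2⟩ := ih₁
    obtain ⟨y, h3, h4⟩ := ih₂
    exact ⟨x ++ y, by rw [List.reduceOption_append]; exact h1.append h3,
      (D.toεNFA.isPath_append).2 ⟨_, h2, h4⟩⟩
  | bracket i h1 _ h2 ih =>
    obtain ⟨x, h3, h4⟩ := ih
    refine ⟨[some (.opening i)] ++ x ++ [some (.closing i)], ?_, ?_⟩
    · rw [List.reduceOption_append, List.reduceOption_append]; exact h3.bracket i
    · exact (D.toεNFA.isPath_append).2 ⟨_, (D.toεNFA.isPath_append).2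
        ⟨_, (D.toεNFA.isPath_singleton).2 h1, h4⟩, (D.toεNFA.isPath_singleton).2 h2⟩

/-- The automata that accept a word of the Dyck language. -/
theorem mem_NRR_dyckLanguage_iff :
    D ∈ NRR (dyckLanguage n) ↔ ∃ p ∈ D.accepting, DyckPath D.Edge D.start p := by
  constructor
  · rintro ⟨w, h1, h2⟩
    obtain ⟨q, p, x, rfl, h4, h5, h6⟩ := (D.toεNFA.mem_accepts_iff_exists_path).1 h1
    exact ⟨p, h4, .of_isPath D (mem_dyckLanguage.1 h2) h5 h6⟩
  · rintro ⟨p, h1, h2⟩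
    obtain ⟨x, h3, h4⟩ := h2.exists_isPath D
    exact ⟨_, (D.toεNFA.mem_accepts_iff_exists_path).2 ⟨_, _, x, rfl, h1, rfl, h4⟩,
      mem_dyckLanguage.2 h3⟩

end

/-! ## Computations as Horn systems on a grid -/

/-- Derivability in a Horn system on the grid `ℕ × ℕ`. A rule speaks about the corners of a unit
square; the base points of the squares are bounded by `N`, and the facts that hold in the row `0`
depend on the letters of the input. -/
inductive HornDerives {A F : Type}
    (Rule : Bool × Bool → F → Bool × Bool → F → Bool × Bool → F → Prop)
    (Ax : InputSymbol A → F → Prop) (w : List A) (N : ℕ) : ℕ → ℕ → F → Prop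
  | ax {i a} : i < N → Ax (OfflineTM.inputAt w i) a → HornDerives Rule Ax w N 0 i a
  | rule {t i o a o₁ a₁ o₂ a₂} : t < N → i < N → Rule o a o₁ a₁ o₂ a₂ →
      HornDerives Rule Ax w N (t + o₁.1.toNat) (i + o₁.2.toNat) a₁ →
      HornDerives Rule Ax w N (t + o₂.1.toNat) (i + o₂.2.toNat) a₂ →
      HornDerives Rule Ax w N (t + o.1.toNat) (i + o.2.toNat) a

/-- The constructor with its coordinates as separate variables, tied by equations that `rfl`
settles, so that applications need not match sums with truth values syntactically. -/
theorem HornDerives.of_rule {A F : Type}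
    {Rule : Bool × Bool → F → Bool × Bool → F → Bool × Bool → F → Prop}
    {Ax : InputSymbol A → F → Prop} {w : List A} {N t i T I T₁ I₁ T₂ I₂ : ℕ}
    {o o₁ o₂ : Bool × Bool} {a a₁ a₂ : F} (ht : t < N) (hi : i < N)
    (hr : Rule o a o₁ a₁ o₂ a₂)
    (h₁ : HornDerives Rule Ax w N T₁ I₁ a₁) (h₂ : HornDerives Rule Ax w N T₂ I₂ a₂)
    (hT : T = t + o.1.toNat := by rfl) (hI : I = i + o.2.toNat := by rfl)
    (hT₁ : T₁ = t + o₁.1.toNat := by rfl) (hI₁ : I₁ = i + o₁.2.toNat := by rfl)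
    (hT₂ : T₂ = t + o₂.1.toNat := by rfl) (hI₂ : I₂ = i + o₂.2.toNat := by rfl) :
    HornDerives Rule Ax w N T I a := by
  subst_vars
  exact .rule ht hi hr h₁ h₂

/-- The facts about the configuration at time `t` and the cells number `i`. -/
inductive TableauFact (Q S : Type) (J : ℕ) : Type
  | state (q : Q)
  | view (m : Fin (J + 1)) (q : Q) (ρ : Fin J → S)
  | head (j : Fin J)
  | home (j : Fin J)
  | left (j : Fin J)
  | right (j : Fin J)
  | cell (j : Fin J) (a : S)
  | sees (j : Fin J) (a : S)
  | origin
  | acc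

instance {Q S : Type} {J : ℕ} [Finite Q] [Finite S] : Finite (TableauFact Q S J) :=
  Finite.of_surjective
    (Sum.elim .state (Sum.elim (fun x => .view x.1 x.2.1 x.2.2)
      (Sum.elim .head (Sum.elim .home (Sum.elim .left (Sum.elim .right
        (Sum.elim (fun x => .cell x.1 x.2) (Sum.elim (fun x => .sees x.1 x.2)
          (fun b => bif b then .origin else .acc)))))))) :
      Q ⊕ (Fin (J + 1) × Q × (Fin J → S)) ⊕ Fin J ⊕ Fin J ⊕ Fin J ⊕ Fin J ⊕ (Fin J × S) ⊕
        (Fin J × S) ⊕ Bool → TableauFact Q S J)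
    (by
      rintro (q | ⟨m, q, ρ⟩ | j | j | j | j | ⟨j, a⟩ | ⟨j, a⟩ | _ | _)
      exacts [⟨.inl q, rfl⟩, ⟨.inr (.inl (m, q, ρ)), rfl⟩, ⟨.inr (.inr (.inl j)), rfl⟩,
        ⟨.inr (.inr (.inr (.inl j))), rfl⟩, ⟨.inr (.inr (.inr (.inr (.inl j)))), rfl⟩,
        ⟨.inr (.inr (.inr (.inr (.inr (.inl j))))), rfl⟩,
        ⟨.inr (.inr (.inr (.inr (.inr (.inr (.inl (j, a))))))), rfl⟩,
        ⟨.inr (.inr (.inr (.inr (.inr (.inr (.inr (.inl (j, a)))))))), rfl⟩,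
        ⟨.inr (.inr (.inr (.inr (.inr (.inr (.inr (.inr true))))))), rfl⟩,
        ⟨.inr (.inr (.inr (.inr (.inr (.inr (.inr (.inr false))))))), rfl⟩])

/-- A transition function of a machine with `J` tapes of one and the same kind; the boolean value
tells whether the step accepts. -/
abbrev UniformDelta (Q S : Type) (J : ℕ) :=
  Q → (Fin J → S) → Option (Q × (Fin J → S × HeadMove) × Bool)

/-! ### The tableau of a computation as a Horn system -/

section Tableau

variable {A Q S : Type} {J : ℕ}

open TableauFact in
/-- The rules that describe the computation of a machine. The corners of the square are the base
point, its neighbour in space `(false, true)`, and their copies one time step later. -/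
inductive TableauRule (δ : UniformDelta Q S J) : Bool × Bool → TableauFact Q S J →
    Bool × Bool → TableauFact Q S J → Bool × Bool → TableauFact Q S J → Prop
  | view_zero (q ρ) : TableauRule δ (false, false) (view 0 q ρ)
      (false, false) (state q) (false, false) (state q)
  | view_succ (m : Fin J) (q ρ) : TableauRule δ (false, false) (view m.succ q ρ)
      (false, false) (view m.castSucc q ρ) (false, false) (sees m (ρ m))
  | state {q ρ r} : δ q ρ = some r → TableauRule δ (true, false) (state r.1)
      (false, false) (view (Fin.last J) q ρ) (false, false) (view (Fin.last J) q ρ)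
  | sees_head (j a) : TableauRule δ (false, false) (sees j a)
      (false, false) (head j) (false, false) (cell j a)
  | sees_left (j a) : TableauRule δ (false, false) (sees j a)
      (false, true) (sees j a) (false, true) (sees j a)
  | sees_right (j a) : TableauRule δ (false, true) (sees j a)
      (false, false) (sees j a) (false, false) (sees j a)
  | head_stay {q ρ r} (j) : δ q ρ = some r → (r.2.1 j).2 = .stay →
      TableauRule δ (true, false) (head j)
        (false, false) (view (Fin.last J) q ρ) (false, false) (head j)
  | head_right {q ρ r} (j) : δ q ρ = some r → (r.2.1 j).2 = .right →
      TableauRule δ (true, true) (head j)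
        (false, false) (view (Fin.last J) q ρ) (false, false) (head j)
  | head_left {q ρ r} (j) : δ q ρ = some r → (r.2.1 j).2 = .left →
      TableauRule δ (true, false) (head j)
        (false, false) (view (Fin.last J) q ρ) (false, true) (head j)
  | home (j) : TableauRule δ (false, false) (home j)
      (false, false) (head j) (false, false) origin
  | head_home {q ρ r} (j) : δ q ρ = some r → (r.2.1 j).2 = .left →
      TableauRule δ (true, false) (head j)
        (false, false) (view (Fin.last J) q ρ) (false, false) (home j)
  | write {q ρ r} (j) : δ q ρ = some r → TableauRule δ (true, false) (cell j (r.2.1 j).1)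
        (false, false) (view (Fin.last J) q ρ) (false, false) (head j)
  | keep_left (j a) : TableauRule δ (true, false) (cell j a)
      (false, false) (left j) (false, false) (cell j a)
  | keep_right (j a) : TableauRule δ (true, false) (cell j a)
      (false, false) (right j) (false, false) (cell j a)
  | left_head (j) : TableauRule δ (false, true) (left j)
      (false, false) (head j) (false, false) (head j)
  | left_left (j) : TableauRule δ (false, true) (left j)
      (false, false) (left j) (false, false) (left j)
  | right_head (j) : TableauRule δ (false, false) (right j)
      (false, true) (head j) (false, true) (head j)
  | right_right (j) : TableauRule δ (false, false) (right j)
      (false, true) (right j) (false, true) (right j)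
  | origin : TableauRule δ (true, false) origin (false, false) origin (false, false) origin
  | acc_now {q ρ r} : δ q ρ = some r → r.2.2 = true → TableauRule δ (false, false) acc
      (false, false) (view (Fin.last J) q ρ) (false, false) (view (Fin.last J) q ρ)
  | acc_later : TableauRule δ (false, false) acc (true, false) acc (true, false) acc

open TableauFact in
/-- The facts that hold at time `0`. -/
inductive TableauAxiom (q₀ : Q) (ini : Fin J → InputSymbol A → S) :
    InputSymbol A → TableauFact Q S J → Prop
  | state (a) : TableauAxiom q₀ ini a (state q₀)
  | head (j) : TableauAxiom q₀ ini .leftEnd (head j)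
  | cell (j a) : TableauAxiom q₀ ini a (cell j (ini j a))
  | origin : TableauAxiom q₀ ini .leftEnd origin

/-- A computation, which repeats its last configuration forever if it ends. -/
structure UniformTrace (δ : UniformDelta Q S J) (q₀ : Q) (ini : Fin J → InputSymbol A → S)
    (w : List A) where
  state : ℕ → Q
  head : ℕ → Fin J → ℕ
  tape : ℕ → Fin J → ℕ → S
  state_zero : state 0 = q₀
  head_zero : ∀ j, head 0 j = 0
  tape_zero : ∀ j i, tape 0 j i = ini j (OfflineTM.inputAt w i)
  next_none : ∀ t, δ (state t) (fun j => tape t j (head t j)) = none →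
    tape (t + 1) = tape t
  next_some : ∀ t r, δ (state t) (fun j => tape t j (head t j)) = some r →
    state (t + 1) = r.1 ∧ (∀ j, head (t + 1) j = OfflineTM.moveHead (r.2.1 j).2 (head t j)) ∧
    ∀ j, tape (t + 1) j = Function.update (tape t j) (head t j) (r.2.1 j).1

namespace UniformTrace

variable {δ : UniformDelta Q S J} {q₀ : Q} {ini : Fin J → InputSymbol A → S} {w : List A}
  (c : UniformTrace δ q₀ ini w)

/-- The letters under the heads. -/
def read (t : ℕ) : Fin J → S := fun j => c.tape t j (c.head t j)

/-- The step at time `t` accepts. -/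
def AcceptsAt (t : ℕ) : Prop := ∃ r, δ (c.state t) (c.read t) = some r ∧ r.2.2 = true

/-- The meaning of the facts. -/
def Holds (t i : ℕ) : TableauFact Q S J → Prop
  | .state q => c.state t = q
  | .view m q ρ => c.state t = q ∧ ∀ j : Fin J, j.castSucc < m → c.read t j = ρ j
  | .head j => c.head t j = i
  | .home j => c.head t j = i ∧ i = 0
  | .left j => c.head t j < i
  | .right j => i < c.head t j
  | .cell j a => c.tape t j i = a
  | .sees j a => c.read t j = a
  | .origin => i = 0
  | .acc => ∃ t', t ≤ t' ∧ c.AcceptsAt t'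

/-- Because of `next_none` this also covers a halted machine, which makes `keep_left` and
`keep_right` sound without a premise saying that a step is made. -/
theorem tape_succ_of_ne (t : ℕ) (j : Fin J) {i : ℕ} (h : i ≠ c.head t j) :
    c.tape (t + 1) j i = c.tape t j i := by
  cases hd : δ (c.state t) (fun j => c.tape t j (c.head t j)) with
  | none => rw [c.next_none t hd]
  | some r => rw [(c.next_some t r hd).2.2, Function.update_of_ne h]

theorem holds_view_last {t i : ℕ} {q : Q} {ρ : Fin J → S}
    (h : c.Holds t i (.view (Fin.last J) q ρ)) {r} (hr : δ q ρ = some r) :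
    δ (c.state t) (c.read t) = some r := by
  obtain ⟨rfl, h2⟩ := h
  rw [show c.read t = ρ from funext fun j => h2 j (Fin.castSucc_lt_last j)]
  exact hr

/-- Soundness, for every `N`: all axioms and rules are true under the reading `Holds`. Horn clauses
cannot say that a head is not at a cell; the facts `left` and `right` express this positively. -/
theorem holds_of_derives {N t i : ℕ} {a : TableauFact Q S J}
    (h : HornDerives (TableauRule δ) (TableauAxiom q₀ ini) w N t i a) : c.Holds t i a := by
  induction h with
  | @ax i a hi h =>
    have h0 : OfflineTM.inputAt w i = .leftEnd → i = 0 := by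
      cases i with
      | zero => exact fun _ => rfl
      | succ i => rw [OfflineTM.inputAt]; cases w[i]? <;> exact nofun
    generalize hs : OfflineTM.inputAt w i = s at h
    cases h with
    | state a => exact c.state_zero
    | head j => exact (c.head_zero j).trans (h0 hs).symm
    | cell j => rw [← hs]; exact c.tape_zero j i
    | origin => exact h0 hs
  | @rule t i o a o₁ a₁ o₂ a₂ _ _ hr _ _ h1 h2 =>
    cases hr with
    | view_zero q ρ => exact ⟨h1, fun j hj => absurd hj (Fin.not_lt_zero _)⟩
    | view_succ m q ρ =>
      refine ⟨h1.1, fun j hj => ?_⟩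
      rcases (Fin.le_castSucc_iff.2 hj).lt_or_eq with h | h
      · exact h1.2 j h
      · rw [Fin.castSucc_injective _ h]; exact h2
    | state h => exact (c.next_some t _ (c.holds_view_last h1 h)).1
    | sees_head j a =>
      have h1 : c.head t j = i := h1
      have h2 : c.tape t j i = a := h2
      change c.read t j = a
      rw [UniformTrace.read, h1, h2]
    | sees_left j a => exact h1
    | sees_right j a => exact h1
    | head_stay j h hm =>
      have := (c.next_some t _ (c.holds_view_last h1 h)).2.1 j
      rw [hm] at this
      exact this.trans h2
    | head_right j h hm =>
      have := (c.next_some t _ (c.holds_view_last h1 h)).2.1 j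
      rw [hm] at this
      exact this.trans (congrArg (· + 1) h2)
    | head_left j h hm =>
      have := (c.next_some t _ (c.holds_view_last h1 h)).2.1 j
      rw [hm] at this
      exact this.trans (congrArg (· - 1) h2)
    | home j => exact ⟨h1, h2⟩
    | head_home j h hm =>
      have := (c.next_some t _ (c.holds_view_last h1 h)).2.1 j
      rw [hm] at this
      have h3 : c.head t j = i := h2.1
      have h4 : i = 0 := h2.2
      refine this.trans ?_
      rw [h3, h4]; rfl
    | write j h =>
      have h3 := (c.next_some t _ (c.holds_view_last h1 h)).2.2 j
      have h2 : c.head t j = i := h2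
      change c.tape (t + 1) j i = _
      rw [h3, h2, Function.update_self]
    | keep_left j a =>
      have h1 : c.head t j < i := h1
      exact (c.tape_succ_of_ne t j h1.ne').trans h2
    | keep_right j a =>
      have h1 : i < c.head t j := h1
      exact (c.tape_succ_of_ne t j h1.ne).trans h2
    | left_head j =>
      have h1 : c.head t j = i := h1
      change c.head t j < i + 1
      omega
    | left_left j =>
      have h1 : c.head t j < i := h1
      change c.head t j < i + 1
      omega
    | right_head j =>
      have h1 : c.head t j = i + 1 := h1
      change i < c.head t j
      omega
    | right_right j =>
      have h1 : i + 1 < c.head t j := h1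
      change i < c.head t j
      omega
    | origin => exact h1
    | acc_now h ha => exact ⟨t, le_rfl, _, c.holds_view_last h1 h, ha⟩
    | acc_later =>
      obtain ⟨t', h3, h4⟩ := h1
      exact ⟨t', (Nat.le_succ t).trans h3, h4⟩

/-- The facts from which all others at the same time follow. -/
structure Derived (N t : ℕ) : Prop where
  state : ∀ i < N, HornDerives (TableauRule δ) (TableauAxiom q₀ ini) w N t i (.state (c.state t))
  head : ∀ j, HornDerives (TableauRule δ) (TableauAxiom q₀ ini) w N t (c.head t j) (.head j)
  cell : ∀ j, ∀ i < N,
    HornDerives (TableauRule δ) (TableauAxiom q₀ ini) w N t i (.cell j (c.tape t j i))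
  origin : HornDerives (TableauRule δ) (TableauAxiom q₀ ini) w N t 0 .origin
  head_le : ∀ j, c.head t j ≤ t

variable {c} {N t : ℕ}

theorem derived_zero (hN : 0 < N) : c.Derived N 0 where
  state i hi := .ax hi (by rw [c.state_zero]; exact .state _)
  head j := .ax (by rw [c.head_zero]; exact hN) (by rw [c.head_zero]; exact .head j)
  cell j i hi := .ax hi (by rw [c.tape_zero]; exact .cell j _)
  origin := .ax hN .origin
  head_le j := (c.head_zero j).le

/-- The letter is known at the cell of the head and is carried along the row in both directions, so
that it becomes available to the local rules at every cell. -/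
theorem Derived.sees (h : c.Derived N t) (ht : t < N) (j : Fin J) : ∀ i < N,
    HornDerives (TableauRule δ) (TableauAxiom q₀ ini) w N t i (.sees j (c.read t j)) := by
  have hj : c.head t j < N := (h.head_le j).trans_lt ht
  have h0 : HornDerives (TableauRule δ) (TableauAxiom q₀ ini) w N t (c.head t j)
      (.sees j (c.read t j)) :=
    .of_rule ht hj (.sees_head j _) (h.head j) (h.cell j _ hj)
  intro i hi
  rcases le_total (c.head t j) i with hl | hl
  · induction i, hl using Nat.le_induction with
    | base => exact h0
    | succ i _ ih =>
      have := ih (by omega)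
      exact .of_rule (i := i) ht (by omega) (.sees_right j _) this this
  · induction hl using Nat.decreasingInduction with
    | self => exact h0
    | of_succ i hi' ih =>
      have := ih (by omega)
      exact .of_rule ht hi (.sees_left j _) this this

theorem Derived.left (h : c.Derived N t) (ht : t < N) (j : Fin J) {i : ℕ} (hi : i < N)
    (hl : c.head t j < i) :
    HornDerives (TableauRule δ) (TableauAxiom q₀ ini) w N t i (.left j) := by
  induction i, Nat.succ_le_of_lt hl using Nat.le_induction with
  | base => exact .of_rule (i := c.head t j) ht (by omega) (.left_head j) (h.head j) (h.head j)
  | succ i hi' ih =>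
    have := ih (by omega) (by omega)
    exact .of_rule (i := i) ht (by omega) (.left_left j) this this

theorem Derived.right (h : c.Derived N t) (ht : t < N) (j : Fin J) {i : ℕ}
    (hl : i < c.head t j) :
    HornDerives (TableauRule δ) (TableauAxiom q₀ ini) w N t i (.right j) := by
  have hj : c.head t j < N := (h.head_le j).trans_lt ht
  obtain ⟨m, hm⟩ : ∃ m, c.head t j = m + 1 := ⟨c.head t j - 1, by omega⟩
  have h0 := h.head j
  rw [hm] at h0
  have hl : i ≤ m := by omega
  induction hl using Nat.decreasingInduction with
  | self => exact .of_rule (i := m) ht (by omega) (.right_head j) h0 h0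
  | of_succ i hi' ih =>
    have := ih (by omega)
    exact .of_rule (i := i) ht (by omega) (.right_right j) this this

/-- A rule has only two premises, so the letters under the heads are collected one tape at a time.
-/
theorem Derived.view (h : c.Derived N t) (ht : t < N) {i : ℕ} (hi : i < N) :
    HornDerives (TableauRule δ) (TableauAxiom q₀ ini) w N t i
      (.view (Fin.last J) (c.state t) (c.read t)) := by
  suffices ∀ m, HornDerives (TableauRule δ) (TableauAxiom q₀ ini) w N t i
      (.view m (c.state t) (c.read t)) from this _
  intro m
  induction m using Fin.induction with
  | zero => exact .of_rule ht hi (.view_zero _ _) (h.state i hi) (h.state i hi)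
  | succ m ih => exact .of_rule ht hi (.view_succ m _ _) ih (h.sees ht m i hi)

theorem Derived.succ (h : c.Derived N t) (ht : t < N) {r}
    (hr : δ (c.state t) (c.read t) = some r) : c.Derived N (t + 1) := by
  obtain ⟨h1, h2, h3⟩ := c.next_some t r hr
  have hN : ∀ j, c.head t j < N := fun j => (h.head_le j).trans_lt ht
  refine ⟨fun i hi => ?_, fun j => ?_, fun j i hi => ?_, ?_, fun j => ?_⟩
  · rw [h1]
    exact .of_rule ht hi (.state hr) (h.view ht hi) (h.view ht hi)
  · rw [h2]
    have hj := hN j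
    have h4 := h.head j
    cases hm : (r.2.1 j).2 with
    | stay => exact .of_rule ht hj (.head_stay j hr hm) (h.view ht hj) h4
    | right => exact .of_rule ht hj (.head_right j hr hm) (h.view ht hj) h4
    | left =>
      -- A left move from cell 0 stays there and has no cell to come from, hence the extra rule
      -- `head_home`, for which `origin` identifies the cell.
      cases hc : c.head t j with
      | zero =>
        rw [hc] at h4 hj
        exact .of_rule ht hj (.head_home j hr hm) (h.view ht hj)
          (.of_rule ht hj (.home j) h4 h.origin)
      | succ i =>
        rw [hc] at h4 hj
        have hi : i < N := by omega
        exact .of_rule ht hi (.head_left j hr hm) (h.view ht hi) h4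
  · by_cases hi' : i = c.head t j
    · subst hi'
      rw [h3, Function.update_self]
      exact .of_rule ht hi (.write j hr) (h.view ht hi) (h.head j)
    · rw [c.tape_succ_of_ne t j hi']
      rcases lt_or_gt_of_ne hi' with hl | hl
      · exact .of_rule ht hi (.keep_right j _) (h.right ht j hl) (h.cell j i hi)
      · exact .of_rule ht hi (.keep_left j _) (h.left ht j hi hl) (h.cell j i hi)
  · exact .of_rule (i := 0) ht (by omega) .origin h.origin h.origin
  · rw [h2]
    have := h.head_le j
    cases (r.2.1 j).2 <;> simp only [OfflineTM.moveHead] <;> omega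

variable (c) in
/-- Acceptance is derivable if and only if it happens. -/
theorem derives_acc_iff (hN : ∀ t, c.AcceptsAt t → t < N ∧
    ∀ t' < t, δ (c.state t') (c.read t') ≠ none) :
    HornDerives (TableauRule δ) (TableauAxiom q₀ ini) w N 0 0 .acc ↔ ∃ t, c.AcceptsAt t := by
  constructor
  · intro h
    obtain ⟨t, -, ht⟩ := c.holds_of_derives h
    exact ⟨t, ht⟩
  · rintro ⟨t, ht⟩
    obtain ⟨hlt, hd⟩ := hN t ht
    -- No step before the accepting one is missing, so the complete description propagates up to
    -- time `t`.
    have hder : ∀ t' ≤ t, c.Derived N t' := by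
      intro t' ht'
      induction t' with
      | zero => exact derived_zero (by omega)
      | succ t' ih =>
        obtain ⟨r, hr⟩ := Option.ne_none_iff_exists'.1 (hd t' (by omega))
        exact (ih (by omega)).succ (by omega) hr
    -- Acceptance is carried backwards in time, so that the goal sits at a point that does not
    -- depend on the computation.
    suffices ∀ t' ≤ t, HornDerives (TableauRule δ) (TableauAxiom q₀ ini) w N t' 0 .acc from
      this 0 (Nat.zero_le _)
    intro t' ht'
    induction ht' using Nat.decreasingInduction with
    | self =>
      obtain ⟨r, hr, ha⟩ := ht
      have := (hder t le_rfl).view hlt (i := 0) (by omega)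
      exact .of_rule (i := 0) hlt (by omega) (.acc_now hr ha) this this
    | of_succ t' ht' ih => exact .of_rule (t := t') (i := 0) (by omega) (by omega) .acc_later ih ih

end UniformTrace

end Tableau

/-! ### Deciders as computations with tapes of one kind -/

namespace OfflineTM

variable {A : Type} (M : OfflineTM A Bool)

open Classical in
/-- A move of the machine, the input tape being treated like the work tapes. -/
noncomputable def uniformMove {Q Γ : Type} {k : ℕ} (a : InputSymbol A)
    (r : Q × HeadMove × (Fin k → Γ × HeadMove) × Option Bool) :
    Q × (Fin (k + 1) → (InputSymbol A ⊕ Γ) × HeadMove) × Bool :=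
  (r.1, Fin.cons (.inl a, if a = .rightEnd ∧ r.2.1 = .right then .stay else r.2.1)
    (fun j => (.inr (r.2.2.1 j).1, (r.2.2.1 j).2)), decide (r.2.2.2 = some true))

/-- The transition function of a machine, the input tape being treated like the work tapes. -/
noncomputable def uniformDelta : UniformDelta M.Q (InputSymbol A ⊕ M.Γ) (M.tapes + 1) :=
  fun q ρ => (ρ 0).elim
    (fun a => (M.δ q a fun j => (ρ j.succ).elim (fun _ => M.blank) id).map (uniformMove a))
    (fun _ => none)

/-- The initial contents of the tapes. -/
def uniformInit : Fin (M.tapes + 1) → InputSymbol A → InputSymbol A ⊕ M.Γ :=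
  Fin.cons .inl fun _ _ => .inr M.blank

variable {M} (w : List A)

theorem inputHead_cfgAt_le (t : ℕ) : (M.cfgAt w t).inputHead ≤ w.length + 1 := by
  induction t with
  | zero => exact Nat.zero_le _
  | succ t ih =>
    rw [cfgAt, step]
    split
    · exact ih
    · exact min_le_right _ _

theorem uniformDelta_apply (q : M.Q) (a : InputSymbol A) (g : Fin M.tapes → M.Γ) :
    M.uniformDelta q (Fin.cons (.inl a) fun j => .inr (g j)) =
      (M.δ q a g).map (uniformMove a) := by
  simp [uniformDelta]

/-- The letters read at time `t`. -/
def workRead (t : ℕ) : Fin M.tapes → M.Γ :=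
  fun j => (M.cfgAt w t).work j ((M.cfgAt w t).heads j)

/-- The move that the machine makes at time `t`. -/
def moveAt (t : ℕ) : Option (M.Q × HeadMove × (Fin M.tapes → M.Γ × HeadMove) × Option Bool) :=
  M.δ (M.cfgAt w t).state (inputAt w (M.cfgAt w t).inputHead) (M.workRead w t)

theorem cfgAt_succ_of_none {t : ℕ} (h : M.moveAt w t = none) : M.cfgAt w (t + 1) = M.cfgAt w t := by
  rw [cfgAt, step]
  unfold moveAt workRead at h
  rw [h]; rfl

theorem cfgAt_succ_of_some {t : ℕ} {r} (h : M.moveAt w t = some r) : M.cfgAt w (t + 1) =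
    { state := r.1
      inputHead := min (moveHead r.2.1 (M.cfgAt w t).inputHead) (w.length + 1)
      heads := fun j => moveHead (r.2.2.1 j).2 ((M.cfgAt w t).heads j)
      work := fun j => Function.update ((M.cfgAt w t).work j) ((M.cfgAt w t).heads j) (r.2.2.1 j).1
      output := (M.cfgAt w t).output ++ r.2.2.2.toList } := by
  rw [cfgAt, step]
  unfold moveAt workRead at h
  rw [h]; rfl

/-- The heads, including the input head. -/
def uniformHead (t : ℕ) : Fin (M.tapes + 1) → ℕ :=
  Fin.cons (M.cfgAt w t).inputHead (M.cfgAt w t).heads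

/-- The tapes, including the input tape. -/
def uniformTape (t : ℕ) : Fin (M.tapes + 1) → ℕ → InputSymbol A ⊕ M.Γ :=
  Fin.cons (fun i => .inl (inputAt w i)) fun j i => .inr ((M.cfgAt w t).work j i)

theorem uniformDelta_cfgAt (t : ℕ) : M.uniformDelta (M.cfgAt w t).state
    (fun j => M.uniformTape w t j (M.uniformHead w t j)) =
      (M.moveAt w t).map (uniformMove (inputAt w (M.cfgAt w t).inputHead)) := by
  rw [moveAt, ← uniformDelta_apply]
  congr 1
  funext j
  refine Fin.cases rfl (fun j => rfl) j

theorem inputAt_eq_rightEnd_iff (i : ℕ) : inputAt w i = .rightEnd ↔ w.length < i := by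
  cases i with
  | zero => simp [inputAt]
  | succ i =>
    rw [inputAt]
    by_cases h : i < w.length
    · rw [List.getElem?_eq_getElem h]; simp; omega
    · rw [List.getElem?_eq_none (by omega)]; simp; omega

/-- The computation of a machine on the input `w`. -/
noncomputable def trace : UniformTrace M.uniformDelta M.start M.uniformInit w where
  state t := (M.cfgAt w t).state
  head := M.uniformHead w
  tape := M.uniformTape w
  state_zero := rfl
  head_zero j := by refine Fin.cases rfl (fun j => rfl) j
  tape_zero j i := by refine Fin.cases rfl (fun j => rfl) j
  next_none t h := by
    rw [uniformDelta_cfgAt, Option.map_eq_none_iff] at h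
    rw [uniformTape, cfgAt_succ_of_none w h, uniformTape]
  next_some t r h := by
    rw [uniformDelta_cfgAt, Option.map_eq_some_iff] at h
    obtain ⟨r', h, rfl⟩ := h
    have hs := cfgAt_succ_of_some w h
    refine ⟨by rw [hs]; rfl, fun j => ?_, fun j => ?_⟩
    · refine Fin.cases ?_ (fun j => ?_) j
      · have h1 := inputHead_cfgAt_le (M := M) w t
        have h2 := inputAt_eq_rightEnd_iff w (M.cfgAt w t).inputHead
        rw [uniformHead, hs]
        simp only [uniformMove, Fin.cons_zero, uniformHead, h2]
        cases hm : r'.2.1 <;> simp only [moveHead, reduceCtorEq, and_false, if_false, and_true]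
        · omega
        · omega
        -- The machine clips its input head at the right end marker; `uniformMove` achieves the same
        -- by turning the move into `stay`.
        · by_cases hl : w.length < (M.cfgAt w t).inputHead
          · rw [if_pos ⟨h2.2 hl, rfl⟩]; simp only; omega
          · rw [if_neg fun h => hl (h2.1 h.1)]; simp only; omega
      · rw [uniformHead, hs]; rfl
    · refine Fin.cases ?_ (fun j => ?_) j
      · simp [uniformTape, uniformHead, uniformMove]
      · rw [uniformTape, hs]
        simp only [uniformTape, uniformHead, uniformMove, Fin.cons_succ]
        funext i
        simp only [Function.update_apply]
        split_ifs <;> rfl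

theorem acceptsAt_trace_iff (t : ℕ) :
    (M.trace w).AcceptsAt t ↔ ∃ r, M.moveAt w t = some r ∧ r.2.2.2 = some true := by
  unfold UniformTrace.AcceptsAt
  have h : M.uniformDelta ((M.trace w).state t) ((M.trace w).read t) = _ := uniformDelta_cfgAt w t
  rw [h]
  simp [uniformMove]

/-- The output only grows, one letter per step at most, so the presence of `true` is witnessed by
the single step that printed it. -/
theorem mem_output_iff (t : ℕ) :
    true ∈ (M.cfgAt w t).output ↔ ∃ t' < t, (M.trace w).AcceptsAt t' := by
  induction t with
  | zero => simp [cfgAt, init]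
  | succ t ih =>
    simp only [Nat.lt_succ_iff_lt_or_eq, or_and_right, exists_or, exists_eq_left]
    rw [← ih, acceptsAt_trace_iff]
    cases h : M.moveAt w t with
    | none => rw [cfgAt_succ_of_none w h]; simp
    | some r => rw [cfgAt_succ_of_some w h]; simp

theorem moveAt_eq_none_of_le {t t' : ℕ} (htt' : t ≤ t') (h : M.moveAt w t = none) :
    M.moveAt w t' = none ∧ M.cfgAt w t' = M.cfgAt w t := by
  induction t', htt' using Nat.le_induction with
  | base => exact ⟨h, rfl⟩
  | succ t' _ ih =>
    have := cfgAt_succ_of_none w ih.1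
    rw [← ih.2]
    refine ⟨?_, this⟩
    rw [← ih.1]
    unfold moveAt workRead
    rw [this]

theorem moveAt_eq_none_iff (t : ℕ) : M.moveAt w t = none ↔ M.step w (M.cfgAt w t) = none := by
  rw [step, moveAt]
  unfold workRead
  split <;> simp_all

/-- The Horn system of a machine that decides a language. -/
theorem derives_acc_iff_mem {L : Language A} {w : List A} {T N : ℕ} (hN : T < N)
    (h : M.HaltsWithin w T [open Classical in decide (w ∈ L)]) :
    HornDerives (TableauRule M.uniformDelta) (TableauAxiom M.start M.uniformInit) w N 0 0 .acc ↔
      w ∈ L := by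
  obtain ⟨h1, h2⟩ := h
  rw [← moveAt_eq_none_iff] at h1
  have hacc : ∀ t, (M.trace w).AcceptsAt t → M.moveAt w t ≠ none := by
    intro t ht
    obtain ⟨r, hr, -⟩ := (acceptsAt_trace_iff w t).1 ht
    rw [hr]; exact nofun
  -- An accepting step is a genuine move, and there are none from time `T` on; so the grid is large
  -- enough to contain it.
  have hlt : ∀ t, (M.trace w).AcceptsAt t → t < T := by
    intro t ht
    by_contra hle
    exact hacc t ht (moveAt_eq_none_of_le w (by omega) h1).1
  rw [(M.trace w).derives_acc_iff]
  · have h3 := mem_output_iff (M := M) w T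
    rw [h2] at h3
    constructor
    · rintro ⟨t, ht⟩
      simpa using h3.2 ⟨t, hlt t ht, ht⟩
    · intro hw
      obtain ⟨t, -, ht⟩ := h3.1 (by simp [hw])
      exact ⟨t, ht⟩
  · intro t ht
    refine ⟨(hlt t ht).trans hN, fun t' ht' hnone => ?_⟩
    have h4 : M.uniformDelta ((M.trace w).state t') ((M.trace w).read t') = _ :=
      uniformDelta_cfgAt w t'
    rw [h4, Option.map_eq_none_iff] at hnone
    exact hacc t ht (moveAt_eq_none_of_le w ht'.le hnone).1

end OfflineTM

/-! ## Automata on a grid -/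

theorem DyckPath.map {n : ℕ} {S S' : Type} {E : S → Option (DyckLetter n) → S → Prop}
    {E' : S' → Option (DyckLetter n) → S' → Prop} (f : S → S')
    (hf : ∀ q o p, E q o p → E' (f q) o (f p)) {q p : S} (h : DyckPath E q p) :
    DyckPath E' (f q) (f p) := by
  induction h with
  | refl q => exact .refl _
  | eps h => exact .eps (hf _ _ _ h)
  | trans _ _ h₁ h₂ => exact h₁.trans h₂
  | bracket i h₁ _ h₂ ih => exact .bracket i (hf _ _ _ h₁) ih (hf _ _ _ h₂)

/-- Finite data that describe an automaton on a grid with `C` states at each point: edges between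
the corners of each unit square, and `ε`-transitions at the points of the row `0`, which depend on
the letters of the input. -/
structure GridData (A α : Type) where
  C : ℕ
  edges : List ((Bool × Bool) × Fin C × Option α × (Bool × Bool) × Fin C)
  axioms : List ((InputSymbol A → Bool) × Fin C × Fin C)
  start : Fin C
  final : Fin C

/-- The numbers `n - 1, …, 0`. -/
def downFrom (n : ℕ) : List ℕ := (List.range n).reverse

theorem mem_downFrom {n i : ℕ} : i ∈ downFrom n ↔ i < n := by simp [downFrom]

namespace GridData

variable {A α : Type} (G : GridData A α)

/-- The transitions of the automaton. -/
inductive Graph (w : List A) (N : ℕ) : ℕ × ℕ × Fin G.C → Option α → ℕ × ℕ × Fin G.C → Prop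
  | edge {t i o x l o' x'} : t < N → i < N → (o, x, l, o', x') ∈ G.edges →
      Graph w N (t + o.1.toNat, i + o.2.toNat, x) l (t + o'.1.toNat, i + o'.2.toNat, x')
  | ax {i b x x'} : i < N → (b, x, x') ∈ G.axioms → b (OfflineTM.inputAt w i) = true →
      Graph w N (0, i, x) none (0, i, x')

/-- The number of a state. -/
def num (N t i : ℕ) (x : Fin G.C) : ℕ := (t * (N + 1) + i) * G.C + x

/-- The transitions, with numbers as states. -/
def transitionList (w : List A) (N : ℕ) : List (ℕ × Option α × ℕ) :=
  ((downFrom N).flatMap fun t => (downFrom N).flatMap fun i => G.edges.map fun e =>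
    (G.num N (t + e.1.1.toNat) (i + e.1.2.toNat) e.2.1, e.2.2.1,
      G.num N (t + e.2.2.2.1.1.toNat) (i + e.2.2.2.1.2.toNat) e.2.2.2.2)) ++
  (downFrom N).flatMap fun i => G.axioms.flatMap fun e =>
    bif e.1 (OfflineTM.inputAt w i) then [(G.num N 0 i e.2.1, none, G.num N 0 i e.2.2)] else []

variable {G}

theorem num_lt {N t i : ℕ} (ht : t ≤ N) (hi : i ≤ N) (x : Fin G.C) :
    G.num N t i x < (N + 1) * (N + 1) * G.C := by
  have h1 : t * (N + 1) + i + 1 ≤ (N + 1) * (N + 1) := by nlinarith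
  calc G.num N t i x < (t * (N + 1) + i) * G.C + G.C := Nat.add_lt_add_left x.2 _
    _ = (t * (N + 1) + i + 1) * G.C := by ring
    _ ≤ _ := Nat.mul_le_mul_right _ h1

theorem card_pos (N : ℕ) : 0 < (N + 1) * (N + 1) * G.C :=
  Nat.mul_pos (Nat.mul_pos (by omega) (by omega)) G.start.pos

variable (G)

/-- A number as a state. -/
def toState (N k : ℕ) : Fin ((N + 1) * (N + 1) * G.C) :=
  ⟨k % ((N + 1) * (N + 1) * G.C), Nat.mod_lt _ (card_pos N)⟩

/-- The automaton. -/
def description (w : List A) (N : ℕ) : NFADescription α where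
  numStates := (N + 1) * (N + 1) * G.C
  start := G.toState N G.start
  accepting := [G.toState N G.final]
  transitions := (G.transitionList w N).map fun e => (G.toState N e.1, e.2.1, G.toState N e.2.2)

variable {G}

theorem toState_val {N k : ℕ} (h : k < (N + 1) * (N + 1) * G.C) : (G.toState N k).val = k :=
  Nat.mod_eq_of_lt h

theorem mem_transitionList {w : List A} {N : ℕ} {e : ℕ × Option α × ℕ} :
    e ∈ G.transitionList w N ↔ ∃ u l v, G.Graph w N u l v ∧ u.1 ≤ N ∧ u.2.1 ≤ N ∧ v.1 ≤ N ∧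
      v.2.1 ≤ N ∧ e = (G.num N u.1 u.2.1 u.2.2, l, G.num N v.1 v.2.1 v.2.2) := by
  have hb : ∀ b : Bool, b.toNat ≤ 1 := fun b => by cases b <;> simp
  simp only [transitionList, List.mem_append, List.mem_flatMap, mem_downFrom, List.mem_map]
  constructor
  · rintro (⟨t, ht, i, hi, ⟨o, x, l, o', x'⟩, he, rfl⟩ | ⟨i, hi, ⟨b, x, x'⟩, he, h⟩)
    · have h1 := hb o.1; have h2 := hb o.2; have h3 := hb o'.1; have h4 := hb o'.2
      exact ⟨_, _, _, .edge ht hi he, by simp only; omega, by simp only; omega,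
        by simp only; omega, by simp only; omega, rfl⟩
    · cases hb : b (OfflineTM.inputAt w i)
      · simp [hb] at h
      · simp only [hb, cond_true, List.mem_singleton] at h
        exact ⟨_, _, _, .ax hi he hb, Nat.zero_le _, hi.le, Nat.zero_le _, hi.le, h⟩
  · rintro ⟨u, l, v, h, -, -, -, -, rfl⟩
    cases h with
    | edge ht hi he => exact .inl ⟨_, ht, _, hi, _, he, rfl⟩
    | ax hi he hb => exact .inr ⟨_, hi, _, he, by simp [hb]⟩

/-- The inverse of `num`. -/
def ofNum (hC : 0 < G.C) (N k : ℕ) : ℕ × ℕ × Fin G.C :=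
  (k / G.C / (N + 1), k / G.C % (N + 1), ⟨k % G.C, Nat.mod_lt _ hC⟩)

theorem ofNum_num {hC : 0 < G.C} {N t i : ℕ} (hi : i ≤ N) (x : Fin G.C) :
    ofNum hC N (G.num N t i x) = (t, i, x) := by
  have h1 : G.num N t i x / G.C = t * (N + 1) + i := by
    rw [num, mul_comm, Nat.mul_add_div hC, Nat.div_eq_of_lt x.2, add_zero]
  have h2 : G.num N t i x % G.C = x := by
    rw [num, Nat.mul_add_mod_self_right, Nat.mod_eq_of_lt x.2]
  have h3 : (t * (N + 1) + i) / (N + 1) = t := by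
    rw [mul_comm, Nat.mul_add_div (by omega), Nat.div_eq_of_lt (by omega), add_zero]
  have h4 : (t * (N + 1) + i) % (N + 1) = i := by
    rw [Nat.mul_add_mod_self_right, Nat.mod_eq_of_lt (by omega)]
  simp [ofNum, h1, h2, h3, h4]

/-- Balanced paths are transported both ways by `DyckPath.map`. All transitions join points with
coordinates at most `N`, where `ofNum` inverts the numbering. -/
theorem description_mem_NRR_iff {n : ℕ} {G : GridData A (DyckLetter n)} (w : List A) (N : ℕ) :
    G.description w N ∈ NRR (dyckLanguage n) ↔
      DyckPath (G.Graph w N) (0, 0, G.start) (0, 0, G.final) := by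
  have hC : 0 < G.C := G.start.pos
  have hnum : ∀ x : Fin G.C, G.num N 0 0 x = x := fun x => by simp [num]
  rw [mem_NRR_dyckLanguage_iff]
  have hlt : ∀ x : Fin G.C, x.val < (N + 1) * (N + 1) * G.C := fun x => by
    rw [← hnum]; exact num_lt (Nat.zero_le _) (Nat.zero_le _) x
  constructor
  · rintro ⟨p, hp, h⟩
    obtain rfl : p = G.toState N G.final := List.mem_singleton.1 hp
    have h2 := DyckPath.map (E' := G.Graph w N) (fun q => ofNum hC N q.val) (fun q o p he => ?_) h
    · simp only [description, toState_val (hlt _)] at h2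
      rwa [← hnum G.start, ← hnum G.final, ofNum_num (Nat.zero_le _),
        ofNum_num (Nat.zero_le _)] at h2
    · obtain ⟨e, he, heq⟩ := List.mem_map.1 he
      obtain ⟨u, l, v, h1, h2, h3, h4, h5, rfl⟩ := mem_transitionList.1 he
      obtain ⟨rfl, rfl, rfl⟩ := heq
      simp only [toState_val (num_lt h2 h3 _), toState_val (num_lt h4 h5 _), ofNum_num h3,
        ofNum_num h5]
      exact h1
  · intro h
    refine ⟨G.toState N G.final, List.mem_singleton.2 rfl, ?_⟩
    have h2 := DyckPath.map (E' := (G.description w N).Edge)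
      (fun u => G.toState N (G.num N u.1 u.2.1 u.2.2)) (fun q o p he => ?_) h
    · simp only [hnum] at h2
      exact h2
    · refine List.mem_map.2 ⟨_, mem_transitionList.2 ⟨q, o, p, he, ?_, ?_, ?_, ?_, rfl⟩, rfl⟩
      all_goals
        have hb : ∀ b : Bool, b.toNat ≤ 1 := fun b => by cases b <;> simp
        cases he with
        | @edge t i o x l o' x' ht hi he =>
          have h1 := hb o.1; have h2 := hb o.2; have h3 := hb o'.1; have h4 := hb o'.2
          simp only
          omega
        | ax hi he hb => simp only; omega

/-- All numbers that occur are in range, so the reduction modulo the number of states disappears and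
a word remains that nested loops can print. -/
theorem encode_description (w : List A) (N : ℕ) : (G.description w N).encode =
    NFADescription.tally α ((N + 1) * (N + 1) * G.C) ++
      .init :: NFADescription.tally α G.start ++ .acc :: NFADescription.tally α G.final ++
      (G.transitionList w N).flatMap fun e =>
        .edge :: NFADescription.tally α e.1 ++ .label e.2.1 :: NFADescription.tally α e.2.2 := by
  have hnum : ∀ x : Fin G.C, G.num N 0 0 x = x := fun x => by simp [num]
  have hlt : ∀ x : Fin G.C, x.val < (N + 1) * (N + 1) * G.C := fun x => by
    rw [← hnum]; exact num_lt (Nat.zero_le _) (Nat.zero_le _) x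
  simp only [NFADescription.encode, description, toState_val (hlt _), List.flatMap_cons,
    List.flatMap_nil, List.append_nil, List.flatMap_map]
  congr 1
  refine List.flatMap_congr fun e he => ?_
  obtain ⟨u, l, v, -, h2, h3, h4, h5, rfl⟩ := mem_transitionList.1 he
  simp only [toState_val (num_lt h2 h3 _), toState_val (num_lt h4 h5 _)]

end GridData

/-! ### The automaton of a Horn system -/

/-- The rules of a Horn system: the head and two facts in the body. -/
abbrev HornRule (F : Type) := ((Bool × Bool) × F) × ((Bool × Bool) × F) × (Bool × Bool) × F

/-- The tasks of the automaton of a Horn system: prove a fact, continue after the proof of a fact,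
continue after the proof of the first fact in the body of a rule. -/
inductive HornTask (F : Type) : Type
  | prove (a : F)
  | done (a : F)
  | mid (r : HornRule F)

/-- The states of the automaton at a point: a task, or a task before which letters have to be
pushed on the stack or popped from the stack. -/
inductive HornState (F : Type) (m : ℕ) : Type
  | task (b : HornTask F)
  | push (b : HornTask F) (j : Fin m)
  | pop (b : HornTask F) (j : Fin m)

instance {F : Type} [Finite F] : Finite (HornTask F) :=
  Finite.of_surjective (Sum.elim .prove (Sum.elim .done .mid) : F ⊕ F ⊕ HornRule F → HornTask F)
    (by
      rintro (a | a | r)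
      exacts [⟨.inl a, rfl⟩, ⟨.inr (.inl a), rfl⟩, ⟨.inr (.inr r), rfl⟩])

instance {F : Type} {m : ℕ} [Finite F] : Finite (HornState F m) :=
  Finite.of_surjective (Sum.elim .task (Sum.elim (fun x => .push x.1 x.2) fun x => .pop x.1 x.2) :
      HornTask F ⊕ (HornTask F × Fin m) ⊕ (HornTask F × Fin m) → HornState F m)
    (by
      rintro (b | ⟨b, j⟩ | ⟨b, j⟩)
      exacts [⟨.inl b, rfl⟩, ⟨.inr (.inl (b, j)), rfl⟩, ⟨.inr (.inr (b, j)), rfl⟩])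

section Horn

variable {A F : Type} {m : ℕ} (Rule : Bool × Bool → F → Bool × Bool → F → Bool × Bool → F → Prop)
  (Ax : InputSymbol A → F → Prop) (code : HornRule F × Bool → Fin m)

open HornState HornTask in
/-- The edges of the automaton of a Horn system. The stack is used to store the rules that are
being applied; the number `j` is represented by `j` letters `0` above a letter `1`. -/
inductive HornEdge : Bool × Bool → HornState F m → Option (DyckLetter 2) → Bool × Bool →
    HornState F m → Prop
  | call₁ {o a o₁ a₁ o₂ a₂} : Rule o a o₁ a₁ o₂ a₂ →
      HornEdge o (task (prove a)) (some (.opening 1)) o₁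
        (push (prove a₁) (code (((o, a), (o₁, a₁), (o₂, a₂)), false)))
  | return₁ {o a o₁ a₁ o₂ a₂} : Rule o a o₁ a₁ o₂ a₂ →
      HornEdge o₁ (task (done a₁)) none (false, false)
        (pop (mid ((o, a), (o₁, a₁), (o₂, a₂))) (code (((o, a), (o₁, a₁), (o₂, a₂)), false)))
  | call₂ {o a o₁ a₁ o₂ a₂} : Rule o a o₁ a₁ o₂ a₂ →
      HornEdge (false, false) (task (mid ((o, a), (o₁, a₁), (o₂, a₂)))) (some (.opening 1)) o₂
        (push (prove a₂) (code (((o, a), (o₁, a₁), (o₂, a₂)), true)))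
  | return₂ {o a o₁ a₁ o₂ a₂} : Rule o a o₁ a₁ o₂ a₂ →
      HornEdge o₂ (task (done a₂)) none o
        (pop (done a) (code (((o, a), (o₁, a₁), (o₂, a₂)), true)))
  | push_succ (o b) (j j' : Fin m) : j'.val = j.val + 1 →
      HornEdge o (push b j') (some (.opening 0)) o (push b j)
  | push_zero (o b) (j : Fin m) : j.val = 0 → HornEdge o (push b j) none o (task b)
  | pop_succ (o b) (j j' : Fin m) : j'.val = j.val + 1 →
      HornEdge o (pop b j') (some (.closing 0)) o (pop b j)
  | pop_zero (o b) (j : Fin m) : j.val = 0 → HornEdge o (pop b j) (some (.closing 1)) o (task b)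

open HornState HornTask in
/-- The transitions of the automaton of a Horn system. -/
inductive HornGraph (w : List A) (N : ℕ) :
    ℕ × ℕ × HornState F m → Option (DyckLetter 2) → ℕ × ℕ × HornState F m → Prop
  | edge {t i o x l o' x'} : t < N → i < N → HornEdge Rule code o x l o' x' →
      HornGraph w N (t + o.1.toNat, i + o.2.toNat, x) l (t + o'.1.toNat, i + o'.2.toNat, x')
  | ax {i a} : i < N → Ax (OfflineTM.inputAt w i) a →
      HornGraph w N (0, i, task (prove a)) none (0, i, task (done a))

/-- The letters on the stack that represent a number. -/
def stackCode (j : ℕ) (σ : List (Fin 2)) : List (Fin 2) := List.replicate j 0 ++ 1 :: σ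

/-- The letter 1 terminates a block of letters 0, so these are prefix codes. This is how two pairs
of brackets replace one pair for each rule. -/
theorem stackCode_inj {j j' : ℕ} {σ σ' : List (Fin 2)} (h : stackCode j σ = stackCode j' σ') :
    j = j' ∧ σ = σ' := by
  unfold stackCode at h
  induction j generalizing j' with
  | zero =>
    cases j' with
    | zero => simpa using h
    | succ j' => simp [List.replicate_succ] at h
  | succ j ih =>
    cases j' with
    | zero => simp [List.replicate_succ] at h
    | succ j' =>
      simp only [List.replicate_succ, List.cons_append, List.cons.injEq, true_and] at h
      obtain ⟨rfl, h2⟩ := ih h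
      exact ⟨rfl, h2⟩

/-- The fact with the given number of a rule that is applied at a base point is followed by tasks
that can be completed, with the stack `σ`. -/
inductive HornCont (w : List A) (N : ℕ) (goal : F) : ℕ → ℕ → F → List (Fin 2) → Prop
  | final : HornCont w N goal 0 0 goal []
  | first {t i o a o₁ a₁ o₂ a₂ σ T I τ} : t < N → i < N → Rule o a o₁ a₁ o₂ a₂ →
      HornDerives Rule Ax w N (t + o₂.1.toNat) (i + o₂.2.toNat) a₂ →
      HornCont w N goal (t + o.1.toNat) (i + o.2.toNat) a σ →
      T = t + o₁.1.toNat → I = i + o₁.2.toNat →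
      τ = stackCode (code (((o, a), (o₁, a₁), (o₂, a₂)), false)).val σ →
      HornCont w N goal T I a₁ τ
  | second {t i o a o₁ a₁ o₂ a₂ σ T I τ} : t < N → i < N → Rule o a o₁ a₁ o₂ a₂ →
      HornCont w N goal (t + o.1.toNat) (i + o.2.toNat) a σ →
      T = t + o₂.1.toNat → I = i + o₂.2.toNat →
      τ = stackCode (code (((o, a), (o₁, a₁), (o₂, a₂)), true)).val σ →
      HornCont w N goal T I a₂ τ

/-- A task can be completed, with the stack `σ`. -/
def HornTask.Good (w : List A) (N : ℕ) (goal : F) (t i : ℕ) (σ : List (Fin 2)) :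
    HornTask F → Prop
  | prove a => HornDerives Rule Ax w N t i a ∧ HornCont Rule Ax code w N goal t i a σ
  | done a => HornCont Rule Ax code w N goal t i a σ
  | mid r => HornDerives Rule Ax w N (t + r.2.2.1.1.toNat) (i + r.2.2.1.2.toNat) r.2.2.2 ∧
      HornCont Rule Ax code w N goal (t + r.1.1.1.toNat) (i + r.1.1.2.toNat) r.1.2 σ

/-- A configuration from which all tasks can be completed. -/
def HornState.Good (w : List A) (N : ℕ) (goal : F) (t i : ℕ) (σ : List (Fin 2)) :
    HornState F m → Prop
  | task b => b.Good Rule Ax code w N goal t i σ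
  | push b j => b.Good Rule Ax code w N goal t i (List.replicate j 0 ++ σ)
  | pop b j => ∃ σ', σ = stackCode j σ' ∧ b.Good Rule Ax code w N goal t i σ'

variable {Rule Ax code} {w : List A} {N : ℕ} {goal : F}

/-- The code on top of the stack determines the rule and which of its premises is being proved,
which leaves a single constructor. The offsets of the rule then recover the base point by
cancellation, so coordinates need not be stored on the stack. -/
theorem HornCont.inv_first (hcode : Function.Injective code) {t i : ℕ} {o a o₁ a₁ o₂ a₂}
    {σ : List (Fin 2)} (h : HornCont Rule Ax code w N goal (t + o₁.1.toNat) (i + o₁.2.toNat) a₁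
      (stackCode (code (((o, a), (o₁, a₁), (o₂, a₂)), false)).val σ)) :
    HornDerives Rule Ax w N (t + o₂.1.toNat) (i + o₂.2.toNat) a₂ ∧
      HornCont Rule Ax code w N goal (t + o.1.toNat) (i + o.2.toNat) a σ := by
  generalize hτ : stackCode (code (((o, a), (o₁, a₁), (o₂, a₂)), false)).val σ = τ at h
  generalize hT : t + o₁.1.toNat = T at h
  generalize hI : i + o₁.2.toNat = I at h
  cases h with
  | final => simp [stackCode] at hτ
  | first _ _ _ h1 h2 h3 h4 h5 =>
    obtain ⟨h6, rfl⟩ := stackCode_inj (hτ.trans h5)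
    have h7 := hcode (Fin.ext h6)
    simp only [Prod.mk.injEq] at h7
    obtain ⟨⟨⟨rfl, rfl⟩, ⟨rfl, -⟩, rfl, rfl⟩, -⟩ := h7
    obtain rfl := Nat.add_right_cancel (hT.trans h3)
    obtain rfl := Nat.add_right_cancel (hI.trans h4)
    exact ⟨h1, h2⟩
  | second _ _ _ h2 h3 h4 h5 =>
    obtain ⟨h6, -⟩ := stackCode_inj (hτ.trans h5)
    simpa using hcode (Fin.ext h6)

theorem HornCont.inv_second (hcode : Function.Injective code) {t i : ℕ} {o a o₁ a₁ o₂ a₂}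
    {σ : List (Fin 2)} (h : HornCont Rule Ax code w N goal (t + o₂.1.toNat) (i + o₂.2.toNat) a₂
      (stackCode (code (((o, a), (o₁, a₁), (o₂, a₂)), true)).val σ)) :
    HornCont Rule Ax code w N goal (t + o.1.toNat) (i + o.2.toNat) a σ := by
  generalize hτ : stackCode (code (((o, a), (o₁, a₁), (o₂, a₂)), true)).val σ = τ at h
  generalize hT : t + o₂.1.toNat = T at h
  generalize hI : i + o₂.2.toNat = I at h
  cases h with
  | final => simp [stackCode] at hτ
  | second _ _ _ h2 h3 h4 h5 =>
    obtain ⟨h6, rfl⟩ := stackCode_inj (hτ.trans h5)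
    have h7 := hcode (Fin.ext h6)
    simp only [Prod.mk.injEq] at h7
    obtain ⟨⟨⟨rfl, rfl⟩, ⟨rfl, rfl⟩, rfl, -⟩, -⟩ := h7
    obtain rfl := Nat.add_right_cancel (hT.trans h3)
    obtain rfl := Nat.add_right_cancel (hI.trans h4)
    exact h2
  | first _ _ _ h1 h2 h3 h4 h5 =>
    obtain ⟨h6, -⟩ := stackCode_inj (hτ.trans h5)
    simpa using hcode (Fin.ext h6)

/-- The effect of a letter on the stack. -/
def StackStep : Option (DyckLetter 2) → List (Fin 2) → List (Fin 2) → Prop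
  | none, σ, τ => τ = σ
  | some (.opening b), σ, τ => τ = b :: σ
  | some (.closing b), σ, τ => σ = b :: τ

/-- Edges are read backwards, from a configuration whose tasks can be completed to its predecessor.
A return edge records in the continuation what the rule still needs; the matching call edge, which
comes later in this reading, takes it out again by `HornCont.inv_first` or `HornCont.inv_second`. -/
theorem HornGraph.good (hcode : Function.Injective code) {u v : ℕ × ℕ × HornState F m} {l}
    (h : HornGraph Rule Ax code w N u l v) {σ τ : List (Fin 2)} (hστ : StackStep l σ τ)
    (hv : v.2.2.Good Rule Ax code w N goal v.1 v.2.1 τ) :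
    u.2.2.Good Rule Ax code w N goal u.1 u.2.1 σ := by
  cases h with
  | ax hi ha =>
    obtain rfl : τ = σ := hστ
    exact ⟨.ax hi ha, hv⟩
  | edge ht hi h =>
    cases h with
    | call₁ hr =>
      obtain rfl : τ = 1 :: σ := hστ
      obtain ⟨h1, h2⟩ := hv
      obtain ⟨h3, h4⟩ := HornCont.inv_first hcode h2
      exact ⟨.rule ht hi hr h1 h3, h4⟩
    | return₁ hr =>
      obtain rfl : τ = σ := hστ
      obtain ⟨σ', rfl, h1, h2⟩ := hv
      exact .first ht hi hr h1 h2 rfl rfl rfl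
    | call₂ hr =>
      obtain rfl : τ = 1 :: σ := hστ
      obtain ⟨h1, h2⟩ := hv
      exact ⟨h1, HornCont.inv_second hcode h2⟩
    | return₂ hr =>
      obtain rfl : τ = σ := hστ
      obtain ⟨σ', rfl, h1⟩ := hv
      exact .second ht hi hr h1 rfl rfl rfl
    | push_succ o b j j' hj =>
      obtain rfl : τ = 0 :: σ := hστ
      simp only [HornState.Good] at hv ⊢
      -- The letter 0 on the stack joins the letters still to be pushed, which makes the block one
      -- longer.
      rw [hj, List.replicate_succ']
      simpa using hv
    | push_zero o b j hj =>
      obtain rfl : τ = σ := hστ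
      simp only [HornState.Good] at hv ⊢
      rw [hj]
      simpa using hv
    | pop_succ o b j j' hj =>
      obtain rfl : σ = 0 :: τ := hστ
      obtain ⟨σ', rfl, h1⟩ := hv
      exact ⟨σ', by rw [hj]; rfl, h1⟩
    | pop_zero o b j hj =>
      obtain rfl : σ = 1 :: τ := hστ
      exact ⟨τ, by rw [hj]; rfl, hv⟩

/-- A balanced path leaves the stack as it found it, so the same `σ` serves at both ends; inside a
bracket the stack is `i :: σ`. -/
theorem HornGraph.good_of_dyckPath (hcode : Function.Injective code)
    {u v : ℕ × ℕ × HornState F m} (h : DyckPath (HornGraph Rule Ax code w N) u v)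
    {σ : List (Fin 2)} (hv : v.2.2.Good Rule Ax code w N goal v.1 v.2.1 σ) :
    u.2.2.Good Rule Ax code w N goal u.1 u.2.1 σ := by
  induction h generalizing σ with
  | refl => exact hv
  | eps h => exact h.good hcode rfl hv
  | trans _ _ ih₁ ih₂ => exact ih₁ (ih₂ hv)
  | bracket i h₁ _ h₂ ih =>
    exact h₁.good (τ := i :: σ) hcode rfl (ih (h₂.good hcode rfl hv))

theorem HornEdge.mem_corner {o x l o' x'} (h : HornEdge Rule code o x l o' x') {t i : ℕ}
    (ht : t < N) (hi : i < N) : HornGraph Rule Ax code w N (t + o.1.toNat, i + o.2.toNat, x) l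
      (t + o'.1.toNat, i + o'.2.toNat, x') := .edge ht hi h

/-- A path between two tasks, surrounded by storing a number on the stack. -/
theorem DyckPath.push_pop {t i t' i' : ℕ} {o o' : Bool × Bool} (ht : t < N) (hi : i < N)
    (ht' : t' < N) (hi' : i' < N) {b d' : HornTask F} {k : Fin m}
    (h : DyckPath (HornGraph Rule Ax code w N) (t + o.1.toNat, i + o.2.toNat, .task b)
      (t' + o'.1.toNat, i' + o'.2.toNat, .pop d' k))
    {u v : ℕ × ℕ × HornState F m}
    (hu : HornGraph Rule Ax code w N u (some (.opening 1)) (t + o.1.toNat, i + o.2.toNat, .push b k))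
    (hv : v = (t' + o'.1.toNat, i' + o'.2.toNat, .task d')) :
    DyckPath (HornGraph Rule Ax code w N) u v := by
  have hm : 0 < m := k.pos
  -- With `j` letters 0 left to push, the balanced path extends until just these have been popped,
  -- when `k - j` remain to be popped.
  have key : ∀ j (hj : j < m), j ≤ k.val → DyckPath (HornGraph Rule Ax code w N)
      (t + o.1.toNat, i + o.2.toNat, .push b ⟨j, hj⟩)
      (t' + o'.1.toNat, i' + o'.2.toNat, .pop d' ⟨k.val - j, by omega⟩) := by
    intro j
    induction j with
    | zero =>
      intro hj _
      exact .trans (.eps (.edge ht hi (.push_zero o b ⟨0, hj⟩ rfl))) h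
    | succ j ih =>
      intro hj hk
      exact .bracket 0 (.edge ht hi (.push_succ o b ⟨j, by omega⟩ ⟨j + 1, hj⟩ rfl))
        (ih (by omega) (by omega))
        (.edge ht' hi' (.pop_succ o' d' _ _ (by simp only; omega)))
  subst hv
  exact .bracket 1 hu (key k.val k.2 le_rfl)
    (.edge ht' hi' (.pop_zero o' d' _ (by simp)))

/-- A derivation is traversed depth first: the path for each premise is enclosed between pushing and
popping the code of the rule, and the two halves meet at the task `mid`. -/
theorem HornDerives.dyckPath {t i : ℕ} {a : F} (h : HornDerives Rule Ax w N t i a) :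
    DyckPath (HornGraph Rule Ax code w N) (t, i, .task (.prove a)) (t, i, .task (.done a)) := by
  induction h with
  | ax hi ha => exact .eps (.ax hi ha)
  | @rule t i o a o₁ a₁ o₂ a₂ ht hi hr _ _ ih₁ ih₂ =>
    have h1 := ih₁.trans (.eps (HornEdge.mem_corner (HornEdge.return₁ hr) ht hi))
    have h2 := ih₂.trans (.eps (HornEdge.mem_corner (HornEdge.return₂ hr) ht hi))
    exact .trans
      (DyckPath.push_pop ht hi ht hi h1 (HornEdge.mem_corner (HornEdge.call₁ hr) ht hi) rfl)
      (DyckPath.push_pop ht hi ht hi h2 (HornEdge.mem_corner (HornEdge.call₂ hr) ht hi) rfl)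

/-- From left to right, start with the final configuration, where the stack is empty and nothing is
left to do, and read derivability off the initial one. -/
theorem dyckPath_iff_hornDerives (hcode : Function.Injective code) :
    DyckPath (HornGraph Rule Ax code w N) (0, 0, .task (.prove goal)) (0, 0, .task (.done goal)) ↔
      HornDerives Rule Ax w N 0 0 goal :=
  ⟨fun h => (HornGraph.good_of_dyckPath (goal := goal) (σ := []) hcode h .final).1,
    fun h => h.dyckPath⟩

/-- The automaton of a Horn system as an automaton on a grid. -/
theorem exists_gridData [Finite F]
    (Rule : Bool × Bool → F → Bool × Bool → F → Bool × Bool → F → Prop)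
    (Ax : InputSymbol A → F → Prop) (goal : F) :
    ∃ G : GridData A (DyckLetter 2), ∀ (w : List A) (N : ℕ),
      G.description w N ∈ NRR (dyckLanguage 2) ↔ HornDerives Rule Ax w N 0 0 goal := by
  classical
  obtain ⟨m, ⟨code⟩⟩ := Finite.exists_equiv_fin (HornRule F × Bool)
  obtain ⟨C, ⟨e⟩⟩ := Finite.exists_equiv_fin (HornState F m)
  have hfin : Finite (Option (DyckLetter 2)) := inferInstance
  set E : Set ((Bool × Bool) × Fin C × Option (DyckLetter 2) × (Bool × Bool) × Fin C) :=
    {x | HornEdge Rule code x.1 (e.symm x.2.1) x.2.2.1 x.2.2.2.1 (e.symm x.2.2.2.2)} with hE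
  have := Fintype.ofFinite F
  refine ⟨⟨C, E.toFinite.toFinset.toList, (Finset.univ : Finset F).toList.map fun a =>
    (fun s => decide (Ax s a), e (.task (.prove a)), e (.task (.done a))),
    e (.task (.prove goal)), e (.task (.done goal))⟩, fun w N => ?_⟩
  rw [GridData.description_mem_NRR_iff, ← dyckPath_iff_hornDerives (code := code) code.injective]
  constructor
  · intro h
    have h2 := DyckPath.map (E' := HornGraph Rule Ax code w N)
      (fun u => (u.1, u.2.1, e.symm u.2.2)) (fun q o p he => ?_) h
    · simpa using h2
    · cases he with
      | edge ht hi he =>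
        rw [Finset.mem_toList, Set.Finite.mem_toFinset] at he
        exact .edge ht hi he
      | ax hi he hb =>
        obtain ⟨a, -, ha⟩ := List.mem_map.1 he
        simp only [Prod.mk.injEq] at ha
        obtain ⟨rfl, rfl, rfl⟩ := ha
        simp only [Equiv.symm_apply_apply]
        exact .ax hi (by simpa using hb)
  · intro h
    refine DyckPath.map (fun u => (u.1, u.2.1, e u.2.2)) (fun q o p he => ?_) h
    cases he with
    | edge ht hi he =>
      refine .edge ht hi ?_
      rw [Finset.mem_toList, Set.Finite.mem_toFinset]
      simpa [hE] using he
    | ax hi ha =>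
      refine .ax hi (List.mem_map.2 ⟨_, by simp, rfl⟩) (by simpa using ha)

end Horn

/-! ### Polynomial time -/

namespace LoopProg

variable {A B R C : Type} {K : ℕ}

/-- The running time is bounded by a polynomial in the values of the counters. -/
def PolyTime (p : LoopProg A B R C K) : Prop :=
  ∃ k, ∀ (w : List A) (v : ℕ) (s : LoopState B R C K), (∀ j, s.val j ≤ v) →
    time w p s ≤ (v + k) ^ k

theorem PolyTime.of_bound {p : LoopProg A B R C K} {f : ℕ → ℕ} (hf : PolyBounded f)
    (h : ∀ (w : List A) (v : ℕ) (s : LoopState B R C K), (∀ j, s.val j ≤ v) → time w p s ≤ f v) :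
    p.PolyTime := by
  obtain ⟨k, hk⟩ := hf
  exact ⟨k, fun w v s hs => (h w v s hs).trans (hk v)⟩

theorem Growth.polyTime {p : LoopProg A B R C K} (X : Fin (K + 1) → Prop) (hp : p.Growth X) :
    p.PolyTime :=
  .of_bound (polyBounded_cost p) fun _ _ _ hs => (growth_bound hp fun j _ => hs j).2

theorem polyTime_copy (y x : Fin (K + 1)) : (copy y x : LoopProg A B R C K).PolyTime :=
  Growth.polyTime (fun _ => False) (by simp [Growth])

theorem PolyTime.seq {p q : LoopProg A B R C K} (hp : p.PolyTime) (hq : q.PolyTime) :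
    (p.seq q).PolyTime := by
  obtain ⟨k, hk⟩ := hp
  obtain ⟨l, hl⟩ := hq
  have hpow : PolyBounded fun v => (v + k) ^ k := ⟨k, fun _ => le_rfl⟩
  refine .of_bound (f := fun v => (v + k) ^ k + ((v + (v + k) ^ k) + l) ^ l)
    (hpow.add (((PolyBounded.id.add hpow).add (.const l)).pow l)) fun w v s hs => ?_
  have h1 := hk w v s hs
  rw [time]
  refine Nat.add_le_add h1 (hl w _ _ (exec_val_le p s _ fun j => ?_))
  have := hs j
  omega

theorem PolyTime.ite {p q : LoopProg A B R C K} (hp : p.PolyTime) (hq : q.PolyTime)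
    (b : InputSymbol A → R → C → Bool) : (LoopProg.ite b p q).PolyTime := by
  obtain ⟨k, hk⟩ := hp
  obtain ⟨l, hl⟩ := hq
  refine .of_bound (f := fun v => 1 + ((v + k) ^ k + (v + l) ^ l))
    ((PolyBounded.const 1).add (PolyBounded.add ⟨k, fun _ => le_rfl⟩ ⟨l, fun _ => le_rfl⟩))
    fun w v s hs => ?_
  have h1 := hk w v s hs
  have h2 := hl w v s hs
  rw [time]
  cases b (OfflineTM.inputAt w s.pos) s.reg (s.mem s.ptr) <;>
    simp only [cond_true, cond_false] <;> omega

variable {w : List A}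

/-- The effect of a loop. -/
theorem exec_loop_eq {a x : Fin (K + 1)} {p : LoopProg A B R C K} {s : LoopState B R C K}
    (f : ℕ → LoopState B R C K) (h0 : f (s.val x) = s) (ha : ∀ n ≤ s.val x, (f n).val a = 0)
    (h : ∀ n < s.val x, exec w p ((f (n + 1)).set a n) = (f n).set a n) :
    exec w (loop a x p) s = f 0 := by
  rw [exec]
  refine iterDown_invariant (fun n s => exec w p (s.set a n))
    (fun n (s' : LoopState B R C K) => s'.set a 0 = f n) (fun n hn s' hs' => ?_) ?_
  · have h1 := h n hn
    rw [← hs', LoopState.set_set] at h1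
    have h2 := LoopState.set_self (f n) a
    rw [ha n hn.le] at h2
    simp only [h1, LoopState.set_set, h2]
  · have h2 := LoopState.set_self (f (s.val x)) a
    rw [ha _ le_rfl, h0] at h2
    rw [h2, h0]

/-- The program that does nothing. -/
def skip : LoopProg A B R C K := moveInput .stay

/-- Execute several programs. -/
def all : List (LoopProg A B R C K) → LoopProg A B R C K
  | [] => skip
  | p :: l => seq p (all l)

theorem wellFormed_all {l : List (LoopProg A B R C K)} :
    (all l).WellFormed ↔ ∀ p ∈ l, p.WellFormed := by
  induction l <;> simp_all [all, WellFormed, skip, moveInput]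

theorem growth_all {X : Fin (K + 1) → Prop} {l : List (LoopProg A B R C K)} :
    (all l).Growth X ↔ ∀ p ∈ l, p.Growth X := by
  induction l <;> simp_all [all, Growth, skip, moveInput]

theorem noWrite_all {j : Fin (K + 1)} {l : List (LoopProg A B R C K)} :
    (all l).NoWrite j ↔ ∀ p ∈ l, p.NoWrite j := by
  induction l <;> simp_all [all, NoWrite, skip, moveInput]

theorem keepsPtr_all {Z : ℕ → Prop} {l : List (LoopProg A B R C K)} :
    (all l).KeepsPtr Z ↔ ∀ p ∈ l, p.KeepsPtr Z := by
  induction l <;> simp_all [all, KeepsPtr, skip, moveInput, OfflineTM.moveHead]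

theorem polyTime_all {l : List (LoopProg A B R C K)} (h : ∀ p ∈ l, p.PolyTime) :
    (all l).PolyTime := by
  induction l with
  | nil => exact Growth.polyTime (fun _ => False) trivial
  | cons p l ih => exact (h p (by simp)).seq (ih fun q hq => h q (by simp [hq]))

end LoopProg

/-! ### Programs that print -/

/-- Append letters to the output. -/
def LoopState.emit {B R C : Type} {K : ℕ} (s : LoopState B R C K) (l : List B) :
    LoopState B R C K :=
  { s with out := s.out ++ l }

namespace LoopProg

variable {A B R C : Type} {K : ℕ}

/-- In the state `s` the only effect of the program is that it prints `l`. -/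
def Prints (w : List A) (p : LoopProg A B R C K) (s : LoopState B R C K) (l : List B) : Prop :=
  ∀ l₀, exec w p (s.emit l₀) = s.emit (l₀ ++ l)

/-- Print a letter. -/
def print (b : B) : LoopProg A B R C K := .loc fun _ r c => (r, c, .stay, .stay, some b)

variable {w : List A} {s : LoopState B R C K}

theorem prints_skip (hs : s.pos ≤ w.length + 1) :
    Prints w (skip : LoopProg A B R C K) s [] := by
  intro l₀
  rw [skip, exec_moveInput, List.append_nil]
  simp [LoopState.emit, OfflineTM.moveHead, hs]

theorem prints_print (hs : s.pos ≤ w.length + 1) (b : B) :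
    Prints w (print b : LoopProg A B R C K) s [b] := by
  intro l₀
  simp [exec, print, LoopState.localStep, OfflineTM.moveHead, LoopState.emit, hs]

theorem Prints.seq {p q : LoopProg A B R C K} {l l' : List B} (hp : Prints w p s l)
    (hq : Prints w q s l') : Prints w (p.seq q) s (l ++ l') := by
  intro l₀
  rw [exec, hp, hq, List.append_assoc]

theorem Prints.all {ι : Type} (L : List ι) {f : ι → LoopProg A B R C K} {g : ι → List B}
    (hs : s.pos ≤ w.length + 1) (h : ∀ i ∈ L, Prints w (f i) s (g i)) :
    Prints w (LoopProg.all (L.map f)) s (L.flatMap g) := by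
  induction L with
  | nil => exact prints_skip hs
  | cons i L ih => exact (h i (by simp)).seq (ih fun j hj => h j (by simp [hj]))

theorem Prints.ite {b : InputSymbol A → R → C → Bool} {p q : LoopProg A B R C K} {l l' : List B}
    (hp : Prints w p s l) (hq : Prints w q s l') : Prints w (LoopProg.ite b p q) s
      (bif b (OfflineTM.inputAt w s.pos) s.reg (s.mem s.ptr) then l else l') := by
  intro l₀
  have : b (OfflineTM.inputAt w (s.emit l₀).pos) (s.emit l₀).reg ((s.emit l₀).mem (s.emit l₀).ptr) =
    b (OfflineTM.inputAt w s.pos) s.reg (s.mem s.ptr) := rfl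
  rw [exec, this]
  cases b (OfflineTM.inputAt w s.pos) s.reg (s.mem s.ptr)
  exacts [hq l₀, hp l₀]

theorem downFrom_succ (n : ℕ) : downFrom (n + 1) = n :: downFrom n := by
  simp [downFrom, List.range_succ]

theorem Prints.loop {a x : Fin (K + 1)} {p : LoopProg A B R C K} {g : ℕ → List B}
    (ha : s.val a = 0) (h : ∀ n < s.val x, Prints w p (s.set a n) (g n)) :
    Prints w (LoopProg.loop a x p) s ((downFrom (s.val x)).flatMap g) := by
  suffices H : ∀ k ≤ s.val x, ∀ l₀, (iterDown (fun n s => exec w p (s.set a n)) k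
      (s.emit l₀)).set a 0 = s.emit (l₀ ++ (downFrom k).flatMap g) from
    fun l₀ => H _ le_rfl l₀
  -- The value `m` of the loop counter is left arbitrary, since every round begins by overwriting
  -- it.
  have key : ∀ k ≤ s.val x, ∀ l₀ m, (iterDown (fun n s => exec w p (s.set a n)) k
      ((s.emit l₀).set a m)).set a 0 = s.emit (l₀ ++ (downFrom k).flatMap g) := by
    intro k
    induction k with
    | zero =>
      intro _ l₀ m
      have := LoopState.set_self (s.emit l₀) a
      rw [show (s.emit l₀).val a = 0 from ha] at this
      simpa [iterDown, downFrom, LoopState.set_set] using this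
    | succ k ih =>
      intro hk l₀ m
      have h1 : exec w p (((s.emit l₀).set a m).set a k) = (s.emit (l₀ ++ g k)).set a k := by
        rw [LoopState.set_set]; exact h k hk l₀
      rw [iterDown, h1, ih (by omega), downFrom_succ, List.flatMap_cons, List.append_assoc]
  intro k hk l₀
  have h2 := key k hk l₀ ((s.emit l₀).val a)
  rwa [LoopState.set_self] at h2

theorem exec_loop_moveInput {a x : Fin (K + 1)} (d : HeadMove)
    {s : LoopState B R C K} (ha : s.val a = 0) (f : ℕ → ℕ) (h0 : f (s.val x) = s.pos)
    (hf : ∀ n < s.val x, min (OfflineTM.moveHead d (f (n + 1))) (w.length + 1) = f n) :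
    exec w (LoopProg.loop a x (moveInput d) : LoopProg A B R C K) s = { s with pos := f 0 } :=
  exec_loop_eq (fun n => { s with pos := f n }) (by simp [h0]) (fun _ _ => ha) fun n hn => by
    rw [exec_moveInput]
    simp only [LoopState.set, hf n hn]

/-- Execute a program with the input head at the position given by a counter. -/
def atInput (a x : Fin (K + 1)) (p : LoopProg A B R C K) : LoopProg A B R C K :=
  .seq (.loop a x (moveInput .right)) (.seq p (.loop a x (moveInput .left)))

/-- The counter may exceed the length of the input, and then the head is clipped on the way out.
Going back by the full count still ends at position 0, where it is clipped again. -/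
theorem Prints.atInput {a x : Fin (K + 1)} {p : LoopProg A B R C K} {l : List B}
    (ha : s.val a = 0) (hs : s.pos = 0)
    (h : Prints w p { s with pos := min (s.val x) (w.length + 1) } l) :
    Prints w (LoopProg.atInput a x p) s l := by
  intro l₀
  have h1 := exec_loop_moveInput (w := w) (x := x) .right (s := s.emit l₀) ha
    (fun n => min (s.val x - n) (w.length + 1)) (by simp [LoopState.emit, hs])
    (fun n hn => by
      change n < s.val x at hn
      simp only [OfflineTM.moveHead]
      omega)
  have h2 := exec_loop_moveInput (w := w) (x := x) .left
    (s := ({ s with pos := min (s.val x) (w.length + 1) } : LoopState B R C K).emit (l₀ ++ l)) ha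
    (fun n => min (s.val x) (w.length + 1) - (s.val x - n)) (by simp [LoopState.emit])
    (fun n hn => by
      change n < s.val x at hn
      simp only [OfflineTM.moveHead]
      omega)
  rw [LoopProg.atInput, exec, exec, h1]
  have h3 := h l₀
  simp only [Nat.sub_zero] at h3 ⊢
  rw [show ({ s.emit l₀ with pos := min (s.val x) (w.length + 1) } : LoopState B R C K) =
    ({ s with pos := min (s.val x) (w.length + 1) } : LoopState B R C K).emit l₀ from rfl, h3, h2]
  simp only [LoopState.emit, LoopState.mk.injEq, true_and, and_true, hs]
  omega

/-- Every position beyond the input reads as the right end marker, so clipping is invisible. -/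
theorem inputAt_min (w : List A) (i : ℕ) :
    OfflineTM.inputAt w (min i (w.length + 1)) = OfflineTM.inputAt w i := by
  rcases le_total i (w.length + 1) with h | h
  · rw [min_eq_left h]
  · rw [min_eq_right h]
    obtain ⟨j, rfl⟩ : ∃ j, i = j + 1 := ⟨i - 1, by omega⟩
    simp only [OfflineTM.inputAt]
    rw [List.getElem?_eq_none (by omega), List.getElem?_eq_none (by omega)]

end LoopProg

/-! ### Powers of the length of the input -/

namespace LoopProg

variable {A B R C : Type} {K : ℕ} {w : List A}

theorem exec_loop_inc {a x y : Fin (K + 1)} (hay : a ≠ y) {s : LoopState B R C K}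
    (ha : s.val a = 0) :
    exec w (loop a x (inc y)) s = s.set y (s.val y + s.val x) :=
  exec_loop_eq (fun n => s.set y (s.val y + (s.val x - n)))
    (by simp [LoopState.set_self]) (fun _ _ => by simp [Function.update_of_ne hay, ha])
    fun n hn => by
      simp only [exec, LoopState.val_set, Function.update_of_ne hay.symm, Function.update_self]
      rw [LoopState.set_comm _ hay, LoopState.set_set]
      congr 2
      omega

/-- The states in the computation of a power. -/
def powState (B : Type) (r : R) (c : C) (m b n y u : ℕ) : LoopState B R C 9 where
  val := ![0, m, b, n, y, u, 0, 0, 0, 0]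
  pos := 0
  ptr := 0
  mem := fun _ => c
  reg := r
  out := []

/-- Replace the counter `3` by its product with the counter `2`. -/
def mulStep : LoopProg A B R C 9 :=
  all [copy 4 8, loop 6 3 (loop 7 2 (inc 4)), copy 3 4]

variable {r : R} {c : C} {m b n y u : ℕ}

theorem exec_skip {s : LoopState B R C K} (hs : s.pos ≤ w.length + 1) :
    exec w (skip : LoopProg A B R C K) s = s := by
  rw [skip, exec_moveInput]; simp [OfflineTM.moveHead, hs]

/-- The counter 8 is always zero here, so copying it clears the accumulator 4. -/
theorem exec_mulStep : exec w (mulStep : LoopProg A B R C 9) (powState B r c m b n y u) =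
    powState B r c m b (n * b) (n * b) u := by
  have h1 : exec w (loop 6 3 (loop 7 2 (inc 4)) : LoopProg A B R C 9) (powState B r c m b n 0 u) =
      powState B r c m b n (n * b) u := by
    refine (exec_loop_eq (fun k => powState B r c m b n ((n - k) * b) u) ?_ (fun _ _ => rfl)
      fun k hk => ?_).trans (by simp)
    · change powState B r c m b n ((n - n) * b) u = _
      simp
    · change k < n at hk
      rw [exec_loop_inc (by decide) rfl]
      have e1 : (n - (k + 1)) * b + b = (n - k) * b := by
        rw [show n - k = n - (k + 1) + 1 by omega]; ring
      rw [LoopState.set_comm _ (by decide)]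
      congr 1
      change (powState B r c m b n ((n - (k + 1)) * b) u).set 4 ((n - (k + 1)) * b + b) = _
      rw [e1]
      simp only [LoopState.set, powState, LoopState.mk.injEq, and_true]
      funext j
      fin_cases j <;> rfl
  have h0 : exec w (copy 4 8 : LoopProg A B R C 9) (powState B r c m b n y u) =
      powState B r c m b n 0 u := by
    simp only [exec, LoopState.set, powState, LoopState.mk.injEq, and_true]
    funext j
    fin_cases j <;> rfl
  have h2 : exec w (copy 3 4 : LoopProg A B R C 9) (powState B r c m b n (n * b) u) =
      powState B r c m b (n * b) (n * b) u := by
    simp only [exec, LoopState.set, powState, LoopState.mk.injEq, and_true]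
    funext j
    fin_cases j <;> rfl
  simp only [mulStep, all, exec.eq_5, h0, h1, h2]
  exact exec_skip (Nat.zero_le _)

/-- Compute `N = (m + k) ^ k` and `N + 1`, where `m` is the value of the counter `1`. -/
def powProg (k : ℕ) : LoopProg A B R C 9 :=
  all [copy 2 1, all (List.replicate k (inc 2)), inc 3, all (List.replicate k mulStep),
    copy 5 3, inc 5]

theorem exec_all_replicate {p : LoopProg A B R C K} (f : ℕ → LoopState B R C K)
    (hf : ∀ n, exec w p (f n) = f (n + 1)) (hpos : ∀ n, (f n).pos ≤ w.length + 1) (k n : ℕ) :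
    exec w (all (List.replicate k p)) (f n) = f (n + k) := by
  induction k generalizing n with
  | zero => exact exec_skip (hpos n)
  | succ k ih =>
    rw [List.replicate_succ, all, exec, hf, ih]
    congr 1
    omega

/-- The conditional is the residue in the scratch counter 4, which is untouched if there is no
multiplication. -/
theorem exec_powProg (w : List A) (k : ℕ) :
    exec w (powProg k : LoopProg A B R C 9) (initState B r c 1 w) = powState B r c (w.length + 1)
      (w.length + 1 + k) ((w.length + 1 + k) ^ k) (if k = 0 then 0 else (w.length + 1 + k) ^ k)
      ((w.length + 1 + k) ^ k + 1) := by
  set m := w.length + 1 with hm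
  have h0 : exec w (copy 2 1 : LoopProg A B R C 9) (initState B r c 1 w) =
      powState B r c m (m + 0) 0 0 0 := by
    simp only [exec, LoopState.set, powState, initState, LoopState.mk.injEq, and_true, ← hm]
    funext j
    fin_cases j <;> rfl
  have h1 := exec_all_replicate (w := w) (p := (inc 2 : LoopProg A B R C 9))
    (fun j => powState B r c m (m + j) 0 0 0) (fun j => by
      simp only [exec, LoopState.set, powState, LoopState.mk.injEq, and_true]
      funext j
      fin_cases j <;> rfl) (fun _ => Nat.zero_le _) k 0
  have h2 : exec w (inc 3 : LoopProg A B R C 9) (powState B r c m (m + (0 + k)) 0 0 0) =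
      powState B r c m (m + k) ((m + k) ^ 0) (if 0 = 0 then 0 else (m + k) ^ 0) 0 := by
    simp only [exec, LoopState.set, powState, LoopState.mk.injEq, and_true, Nat.zero_add]
    funext j
    fin_cases j <;> rfl
  have h3 := exec_all_replicate (w := w) (p := (mulStep : LoopProg A B R C 9))
    (fun j => powState B r c m (m + k) ((m + k) ^ j) (if j = 0 then 0 else (m + k) ^ j) 0)
    (fun j => by simp [exec_mulStep, pow_succ]) (fun _ => Nat.zero_le _) k 0
  have h4 : ∀ y, exec w (copy 5 3 : LoopProg A B R C 9) (powState B r c m (m + k) ((m + k) ^ k) y 0) =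
      powState B r c m (m + k) ((m + k) ^ k) y ((m + k) ^ k) := fun y => by
    simp only [exec, LoopState.set, powState, LoopState.mk.injEq, and_true]
    funext j
    fin_cases j <;> rfl
  have h5 : ∀ y, exec w (inc 5 : LoopProg A B R C 9)
      (powState B r c m (m + k) ((m + k) ^ k) y ((m + k) ^ k)) =
      powState B r c m (m + k) ((m + k) ^ k) y ((m + k) ^ k + 1) := fun y => by
    simp only [exec, LoopState.set, powState, LoopState.mk.injEq, and_true]
    funext j
    fin_cases j <;> rfl
  simp only [Nat.zero_add] at h1 h2 h3
  rw [powProg, all, exec, h0, all, exec, h1, all, exec, h2, all, exec, h3, all, exec, h4, all, exec,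
    h5]
  exact exec_skip (Nat.zero_le _)

theorem wellFormed_powProg (k : ℕ) : (powProg k : LoopProg A B R C 9).WellFormed := by
  simp [powProg, mulStep, wellFormed_all, WellFormed, NoWrite, List.mem_replicate]

/-- A product computed in one round bounds the loop of the next, so `Growth` does not apply to the
whole; but the number of rounds is the constant `k`, and polynomial bounds compose. -/
theorem polyTime_powProg (k : ℕ) : (powProg k : LoopProg A B R C 9).PolyTime := by
  have hinc : ∀ i, (inc i : LoopProg A B R C 9).PolyTime := fun i =>
    Growth.polyTime (fun _ => True) trivial
  have hmul : (mulStep : LoopProg A B R C 9).PolyTime := by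
    refine polyTime_all ?_
    simp only [List.mem_cons, List.not_mem_nil, or_false, forall_eq_or_imp, forall_eq]
    exact ⟨polyTime_copy _ _, Growth.polyTime (· = 4) (by simp [Growth]), polyTime_copy _ _⟩
  refine polyTime_all ?_
  simp only [List.mem_cons, List.not_mem_nil, or_false, forall_eq_or_imp, forall_eq]
  refine ⟨polyTime_copy _ _, polyTime_all ?_, hinc 3, polyTime_all ?_, polyTime_copy _ _, hinc 5⟩
  · intro p hp; rw [List.eq_of_mem_replicate hp]; exact hinc 2
  · intro p hp; rw [List.eq_of_mem_replicate hp]; exact hmul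

end LoopProg

/-! ### Printing the automaton on a grid -/

namespace GridData

open LoopProg

variable {A α : Type} (G : GridData A α)

/-- The programs that print descriptions of automata. -/
abbrev PrintProg (A α : Type) := LoopProg A (DescSymbol α) Unit Unit 9

/-- Print a constant in unary. -/
def printTally (k : ℕ) : PrintProg A α := all (List.replicate k (print .tick))

/-- Print the number of a state at the point given by the counters `6` and `7`. -/
def printNum (o : Bool × Bool) (x : Fin G.C) : PrintProg A α :=
  all [.loop 8 6 (.loop 9 5 (printTally G.C)),
    bif o.1 then .loop 9 5 (printTally G.C) else skip,
    .loop 9 7 (printTally G.C),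
    bif o.2 then printTally G.C else skip,
    printTally x]

/-- Print a transition. -/
def printEdge (e : (Bool × Bool) × Fin G.C × Option α × (Bool × Bool) × Fin G.C) : PrintProg A α :=
  all [print .edge, G.printNum e.1 e.2.1, print (.label e.2.2.1), G.printNum e.2.2.2.1 e.2.2.2.2]

/-- Print the transitions for an axiom. -/
def printAxiom (e : (InputSymbol A → Bool) × Fin G.C × Fin G.C) : PrintProg A α :=
  .ite (fun a _ _ => e.1 a) (G.printEdge ((false, false), e.2.1, none, (false, false), e.2.2)) skip

/-- Print the automaton, for the value of `N` that is held by the counter `3`. -/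
def printAll : PrintProg A α :=
  all [.loop 8 5 (.loop 9 5 (printTally G.C)), print .init, printTally G.start, print .acc,
    printTally G.final, .loop 6 3 (.loop 7 3 (all (G.edges.map G.printEdge))),
    .loop 7 3 (atInput 8 7 (all (G.axioms.map G.printAxiom)))]

variable {w : List A} {s : LoopState (DescSymbol α) Unit Unit 9}

theorem prints_tally (hs : s.pos ≤ w.length + 1) (k : ℕ) :
    Prints w (printTally k : PrintProg A α) s (NFADescription.tally α k) := by
  have := Prints.all (w := w) (List.replicate k ()) (f := fun _ => (print .tick : PrintProg A α))
    (g := fun _ => [.tick]) hs fun _ _ => prints_print hs _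
  rw [List.map_replicate] at this
  have h2 : (List.replicate k ()).flatMap (fun _ => [DescSymbol.tick (α := α)]) =
      NFADescription.tally α k := by
    rw [NFADescription.tally]
    clear this
    induction k with
    | zero => rfl
    | succ k ih => simp [List.replicate_succ, ih]
  rwa [h2] at this

theorem tally_add (a b : ℕ) : NFADescription.tally α (a + b) =
    NFADescription.tally α a ++ NFADescription.tally α b := by
  rw [NFADescription.tally, List.replicate_add]; rfl

theorem prints_loop_tally {a x : Fin 10} {p : PrintProg A α} {k : ℕ} (ha : s.val a = 0)
    (h : ∀ n, Prints w p (s.set a n) (NFADescription.tally α k)) :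
    Prints w (.loop a x p) s (NFADescription.tally α (s.val x * k)) := by
  have h1 := Prints.loop (x := x) ha fun n _ => h n
  convert h1
  induction s.val x with
  | zero => simp [NFADescription.tally, downFrom]
  | succ n ih => rw [downFrom_succ, List.flatMap_cons, ← ih, ← tally_add]; congr 1; ring

/-- The conditions on the counters. -/
structure Ready (N : ℕ) (s : LoopState (DescSymbol α) Unit Unit 9) : Prop where
  three : s.val 3 = N
  five : s.val 5 = N + 1
  eight : s.val 8 = 0
  nine : s.val 9 = 0

theorem Ready.set {N n : ℕ} (h : Ready N s) {i : Fin 10} (h3 : 3 ≠ i) (h5 : 5 ≠ i) (h8 : 8 ≠ i)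
    (h9 : 9 ≠ i) : Ready N (s.set i n) := by
  constructor
  · rw [LoopState.val_set, Function.update_of_ne h3, h.three]
  · rw [LoopState.val_set, Function.update_of_ne h5, h.five]
  · rw [LoopState.val_set, Function.update_of_ne h8, h.eight]
  · rw [LoopState.val_set, Function.update_of_ne h9, h.nine]

variable {G} {N : ℕ}

/-- Expanding the number of the state into a sum of products makes every summand a nest of loops
around `G.C` ticks; no product has to be stored. -/
theorem prints_num (h : Ready N s) (hs : s.pos ≤ w.length + 1) (o : Bool × Bool) (x : Fin G.C) :
    Prints w (G.printNum o x) s (NFADescription.tally α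
      (G.num N (s.val 6 + o.1.toNat) (s.val 7 + o.2.toNat) x)) := by
  have ht : ∀ k (s : LoopState (DescSymbol α) Unit Unit 9), s.pos ≤ w.length + 1 →
      Prints w (printTally k : PrintProg A α) s (NFADescription.tally α k) :=
    fun k s hs => prints_tally hs k
  have h1 : Prints w (.loop 8 6 (.loop 9 5 (printTally G.C)) : PrintProg A α) s
      (NFADescription.tally α (s.val 6 * ((N + 1) * G.C))) := by
    refine prints_loop_tally h.eight fun n => ?_
    have := prints_loop_tally (w := w) (s := s.set 8 n) (a := 9) (x := 5)
      (p := printTally G.C) (k := G.C) h.nine fun n => ht _ _ hs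
    rwa [show (s.set 8 n).val 5 = N + 1 from h.five] at this
  have h2 : Prints w (bif o.1 then .loop 9 5 (printTally G.C) else skip : PrintProg A α) s
      (NFADescription.tally α (o.1.toNat * ((N + 1) * G.C))) := by
    cases o.1
    · simpa [NFADescription.tally] using prints_skip hs
    · have := prints_loop_tally (w := w) (x := 5) (p := printTally G.C) h.nine fun n => ht G.C _ hs
      rw [h.five] at this
      simpa using this
  have h3 : Prints w (.loop 9 7 (printTally G.C) : PrintProg A α) s
      (NFADescription.tally α (s.val 7 * G.C)) := prints_loop_tally h.nine fun n => ht _ _ hs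
  have h4 : Prints w (bif o.2 then printTally G.C else skip : PrintProg A α) s
      (NFADescription.tally α (o.2.toNat * G.C)) := by
    cases o.2
    · simpa [NFADescription.tally] using prints_skip hs
    · simpa using ht G.C s hs
  have h5 := h1.seq (h2.seq (h3.seq (h4.seq ((ht x s hs).seq (prints_skip hs)))))
  rw [List.append_nil, ← tally_add, ← tally_add, ← tally_add, ← tally_add] at h5
  convert h5 using 2
  · rfl
  · rw [GridData.num]
    ring

theorem prints_edge (h : Ready N s) (hs : s.pos ≤ w.length + 1)
    (e : (Bool × Bool) × Fin G.C × Option α × (Bool × Bool) × Fin G.C) :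
    Prints w (G.printEdge e) s (.edge :: NFADescription.tally α
      (G.num N (s.val 6 + e.1.1.toNat) (s.val 7 + e.1.2.toNat) e.2.1) ++ .label e.2.2.1 ::
        NFADescription.tally α (G.num N (s.val 6 + e.2.2.2.1.1.toNat)
          (s.val 7 + e.2.2.2.1.2.toNat) e.2.2.2.2)) := by
  have := (prints_print (w := w) (A := A) hs .edge).seq ((prints_num h hs e.1 e.2.1).seq
    ((prints_print hs (.label e.2.2.1)).seq ((prints_num h hs e.2.2.2.1 e.2.2.2.2).seq
      (prints_skip hs))))
  simpa [printEdge, LoopProg.all] using this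

/-- The pieces match `encode_description` one by one. Loops count downwards, which is the reason for
the order `downFrom` in the list of transitions. -/
theorem prints_all (h : Ready N s) (hs : s.pos = 0) (h6 : s.val 6 = 0) (h7 : s.val 7 = 0) :
    Prints w G.printAll s (G.description w N).encode := by
  have hs' : s.pos ≤ w.length + 1 := by omega
  have h1 : Prints w (.loop 8 5 (.loop 9 5 (printTally G.C)) : PrintProg A α) s
      (NFADescription.tally α ((N + 1) * (N + 1) * G.C)) := by
    have := prints_loop_tally (w := w) (a := 8) (x := 5) (k := (N + 1) * G.C)
      (p := (.loop 9 5 (printTally G.C) : PrintProg A α)) h.eight fun n => by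
        have := prints_loop_tally (w := w) (s := s.set 8 n) (a := 9) (x := 5)
          (p := printTally G.C) (k := G.C) h.nine fun m =>
            prints_tally (s := (s.set 8 n).set 9 m) hs' _
        rwa [show (s.set 8 n).val 5 = N + 1 from h.five] at this
    rwa [h.five, ← mul_assoc] at this
  have h2 : Prints w (.loop 6 3 (.loop 7 3 (all (G.edges.map G.printEdge)))) s
      ((downFrom N).flatMap fun t => (downFrom N).flatMap fun i => G.edges.flatMap fun e =>
        (.edge :: NFADescription.tally α (G.num N (t + e.1.1.toNat) (i + e.1.2.toNat) e.2.1) ++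
          .label e.2.2.1 :: NFADescription.tally α (G.num N (t + e.2.2.2.1.1.toNat)
            (i + e.2.2.2.1.2.toNat) e.2.2.2.2))) := by
    have h3 := h.three
    rw [← h3]
    refine Prints.loop h6 fun t ht => ?_
    have e3 : (s.set 6 t).val 3 = s.val 3 := rfl
    rw [← e3]
    refine Prints.loop h7 fun i hi => ?_
    refine Prints.all _ hs' fun e he => ?_
    have hr : Ready N ((s.set 6 t).set 7 i) := (h.set (by decide) (by decide) (by decide)
      (by decide)).set (by decide) (by decide) (by decide) (by decide)
    have := prints_edge (w := w) hr hs' e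
    rwa [show ((s.set 6 t).set 7 i).val 6 = t from rfl,
      show ((s.set 6 t).set 7 i).val 7 = i from rfl, ← h3] at this
  have h4 : Prints w (.loop 7 3 (atInput 8 7 (all (G.axioms.map G.printAxiom)))) s
      ((downFrom N).flatMap fun i => G.axioms.flatMap fun e =>
        bif e.1 (OfflineTM.inputAt w i) then (.edge :: NFADescription.tally α (G.num N 0 i e.2.1) ++
          .label none :: NFADescription.tally α (G.num N 0 i e.2.2)) else []) := by
    have h3 := h.three
    rw [← h3]
    refine Prints.loop h7 fun i hi => ?_
    refine Prints.atInput h.eight hs ?_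
    refine Prints.all _ (min_le_right _ _) fun e he => ?_
    have hr : Ready N (s.set 7 i) := h.set (by decide) (by decide) (by decide) (by decide)
    have hr' : Ready N { s.set 7 i with pos := min ((s.set 7 i).val 7) (w.length + 1) } :=
      ⟨hr.three, hr.five, hr.eight, hr.nine⟩
    have := Prints.ite (b := fun a _ _ => e.1 a) (prints_edge (w := w) hr' (min_le_right _ _)
      ((false, false), e.2.1, none, (false, false), e.2.2)) (prints_skip (min_le_right _ _))
    simp only [inputAt_min] at this
    rw [show (s.set 7 i).val 7 = i from rfl, show (s.set 7 i).val 6 = 0 from h6] at this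
    rw [h3]
    exact this
  have h5 := h1.seq ((prints_print hs' .init).seq ((prints_tally hs' G.start).seq
    ((prints_print hs' .acc).seq ((prints_tally hs' G.final).seq
      (h2.seq (h4.seq (prints_skip hs')))))))
  rw [encode_description]
  convert h5 using 1
  · rfl
  · simp only [GridData.transitionList, List.flatMap_append, List.flatMap_assoc, List.flatMap_map,
    List.append_nil, List.append_assoc, List.cons_append, List.nil_append]
    refine congrArg _ (congrArg _ (congrArg _ (congrArg _ (congrArg _ (congrArg _ ?_)))))
    refine List.flatMap_congr fun i _ => List.flatMap_congr fun e _ => ?_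
    cases e.1 (OfflineTM.inputAt w i) <;> simp

theorem static_printTally (n : ℕ) :
    (printTally n : PrintProg A α).WellFormed ∧
      (printTally n : PrintProg A α).Growth (fun _ => False) ∧
      (∀ j, (printTally n : PrintProg A α).NoWrite j) ∧
      (printTally n : PrintProg A α).KeepsPtr (· = 0) := by
  simp [printTally, wellFormed_all, growth_all, noWrite_all, keepsPtr_all, print, WellFormed,
    Growth, NoWrite, KeepsPtr, List.mem_replicate, OfflineTM.moveHead]

theorem static_printNum (o : Bool × Bool) (x : Fin G.C) :
    (G.printNum o x : PrintProg A α).WellFormed ∧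
      (G.printNum o x : PrintProg A α).Growth (fun _ => False) ∧
      (∀ j, j ≠ 8 → j ≠ 9 → (G.printNum o x : PrintProg A α).NoWrite j) ∧
      (G.printNum o x : PrintProg A α).KeepsPtr (· = 0) := by
  obtain ⟨o₁, o₂⟩ := o
  have h := static_printTally (A := A) (α := α)
  cases o₁ <;> cases o₂ <;>
  simp +contextual [printNum, wellFormed_all, growth_all, noWrite_all, keepsPtr_all,
    WellFormed, Growth, NoWrite, KeepsPtr, OfflineTM.moveHead, h, skip, moveInput]

theorem static_printEdge (e : (Bool × Bool) × Fin G.C × Option α × (Bool × Bool) × Fin G.C) :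
    (G.printEdge e : PrintProg A α).WellFormed ∧
      (G.printEdge e : PrintProg A α).Growth (fun _ => False) ∧
      (∀ j, j ≠ 8 → j ≠ 9 → (G.printEdge e : PrintProg A α).NoWrite j) ∧
      (G.printEdge e : PrintProg A α).KeepsPtr (· = 0) := by
  have h := static_printNum (A := A) (α := α) (G := G)
  simp +contextual [printEdge, wellFormed_all, growth_all, noWrite_all, keepsPtr_all, print,
    WellFormed, Growth, NoWrite, KeepsPtr, OfflineTM.moveHead, h]

theorem static_printAxiom (e : (InputSymbol A → Bool) × Fin G.C × Fin G.C) :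
    (G.printAxiom e : PrintProg A α).WellFormed ∧
      (G.printAxiom e : PrintProg A α).Growth (fun _ => False) ∧
      (∀ j, j ≠ 8 → j ≠ 9 → (G.printAxiom e : PrintProg A α).NoWrite j) ∧
      (G.printAxiom e : PrintProg A α).KeepsPtr (· = 0) := by
  have h := static_printEdge (A := A) (α := α) (G := G)
  simp +contextual [printAxiom, WellFormed, Growth, NoWrite, KeepsPtr, OfflineTM.moveHead, h, skip,
    moveInput]

theorem static_printAll :
    (G.printAll : PrintProg A α).WellFormed ∧
      (G.printAll : PrintProg A α).Growth (fun _ => False) ∧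
      (G.printAll : PrintProg A α).KeepsPtr (· = 0) := by
  have h := static_printTally (A := A) (α := α)
  have h₁ := static_printEdge (A := A) (α := α) (G := G)
  have h₂ := static_printAxiom (A := A) (α := α) (G := G)
  have m : ∀ {β : Type} {l : List β} {f : β → PrintProg A α} {P : PrintProg A α → Prop},
      (∀ e, P (f e)) → ∀ p ∈ l.map f, P p := by
    intro β l f P h p hp
    obtain ⟨e, -, rfl⟩ := List.mem_map.1 hp
    exact h e
  refine ⟨wellFormed_all.2 ?_, growth_all.2 ?_, keepsPtr_all.2 ?_⟩
  · simp only [List.mem_cons, List.not_mem_nil, or_false, forall_eq_or_imp, forall_eq]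
    refine ⟨⟨by decide, by decide, by decide, ⟨by decide, (h _).2.2.1 8⟩, by decide, by decide,
      by decide, (h _).2.2.1 9, (h _).1⟩, trivial, (h _).1, trivial, (h _).1,
      ⟨by decide, by decide, by decide, ⟨by decide, ?_⟩, by decide, by decide, by decide, ?_, ?_⟩,
      ⟨by decide, by decide, by decide, ⟨⟨by decide, trivial⟩, ?_, by decide, trivial⟩,
        ⟨by decide, by decide, by decide, trivial, trivial⟩, ?_,
        by decide, by decide, by decide, trivial, trivial⟩⟩
    · exact noWrite_all.2 (m fun e => (h₁ e).2.2.1 6 (by decide) (by decide))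
    · exact noWrite_all.2 (m fun e => (h₁ e).2.2.1 7 (by decide) (by decide))
    · exact wellFormed_all.2 (m fun e => (h₁ e).1)
    · exact noWrite_all.2 (m fun e => (h₂ e).2.2.1 7 (by decide) (by decide))
    · exact wellFormed_all.2 (m fun e => (h₂ e).1)
  · simp only [List.mem_cons, List.not_mem_nil, or_false, forall_eq_or_imp, forall_eq]
    have h₃ := growth_all.2 (m (l := G.edges) fun e => (h₁ e).2.1)
    have h₄ := growth_all.2 (m (l := G.axioms) fun e => (h₂ e).2.1)
    simp [atInput, print, Growth, h, h₃, h₄, moveInput]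
  · simp only [List.mem_cons, List.not_mem_nil, or_false, forall_eq_or_imp, forall_eq]
    have h₃ := keepsPtr_all.2 (m (l := G.edges) fun e => (h₁ e).2.2.2)
    have h₄ := keepsPtr_all.2 (m (l := G.axioms) fun e => (h₂ e).2.2.2)
    simp [atInput, print, KeepsPtr, OfflineTM.moveHead, h, h₃, h₄, moveInput]

theorem keepsPtr_powProg (k : ℕ) : (powProg k : PrintProg A α).KeepsPtr (· = 0) := by
  simp [powProg, mulStep, keepsPtr_all, KeepsPtr, List.mem_replicate]

/-- Printing increments no counter, so `Growth` with the empty set bounds its time; only the power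
needs the composition of bounds. Neither part moves the pointer. -/
theorem logSpaceComputable [Finite A] [Finite α] (G : GridData A α) (k : ℕ) :
    LogSpaceComputable fun w : List A =>
      (G.description w ((w.length + 1 + k) ^ k)).encode := by
  obtain ⟨l, hl⟩ := (polyTime_powProg (A := A) (B := DescSymbol α) (R := Unit) (C := Unit) k).seq
    (static_printAll (G := G)).2.1.polyTime
  have hT : PolyBounded fun n => (n + 1 + l) ^ l :=
    ((PolyBounded.id.add (.const 1)).add (.const l)).pow l
  refine LoopProg.logSpaceComputable (p := .seq (powProg k) G.printAll) (x := 1) () () (by decide)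
    ⟨wellFormed_powProg k, static_printAll.1⟩ ⟨keepsPtr_powProg k, static_printAll.2.2⟩ hT
    (fun w => hl _ _ _ fun j => ?_) fun w => ?_
  · simp only [initState, Function.update_apply]
    split_ifs <;> omega
  · have h := prints_all (w := w) (G := G) (N := (w.length + 1 + k) ^ k)
      (s := powState (DescSymbol α) () () (w.length + 1) (w.length + 1 + k)
        ((w.length + 1 + k) ^ k) (if k = 0 then 0 else (w.length + 1 + k) ^ k)
        ((w.length + 1 + k) ^ k + 1)) ⟨rfl, rfl, rfl, rfl⟩ rfl rfl rfl []
    rw [exec, exec_powProg]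
    exact congrArg LoopState.out h

end GridData

/-! ### Hardness -/

instance {A : Type} [Finite A] : Finite (InputSymbol A) :=
  Finite.of_surjective
    (fun x : Option (Option A) => match x with
      | none => .leftEnd
      | some none => .rightEnd
      | some (some a) => .letter a)
    (by
      rintro (_ | a | _)
      exacts [⟨none, rfl⟩, ⟨some (some a), rfl⟩, ⟨some none, rfl⟩])

/-- The Dyck realizability problem is hard for **P**. -/
theorem logSpaceReducible_NRRProblem {A : Type} [Finite A] {L : Language A} (h : InP L) :
    LogSpaceReducible L (NRRProblem (dyckLanguage 2)) := by
  obtain ⟨M, p, hp⟩ := h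
  have := M.finite_Q
  have := M.finite_Γ
  obtain ⟨k, hk⟩ := PolyBounded.eval p
  obtain ⟨G, hG⟩ := exists_gridData (TableauRule M.uniformDelta)
    (TableauAxiom M.start M.uniformInit) .acc
  refine ⟨_, G.logSpaceComputable (k + 1), fun w => ?_⟩
  -- The grid must be strictly larger than the time bound, hence `k + 1` in place of `k`.
  have hN : p.eval w.length < (w.length + 1 + (k + 1)) ^ (k + 1) :=
    calc p.eval w.length ≤ (w.length + k) ^ k := hk _
      _ ≤ (w.length + 1 + (k + 1)) ^ k := Nat.pow_le_pow_left (by omega) _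
      _ < _ := Nat.pow_lt_pow_right (by omega) (by omega)
  have hw := hp w
  rw [← M.derives_acc_iff_mem hN (by convert hp w), ← hG]
  constructor
  · exact fun h => ⟨_, h, rfl⟩
  -- A word in the problem comes with some automaton; by injectivity of the encoding it is the one
  -- that was printed.
  · rintro ⟨D, hD, h⟩
    rwa [NFADescription.encode_injective h] at hD

/-! ### Programs that use the memory as an array -/

namespace LoopProg

variable {A B R C S : Type} {K : ℕ}

/-- On a family of states, the program acts by a function on the parameter. -/
def Acts (w : List A) (p : LoopProg A B R C K) (s : S → LoopState B R C K) (F : S → S) : Prop :=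
  ∀ e, exec w p (s e) = s (F e)

variable {w : List A} {s : S → LoopState B R C K} {F G : S → S}

theorem Acts.seq {p q : LoopProg A B R C K} (hp : Acts w p s F) (hq : Acts w q s G) :
    Acts w (p.seq q) s (G ∘ F) := by
  intro e
  rw [exec, hp, hq]
  rfl

theorem acts_skip (hs : ∀ e, (s e).pos ≤ w.length + 1) :
    Acts w (skip : LoopProg A B R C K) s id :=
  fun e => exec_skip (hs e)

theorem Acts.all {ι : Type} (L : List ι) {f : ι → LoopProg A B R C K} {g : ι → S → S}
    (hs : ∀ e, (s e).pos ≤ w.length + 1) (h : ∀ i ∈ L, Acts w (f i) s (g i)) :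
    Acts w (LoopProg.all (L.map f)) s (fun e => L.foldl (fun e i => g i e) e) := by
  induction L with
  | nil => exact acts_skip hs
  | cons i L ih => exact (h i (by simp)).seq (ih fun j hj => h j (by simp [hj]))

/-- The parameter stands for data outside of the control of the loop: the counter `a` and the bound
`x` must not depend on it. -/
theorem Acts.loop {a x : Fin (K + 1)} {p : LoopProg A B R C K} {F : ℕ → S → S} {v : ℕ}
    (ha : ∀ e, (s e).val a = 0) (hx : ∀ e, (s e).val x = v)
    (h : ∀ n < v, Acts w p (fun e => (s e).set a n) (F n)) :
    Acts w (LoopProg.loop a x p) s (iterDown F v) := by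
  have key : ∀ k ≤ v, ∀ e m, (iterDown (fun n s => exec w p (s.set a n)) k
      ((s e).set a m)).set a 0 = s (iterDown F k e) := by
    intro k
    induction k with
    | zero =>
      intro _ e m
      have := LoopState.set_self (s e) a
      rw [ha] at this
      simpa [iterDown, LoopState.set_set] using this
    | succ k ih =>
      intro hk e m
      rw [iterDown, LoopState.set_set, h k hk e, ih (by omega), iterDown]
  intro e
  have h2 := key v le_rfl e ((s e).val a)
  rw [LoopState.set_self] at h2
  rw [exec, hx, h2]

/-- A bound along the actual trajectory `f`, for loops whose body increments counters on which its
cost depends. -/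
theorem time_loop_le {a x : Fin (K + 1)} {p : LoopProg A B R C K} {s : LoopState B R C K}
    (f : ℕ → LoopState B R C K) (h0 : f (s.val x) = s) (ha : ∀ n ≤ s.val x, (f n).val a = 0)
    (h : ∀ n < s.val x, exec w p ((f (n + 1)).set a n) = (f n).set a n) {c : ℕ}
    (hc : ∀ n < s.val x, time w p ((f (n + 1)).set a n) ≤ c) :
    time w (loop a x p) s ≤ s.val a + 5 * s.val x + 4 + s.val x * (c + 2) := by
  rw [time]
  refine Nat.add_le_add_left (sumDown_le (fun n s => exec w p (s.set a n))
    (fun n s => time w p (s.set a n) + 2)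
    (fun n (s' : LoopState B R C K) => s'.set a 0 = f n) (c + 2) (fun n hn s' hs' => ?_) ?_) _
  · have h1 := h n hn
    have h3 := hc n hn
    rw [← hs', LoopState.set_set] at h1 h3
    have h2 := LoopState.set_self (f n) a
    rw [ha n hn.le] at h2
    simp only [h1, LoopState.set_set, h2, true_and]
    omega
  · have h2 := LoopState.set_self (f (s.val x)) a
    rw [ha _ le_rfl, h0] at h2
    rw [h2, h0]

/-- Move the pointer. -/
def movePtr (d : HeadMove) : LoopProg A B R C K := .loc fun _ r c => (r, c, .stay, d, none)

theorem exec_movePtr (d : HeadMove) {s : LoopState B R C K} (hs : s.pos ≤ w.length + 1) :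
    exec w (movePtr d) s = { s with ptr := OfflineTM.moveHead d s.ptr } := by
  simp [exec, movePtr, LoopState.localStep, OfflineTM.moveHead, hs]

theorem exec_loop_movePtr_right {a x : Fin (K + 1)} {s : LoopState B R C K} (ha : s.val a = 0)
    (hs : s.pos ≤ w.length + 1) : exec w (.loop a x (movePtr .right) : LoopProg A B R C K) s =
      { s with ptr := s.ptr + s.val x } :=
  exec_loop_eq (fun n => { s with ptr := s.ptr + (s.val x - n) }) (by simp) (fun _ _ => ha)
    fun n hn => by
      refine (exec_movePtr _ (by exact hs)).trans ?_
      simp only [LoopState.set, OfflineTM.moveHead]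
      congr 1
      omega

theorem exec_loop_movePtr_left {a x : Fin (K + 1)} {s : LoopState B R C K} (ha : s.val a = 0)
    (hs : s.pos ≤ w.length + 1) : exec w (.loop a x (movePtr .left) : LoopProg A B R C K) s =
      { s with ptr := s.ptr - s.val x } :=
  exec_loop_eq (fun n => { s with ptr := s.ptr - (s.val x - n) }) (by simp) (fun _ _ => ha)
    fun n hn => by
      refine (exec_movePtr _ (by exact hs)).trans ?_
      simp only [LoopState.set, OfflineTM.moveHead]
      congr 1
      omega

/-- Change the register and the cell at the pointer. -/
def cellOp (g : R → C → R × C) : LoopProg A B R C K :=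
  .loc fun _ r c => ((g r c).1, (g r c).2, .stay, .stay, none)

/-- Change the register and the cell in row `x` and column `y` of the array with rows of the length
that is held by the counter `m`. -/
def atCell (a b m x y : Fin (K + 1)) (g : R → C → R × C) : LoopProg A B R C K :=
  .seq (.loop a x (.loop b m (movePtr .right))) (.seq (.loop b y (movePtr .right))
    (.seq (cellOp g)
      (.seq (.loop b y (movePtr .left)) (.loop a x (.loop b m (movePtr .left))))))

/-- No instruction can test the pointer, so every access starts from cell 0 and walks the same
distance back. -/
theorem exec_atCell {a b m x y : Fin (K + 1)} (hab : a ≠ b) (ham : a ≠ m)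
    (g : R → C → R × C) {s : LoopState B R C K} (ha : s.val a = 0) (hb : s.val b = 0)
    (hs : s.pos ≤ w.length + 1) (hptr : s.ptr = 0) :
    exec w (atCell a b m x y g : LoopProg A B R C K) s =
      { s with
        mem := Function.update s.mem (s.val x * s.val m + s.val y)
          (g s.reg (s.mem (s.val x * s.val m + s.val y))).2
        reg := (g s.reg (s.mem (s.val x * s.val m + s.val y))).1 } := by
  have h1 : exec w (.loop a x (.loop b m (movePtr .right)) : LoopProg A B R C K) s =
      { s with ptr := s.val x * s.val m } := by
    refine (exec_loop_eq (fun n => { s with ptr := (s.val x - n) * s.val m }) ?_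
      (fun _ _ => ha) fun n hn => ?_).trans (by simp)
    · rw [show (s.val x - s.val x) * s.val m = s.ptr by rw [hptr, Nat.sub_self, zero_mul]]
    refine (exec_loop_movePtr_right (by simp [Function.update_of_ne hab.symm, hb])
      (by exact hs)).trans ?_
    simp only [LoopState.set, Function.update_of_ne ham.symm]
    congr 1
    rw [show s.val x - n = s.val x - (n + 1) + 1 by omega]
    ring
  have h2 : ∀ s' : LoopState B R C K, s'.val = s.val → s'.pos = s.pos →
      s'.ptr = s.val x * s.val m →
      exec w (.loop a x (.loop b m (movePtr .left)) : LoopProg A B R C K) s' =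
        { s' with ptr := 0 } := by
    intro s' e1 e2 e3
    refine (exec_loop_eq (fun n => { s' with ptr := n * s.val m })
      (by rw [show s'.val x * s.val m = s'.ptr by rw [e3, e1]])
      (fun _ _ => by simp [e1, ha]) fun n hn => ?_).trans (by simp)
    refine (exec_loop_movePtr_left (by simp [Function.update_of_ne hab.symm, e1, hb])
      (by simp [e2, hs])).trans ?_
    simp only [LoopState.set, Function.update_of_ne ham.symm, e1]
    congr 1
    rw [Nat.add_mul, one_mul, Nat.add_sub_cancel]
  rw [atCell, exec, h1, exec, exec_loop_movePtr_right (by exact hb) (by exact hs), exec, exec, cellOp, exec,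
    exec_loop_movePtr_left (by exact hb) (by simp [LoopState.localStep]), h2]
  · simp [LoopState.localStep, OfflineTM.moveHead, hs, hptr]
  · rfl
  · simp [LoopState.localStep, OfflineTM.moveHead, hs]
  · simp [LoopState.localStep, OfflineTM.moveHead]

theorem wellFormed_atCell {a b m x y : Fin (K + 1)} (g : R → C → R × C) (h : a ≠ 0 ∧ b ≠ 0 ∧ m ≠ 0 ∧
    x ≠ 0 ∧ y ≠ 0 ∧ a ≠ b ∧ a ≠ x ∧ b ≠ m ∧ b ≠ y) :
    (atCell a b m x y g : LoopProg A B R C K).WellFormed := by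
  obtain ⟨h1, h2, h3, h4, h5, h6, h7, h8, h9⟩ := h
  exact ⟨⟨h1, h4, h7, ⟨h6, trivial⟩, h2, h3, h8, trivial, trivial⟩,
    ⟨h2, h5, h9, trivial, trivial⟩, trivial, ⟨h2, h5, h9, trivial, trivial⟩,
    ⟨h1, h4, h7, ⟨h6, trivial⟩, h2, h3, h8, trivial, trivial⟩⟩

theorem growth_atCell {a b m x y : Fin (K + 1)} (g : R → C → R × C) :
    (atCell a b m x y g : LoopProg A B R C K).Growth fun _ => False := by
  simp [atCell, Growth, movePtr, cellOp]

theorem noWrite_atCell {a b m x y j : Fin (K + 1)} (g : R → C → R × C) (ha : j ≠ a) (hb : j ≠ b) :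
    (atCell a b m x y g : LoopProg A B R C K).NoWrite j := by
  simp [atCell, NoWrite, movePtr, cellOp, ha, hb]

end LoopProg

/-! ### Saturation -/

/-- The cells of the array that stores a graph: the key `some o` stands for an edge with the label
`o`, and the key `none` marks accepting vertices in the row `0`. -/
abbrev GraphCell (α : Type) := Option (Option α) → Bool

/-- The register of the program that decides the realizability problem: the last letter that is not
a tick, whether no error has been found, the result of a test, and the answer. -/
structure DecisionReg (α : Type) where
  phase : Option (DescSymbol α)
  ok : Bool
  test : Bool
  found : Bool

instance {α : Type} [Finite α] : Finite (DecisionReg α) :=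
  Finite.of_injective (fun r => (r.phase, r.ok, r.test, r.found)) (by
    rintro ⟨a, b, c, d⟩ ⟨a', b', c', d'⟩ h
    simpa using h)

/-- The programs that decide the realizability problem. The counter `1` holds the length of the rows
of the array, the counters `6` and `7` are used to move the pointer. -/
abbrev DecisionProg (α : Type) :=
  LoopProg (DescSymbol α) Bool (DecisionReg α) (GraphCell α) 15

/-- The states of these programs. -/
abbrev DecisionState (α : Type) := LoopState Bool (DecisionReg α) (GraphCell α) 15

open Classical in
/-- The array for a set of accepting vertices and a set of edges. -/
noncomputable def graphCells {α : Type} (m : ℕ) (V : Set ℕ) (E : Set (ℕ × Option α × ℕ)) (i : ℕ) :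
    GraphCell α
  | none => decide (i ∈ V)
  | some o => decide ((i / m, o, i % m) ∈ E)

open Classical in
/-- Set the mark `f` if `b` is true. -/
noncomputable def GraphCell.mark {α : Type} (f : Option (Option α)) (b : Bool) (c : GraphCell α) :
    GraphCell α :=
  fun f' => c f' || (b && decide (f' = f))

section GraphCells

variable {α : Type} {m : ℕ} {V : Set ℕ} {E : Set (ℕ × Option α × ℕ)}

open Classical in
theorem graphCells_some {x y : ℕ} (hy : y < m) (o : Option α) :
    graphCells m V E (x * m + y) (some o) = decide ((x, o, y) ∈ E) := by
  have h1 : (x * m + y) / m = x := by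
    rw [mul_comm, Nat.mul_add_div (by omega), Nat.div_eq_of_lt hy, add_zero]
  have h2 : (x * m + y) % m = y := by
    rw [Nat.mul_add_mod_self_right, Nat.mod_eq_of_lt hy]
  rw [graphCells, h1, h2]

-- Only the column has to be in range: division with remainder by `m` then recovers both indices
-- from the cell, so no other edge is affected.
open Classical in
theorem update_graphCells_some {x y : ℕ} (hy : y < m) (o : Option α) (b : Bool) :
    Function.update (graphCells m V E) (x * m + y)
      ((graphCells m V E (x * m + y)).mark (some o) b) =
      graphCells m V (E ∪ {e | e = (x, o, y) ∧ b = true}) := by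
  funext i f
  rw [Function.update_apply]
  split_ifs with hi
  · subst hi
    rcases f with _ | o'
    · simp [GraphCell.mark, graphCells]
    · rw [GraphCell.mark, graphCells_some hy, graphCells_some hy]
      by_cases hE : (x, o', y) ∈ E <;> cases b <;> simp [hE, eq_comm]
  · rcases f with _ | o'
    · rfl
    · have : ¬(i / m = x ∧ i % m = y) := by
        rintro ⟨rfl, rfl⟩
        exact hi (by rw [mul_comm, Nat.div_add_mod])
      simp only [graphCells, Set.mem_union, Set.mem_ofPred_eq, Prod.mk.injEq]
      congr 1
      grind

open Classical in
theorem update_graphCells_none {x y : ℕ} (hx : x = 0) :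
    Function.update (graphCells m V E) (x * m + y)
      ((graphCells m V E (x * m + y)).mark none true) =
      graphCells m (V ∪ {y}) E := by
  subst hx
  funext i f
  rw [Function.update_apply, zero_mul, zero_add]
  split_ifs with hi
  · subst hi
    rcases f with _ | o'
    · simp [GraphCell.mark, graphCells]
    · simp [GraphCell.mark, graphCells]
  · rcases f with _ | o'
    · simp [graphCells, hi]
    · rfl

end GraphCells

namespace DecisionProg

open LoopProg

variable {α : Type} {w : List (DescSymbol α)}

/-- The conditions on the state when the array is used. -/
structure Ready (w : List (DescSymbol α)) (m : ℕ) (s : DecisionState α) : Prop where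
  one : s.val 1 = m
  six : s.val 6 = 0
  seven : s.val 7 = 0
  ptr : s.ptr = 0
  pos : s.pos ≤ w.length + 1

/-- The state with a given content of the array. -/
noncomputable def withGraph (m : ℕ) (V : Set ℕ) (s : DecisionState α)
    (E : Set (ℕ × Option α × ℕ)) : DecisionState α :=
  { s with mem := graphCells m V E }

/-- Access to the array. -/
abbrev access (x y : Fin 16) (g : DecisionReg α → GraphCell α → DecisionReg α × GraphCell α) :
    DecisionProg α := atCell 6 7 1 x y g

theorem exec_access {m : ℕ} {s : DecisionState α} (h : Ready w m s) (x y : Fin 16)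
    (g : DecisionReg α → GraphCell α → DecisionReg α × GraphCell α) (r : DecisionReg α)
    (c : ℕ → GraphCell α) :
    exec w (access x y g) ({ s with mem := c, reg := r } : DecisionState α) = { s with
      mem := Function.update c (s.val x * m + s.val y) (g r (c (s.val x * m + s.val y))).2
      reg := (g r (c (s.val x * m + s.val y))).1 } := by
  refine (exec_atCell (by decide) (by decide) _ (by exact h.six) (by exact h.seven)
    (by exact h.pos) (by exact h.ptr)).trans ?_
  simp only [h.one]

/-- If there are edges with labels `f.1` from `q` to `x`, `ε` from `x` to `y` and `f.2` from `y` to `p`,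
add an edge with the label `ε` from `q` to `p`. The counters `10, …, 13` hold `q, x, y, p`. -/
noncomputable def saturateStep (f : Option α × Option α) : DecisionProg α :=
  .seq (access 10 11 fun r c => ({ r with test := c (some f.1) }, c))
    (.seq (access 11 12 fun r c => ({ r with test := r.test && c (some none) }, c))
      (.seq (access 12 13 fun r c => ({ r with test := r.test && c (some f.2) }, c))
        (access 10 13 fun r c => ({ r with test := false }, c.mark (some none) r.test))))

/-- The effect of `saturateStep`. -/
def addEdge (q x y p : ℕ) (f : Option α × Option α) (E : Set (ℕ × Option α × ℕ)) :
    Set (ℕ × Option α × ℕ) :=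
  E ∪ {e | e = (q, none, p) ∧ (q, f.1, x) ∈ E ∧ (x, none, y) ∈ E ∧ (y, f.2, p) ∈ E}

/-- The register accumulates the conjunction of three lookups; the last access spends it and resets
`test`, so that the state depends on the graph alone again. -/
theorem acts_saturateStep {m : ℕ} {V : Set ℕ} {s : DecisionState α} (h : Ready w m s)
    (ht : s.reg.test = false) (hx : s.val 11 < m) (hy : s.val 12 < m) (hp : s.val 13 < m)
    (f : Option α × Option α) : Acts w (saturateStep f) (withGraph m V s)
      (addEdge (s.val 10) (s.val 11) (s.val 12) (s.val 13) f) := by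
  intro E
  change exec w _ ({ s with mem := graphCells m V E, reg := s.reg } : DecisionState α) = _
  rw [saturateStep, exec, exec_access h, exec, exec_access h, exec, exec_access h, exec_access h]
  simp only [Function.update_eq_self, graphCells_some hx, graphCells_some hy, graphCells_some hp,
    update_graphCells_some hp, ← ht]
  rw [withGraph, addEdge]
  congr 2
  ext e
  simp [and_assoc]

/-- The pairs of labels that surround balanced paths. -/
def patterns (n : ℕ) : List (Option (DyckLetter n) × Option (DyckLetter n)) :=
  (none, none) :: (List.finRange n).map fun i => (some (.opening i), some (.closing i))

variable {n : ℕ}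

/-- Apply all instances of `saturateStep`. -/
noncomputable def sweep (n : ℕ) : DecisionProg (DyckLetter n) :=
  .loop 10 1 (.loop 11 1 (.loop 12 1 (.loop 13 1 (all ((patterns n).map saturateStep)))))

/-- The effect of a sweep. -/
def sweepEdges (n m : ℕ) :
    Set (ℕ × Option (DyckLetter n) × ℕ) → Set (ℕ × Option (DyckLetter n) × ℕ) :=
  iterDown (fun q => iterDown (fun x => iterDown (fun y => iterDown (fun p E =>
    (patterns n).foldl (fun E f => addEdge q x y p f E) E) m) m) m) m

theorem Ready.set {m : ℕ} {s : DecisionState α} (h : Ready w m s) {i : Fin 16} {k : ℕ}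
    (h1 : 1 ≠ i) (h6 : 6 ≠ i) (h7 : 7 ≠ i) : Ready w m (s.set i k) where
  one := by rw [LoopState.val_set, Function.update_of_ne h1, h.one]
  six := by rw [LoopState.val_set, Function.update_of_ne h6, h.six]
  seven := by rw [LoopState.val_set, Function.update_of_ne h7, h.seven]
  ptr := h.ptr
  pos := h.pos

theorem acts_sweep {w : List (DescSymbol (DyckLetter n))} {m : ℕ} {V : Set ℕ}
    {s : DecisionState (DyckLetter n)} (h : Ready w m s) (ht : s.reg.test = false)
    (h10 : s.val 10 = 0) (h11 : s.val 11 = 0) (h12 : s.val 12 = 0) (h13 : s.val 13 = 0) :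
    Acts w (sweep n) (withGraph m V s) (sweepEdges n m) := by
  refine Acts.loop (fun _ => h10) (fun _ => h.one) fun q hq => ?_
  refine Acts.loop (fun _ => h11) (fun _ => h.one) fun x hx => ?_
  refine Acts.loop (fun _ => h12) (fun _ => h.one) fun y hy => ?_
  refine Acts.loop (fun _ => h13) (fun _ => h.one) fun p hp => ?_
  refine Acts.all _ (fun _ => h.pos) fun f _ => ?_
  exact acts_saturateStep (s := (((s.set 10 q).set 11 x).set 12 y).set 13 p)
    ((((h.set (by decide) (by decide) (by decide)).set (by decide) (by decide) (by decide)).set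
      (by decide) (by decide) (by decide)).set (by decide) (by decide) (by decide)) ht hx hy hp f

/-- Sweep often enough. -/
noncomputable def saturate (n : ℕ) : DecisionProg (DyckLetter n) :=
  .loop 14 1 (.loop 15 1 (sweep n))

theorem iterDown_const {S : Type} (F : S → S) (k : ℕ) (s : S) :
    iterDown (fun _ => F) k s = F^[k] s := by
  induction k generalizing s with
  | zero => rfl
  | succ k ih => rw [iterDown, ih, Function.iterate_succ_apply]

/-- Two nested loops provide `m * m` sweeps, one for each ε-edge that might be added. -/
theorem acts_saturate {w : List (DescSymbol (DyckLetter n))} {m : ℕ} {V : Set ℕ}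
    {s : DecisionState (DyckLetter n)} (h : Ready w m s) (ht : s.reg.test = false)
    (h0 : ∀ i, 10 ≤ i → s.val i = 0) :
    Acts w (saturate n) (withGraph m V s) (sweepEdges n m)^[m * m] := by
  have key : Acts w (saturate n) (withGraph m V s)
      (iterDown (fun _ => iterDown (fun _ => sweepEdges n m) m) m) := by
    refine Acts.loop (fun _ => h0 14 (by decide)) (fun _ => h.one) fun i _ => ?_
    refine Acts.loop (fun _ => h0 15 (by decide)) (fun _ => h.one) fun j _ => ?_
    exact acts_sweep (s := (s.set 14 i).set 15 j)
      ((h.set (by decide) (by decide) (by decide)).set (by decide) (by decide) (by decide)) ht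
      (h0 10 (by decide)) (h0 11 (by decide)) (h0 12 (by decide)) (h0 13 (by decide))
  convert key using 1
  funext E
  rw [iterDown_const, show iterDown (fun _ => sweepEdges n m) m = (sweepEdges n m)^[m] from
    funext fun E => iterDown_const _ _ _, ← Function.iterate_mul]

/-- Add loops with the label `ε`. -/
noncomputable def addLoops : DecisionProg α :=
  .loop 10 1 (access 10 10 fun r c => (r, c.mark (some none) true))

theorem acts_addLoops {m : ℕ} {V : Set ℕ} {s : DecisionState α} (h : Ready w m s)
    (h10 : s.val 10 = 0) : Acts w addLoops (withGraph m V s)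
      (iterDown (fun q E => E ∪ {(q, none, q)}) m) := by
  refine Acts.loop (fun _ => h10) (fun _ => h.one) fun q hq E => ?_
  have h' : Ready w m (s.set 10 q) := h.set (by decide) (by decide) (by decide)
  refine (exec_access h' 10 10 _ s.reg (graphCells m V E)).trans ?_
  rw [show (s.set 10 q).val 10 = q from rfl, update_graphCells_some hq]
  simp only [withGraph, LoopState.set]
  congr 2
  ext e
  simp

end DecisionProg

/-! ### Saturated graphs -/

namespace LoopProg

section Inflationary

variable {T : Type} {F : ℕ → Set T → Set T}

theorem subset_iterDown (hF : ∀ k E, E ⊆ F k E) (v : ℕ) (E : Set T) : E ⊆ iterDown F v E := by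
  induction v generalizing E with
  | zero => exact subset_rfl
  | succ v ih => exact (hF v E).trans (ih _)

/-- The intermediate sets increase from `E` to `E`, so all of them equal `E` and every factor fixes
it. -/
theorem eq_of_iterDown_eq (hF : ∀ k E, E ⊆ F k E) {v : ℕ} {E : Set T}
    (h : iterDown F v E = E) : ∀ k < v, F k E = E := by
  induction v generalizing E with
  | zero => intro k hk; omega
  | succ v ih =>
    have h1 : F v E = E := ((subset_iterDown hF v _).trans h.subset).antisymm (hF v E)
    rw [iterDown, h1] at h
    intro k hk
    rcases Nat.lt_succ_iff_lt_or_eq.1 hk with hk | rfl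
    exacts [ih h k hk, h1]

theorem subset_foldl {ι : Type} {G : ι → Set T → Set T} (hG : ∀ i E, E ⊆ G i E) (L : List ι)
    (E : Set T) : E ⊆ L.foldl (fun E i => G i E) E := by
  induction L generalizing E with
  | nil => exact subset_rfl
  | cons i L ih => exact (hG i E).trans (ih _)

theorem eq_of_foldl_eq {ι : Type} {G : ι → Set T → Set T} (hG : ∀ i E, E ⊆ G i E) {L : List ι}
    {E : Set T} (h : L.foldl (fun E i => G i E) E = E) : ∀ i ∈ L, G i E = E := by
  induction L generalizing E with
  | nil => simp
  | cons i L ih =>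
    have h1 : G i E = E := ((subset_foldl hG L _).trans h.subset).antisymm (hG i E)
    rw [List.foldl_cons, h1] at h
    simpa [h1] using ih h

/-- The iteration of an inflationary map that adds only elements of a finite set stops. -/
theorem iterate_fixed {G : Set T → Set T} (hG : ∀ E, E ⊆ G E) {N : Set T} (hN : N.Finite)
    (hGN : ∀ E, G E ⊆ E ∪ N) {k : ℕ} (hk : N.ncard ≤ k) (E : Set T) :
    G (G^[k] E) = G^[k] E := by
  -- A round that changes the set adds an element of `N`; so as long as the iteration moves, `k`
  -- rounds have collected at least `k` of them.
  have key : ∀ k, G (G^[k] E) = G^[k] E ∨ k ≤ (G^[k] E ∩ N).ncard := by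
    intro k
    induction k with
    | zero => exact .inr (Nat.zero_le _)
    | succ k ih =>
      rw [Function.iterate_succ_apply']
      by_cases h : G (G^[k] E) = G^[k] E
      · left; rw [h, h]
      · right
        have h1 := ih.resolve_left h
        refine Nat.succ_le_of_lt (h1.trans_lt (Set.ncard_lt_ncard ?_ (hN.inter_of_right _)))
        refine ⟨Set.inter_subset_inter_left _ (hG _), fun h2 => h ((hG _).antisymm' ?_)⟩
        intro e he
        rcases hGN _ he with h3 | h3
        exacts [h3, (h2 ⟨he, h3⟩).1]
  rcases key k with h | h
  · exact h
  · have h1 : G^[k] E ∩ N = N :=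
      Set.eq_of_subset_of_ncard_le Set.inter_subset_right (hk.trans h) hN
    refine (hG _).antisymm' fun e he => ?_
    rcases hGN _ he with h3 | h3
    exacts [h3, (h1.superset h3).1]

end Inflationary

end LoopProg

/-! ### Saturation finds the balanced paths -/

namespace DecisionProg

open LoopProg

variable {n m : ℕ}

/-- The graph in which the program looks for an edge. -/
def saturated (m : ℕ) (E : Set (ℕ × Option (DyckLetter n) × ℕ)) :
    Set (ℕ × Option (DyckLetter n) × ℕ) :=
  (sweepEdges n m)^[m * m] (iterDown (fun q E => E ∪ {(q, none, q)}) m E)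

theorem subset_addEdge {α : Type} (q x y p : ℕ) (f : Option α × Option α) (E) :
    E ⊆ addEdge q x y p f E := Set.subset_union_left

theorem subset_sweepEdges (E : Set (ℕ × Option (DyckLetter n) × ℕ)) : E ⊆ sweepEdges n m E := by
  have i1 := fun q x y p => subset_foldl (fun f => subset_addEdge q x y p f) (patterns n)
  have i2 := fun q x y => subset_iterDown (i1 q x y) m
  have i3 := fun q x => subset_iterDown (i2 q x) m
  have i4 := fun q => subset_iterDown (i3 q) m
  exact subset_iterDown i4 m E

/-- A sweep is a composition of inflationary maps, so a graph fixed by it is fixed by each single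
`addEdge`, that is, closed under the rule. -/
theorem mem_of_sweepEdges_eq {E : Set (ℕ × Option (DyckLetter n) × ℕ)}
    (h : sweepEdges n m E = E) {q x y p : ℕ} (hq : q < m) (hx : x < m) (hy : y < m) (hp : p < m)
    {f} (hf : f ∈ patterns n) (h1 : (q, f.1, x) ∈ E) (h2 : (x, none, y) ∈ E)
    (h3 : (y, f.2, p) ∈ E) : (q, none, p) ∈ E := by
  have i1 := fun q x y p => subset_foldl (fun f => subset_addEdge q x y p f) (patterns n)
  have i2 := fun q x y => subset_iterDown (i1 q x y) m
  have i3 := fun q x => subset_iterDown (i2 q x) m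
  have i4 := fun q => subset_iterDown (i3 q) m
  have e1 := eq_of_iterDown_eq i4 h q hq
  have e2 := eq_of_iterDown_eq (i3 q) e1 x hx
  have e3 := eq_of_iterDown_eq (i2 q x) e2 y hy
  have e4 := eq_of_iterDown_eq (i1 q x y) e3 p hp
  have e5 := eq_of_foldl_eq (fun f => subset_addEdge q x y p f) e4 f hf
  rw [← e5]
  exact .inr ⟨rfl, h1, h2, h3⟩

/-- A property of graphs that is preserved by all instances of `addEdge` is preserved by sweeps. -/
theorem sweepEdges_induction {P : Set (ℕ × Option (DyckLetter n) × ℕ) → Prop}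
    (hP : ∀ q < m, ∀ x < m, ∀ y < m, ∀ p < m, ∀ f ∈ patterns n, ∀ E, P E →
      P (addEdge q x y p f E)) {E} (h : P E) : P (sweepEdges n m E) := by
  refine iterDown_invariant _ (fun _ => P) (fun q hq E h => ?_) h
  refine iterDown_invariant _ (fun _ => P) (fun x hx E h => ?_) h
  refine iterDown_invariant _ (fun _ => P) (fun y hy E h => ?_) h
  refine iterDown_invariant _ (fun _ => P) (fun p hp E h => ?_) h
  have : ∀ L : List _, (∀ f ∈ L, f ∈ patterns n) → ∀ E, P E →
      P (L.foldl (fun E f => addEdge q x y p f E) E) := by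
    intro L
    induction L with
    | nil => exact fun _ _ h => h
    | cons f L ih =>
      exact fun hL E h => ih (fun f' hf' => hL f' (by simp [hf'])) _
        (hP q hq x hx y hy p hp f (hL f (by simp)) E h)
  exact this _ (fun _ h => h) E h

/-- Sweeps add only ε-edges between vertices below `m`, and there are `m * m` of these, so
`iterate_fixed` applies. -/
theorem sweepEdges_saturated (E : Set (ℕ × Option (DyckLetter n) × ℕ)) :
    sweepEdges n m (saturated m E) = saturated m E := by
  set N : Set (ℕ × Option (DyckLetter n) × ℕ) :=
    (fun x : ℕ × ℕ => (x.1, none, x.2)) '' (Finset.range m ×ˢ Finset.range m : Finset (ℕ × ℕ))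
    with hN
  have hfin : N.Finite := (Finset.finite_toSet _).image _
  refine iterate_fixed subset_sweepEdges hfin (fun E => ?_) ?_ _
  · refine sweepEdges_induction (P := fun E' => E' ⊆ E ∪ N) ?_ Set.subset_union_left
    rintro q hq x hx y hy p hp f hf E' h e (he | ⟨rfl, -⟩)
    · exact h he
    · exact .inr ⟨(q, p), by simp [hq, hp], rfl⟩
  · refine (Set.ncard_image_le (Finset.finite_toSet _)).trans ?_
    rw [Set.ncard_coe_finset]
    simp

theorem mem_saturated_self {E : Set (ℕ × Option (DyckLetter n) × ℕ)} :
    E ⊆ saturated m E ∧ ∀ q < m, (q, none, q) ∈ saturated m E := by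
  have h1 : ∀ E' : Set (ℕ × Option (DyckLetter n) × ℕ), E' ⊆ (sweepEdges n m)^[m * m] E' := by
    intro E'
    induction m * m with
    | zero => exact subset_rfl
    | succ k ih => rw [Function.iterate_succ_apply']; exact ih.trans (subset_sweepEdges _)
  have h2 : ∀ (k : ℕ) (E' : Set (ℕ × Option (DyckLetter n) × ℕ)), E' ⊆ E' ∪ {(k, none, k)} :=
    fun k E' => Set.subset_union_left
  have h3 : ∀ (v : ℕ) (E' : Set (ℕ × Option (DyckLetter n) × ℕ)), ∀ q < v,
      (q, none, q) ∈ iterDown (fun q (E : Set (ℕ × Option (DyckLetter n) × ℕ)) => E ∪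
      {((q, none, q) : ℕ × Option (DyckLetter n) × ℕ)}) v E' := by
    intro v
    induction v with
    | zero => intro _ q hq; omega
    | succ v ih =>
      intro E' q hq
      rcases Nat.lt_succ_iff_lt_or_eq.1 hq with hq | rfl
      · exact ih _ q hq
      · exact subset_iterDown (F := fun q E => E ∪ {((q, none, q) : ℕ × Option (DyckLetter n) × ℕ)})
          h2 q (E' ∪ {(q, none, q)}) (Set.mem_union_right _ (Set.mem_singleton _))
  exact ⟨(subset_iterDown h2 m E).trans (h1 _), fun q hq => h1 _ (h3 m E q hq)⟩

/-- The saturated graph has an edge for each balanced path. -/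
theorem mem_saturated_iff {E : Set (ℕ × Option (DyckLetter n) × ℕ)}
    (hE : ∀ e ∈ E, e.1 < m ∧ e.2.2 < m) {q p : ℕ} (hq : q < m) :
    (q, none, p) ∈ saturated m E ↔ DyckPath (fun q o p => (q, o, p) ∈ E) q p := by
  constructor
  · intro h
    -- The second half of the invariant, that edges labelled by letters are original ones, is what
    -- the case of a pair of brackets needs.
    suffices H : ∀ e ∈ saturated m E, (e.2.1 = none → DyckPath (fun q o p => (q, o, p) ∈ E) e.1 e.2.2)
        ∧ (e.2.1 ≠ none → e ∈ E) from (H _ h).1 rfl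
    have h0 : ∀ e ∈ iterDown (fun q E => E ∪ {((q, none, q) : ℕ × Option (DyckLetter n) × ℕ)}) m E,
        (e.2.1 = none → DyckPath (fun q o p => (q, o, p) ∈ E) e.1 e.2.2) ∧
          (e.2.1 ≠ none → e ∈ E) := by
      refine iterDown_invariant _ (fun _ (E' : Set (ℕ × Option (DyckLetter n) × ℕ)) => ∀ e ∈ E',
        (e.2.1 = none → DyckPath (fun q o p => (q, o, p) ∈ E) e.1 e.2.2) ∧
          (e.2.1 ≠ none → e ∈ E)) ?_ ?_
      · rintro q hq E' h e (he | rfl)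
        · exact h e he
        · exact ⟨fun _ => .refl _, fun h => absurd rfl h⟩
      · rintro ⟨q, o, p⟩ he
        refine ⟨?_, fun _ => he⟩
        rintro rfl
        exact .eps he
    rw [saturated]
    generalize iterDown (fun q E => E ∪ {((q, none, q) : ℕ × Option (DyckLetter n) × ℕ)}) m E = E₀
      at h0
    induction m * m with
    | zero => exact h0
    | succ k ih =>
      rw [Function.iterate_succ_apply']
      refine sweepEdges_induction (P := fun E' => ∀ e ∈ E',
        (e.2.1 = none → DyckPath (fun q o p => (q, o, p) ∈ E) e.1 e.2.2) ∧
          (e.2.1 ≠ none → e ∈ E)) ?_ ih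
      rintro q - x - y - p - f hf E' h e (he | ⟨rfl, h1, h2, h3⟩)
      · exact h e he
      · refine ⟨fun _ => ?_, fun h => absurd rfl h⟩
        have h2 := (h _ h2).1 rfl
        simp only [patterns, List.mem_cons, List.mem_map] at hf
        rcases hf with rfl | ⟨i, -, rfl⟩
        · exact ((h _ h1).1 rfl).trans (h2.trans ((h _ h3).1 rfl))
        · exact .bracket i ((h _ h1).2 (by simp)) h2 ((h _ h3).2 (by simp))
  · intro h
    have hsat := sweepEdges_saturated (m := m) E
    obtain ⟨hs, hrefl⟩ := mem_saturated_self (m := m) (E := E)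
    -- Sweeps range over vertices below `m` only, so the bound on the end point belongs to the
    -- induction.
    suffices H : (q, none, p) ∈ saturated m E ∧ p < m from H.1
    induction h with
    | refl q => exact ⟨hrefl q hq, hq⟩
    | eps h => exact ⟨hs h, (hE _ h).2⟩
    | trans _ _ ih₁ ih₂ =>
      obtain ⟨h1, h2⟩ := ih₁ hq
      obtain ⟨h3, h4⟩ := ih₂ h2
      -- Transitivity is the pattern of three ε-edges, the first of which is the loop at `q`.
      exact ⟨mem_of_sweepEdges_eq hsat hq hq h2 h4 (f := (none, none)) (by simp [patterns])
        (hrefl _ hq) h1 h3, h4⟩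
    | bracket i h1 _ h2 ih =>
      obtain ⟨h3, h4⟩ := ih (hE _ h1).2
      exact ⟨mem_of_sweepEdges_eq hsat hq (hE _ h1).2 h4 (hE _ h2).2
        (f := (some (.opening i), some (.closing i))) (by simp [patterns]) (hs h1) h3 (hs h2),
        (hE _ h2).2⟩

end DecisionProg

/-! ### Parsing descriptions of automata -/

/-- The state of a parser for descriptions of automata: the last letter that is not a tick, whether
no error has been found, the number of states, the initial state, the last source of a transition,
the number of ticks since the last other letter, the accepting states and the transitions. -/
structure ParseState (α : Type) where
  phase : Option (DescSymbol α)
  ok : Bool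
  N : ℕ
  s : ℕ
  q : ℕ
  c : ℕ
  accs : List ℕ
  edges : List (ℕ × Option α × ℕ)

namespace ParseState

open NFADescription

variable {α : Type}

/-- The initial state of the parser. -/
def initial (α : Type) : ParseState α := ⟨none, true, 0, 0, 0, 0, [], []⟩

/-- The effect of the end of a sequence of ticks. -/
def finish (σ : ParseState α) : ParseState α :=
  match σ.phase with
  | none => { σ with N := σ.c }
  | some .init => { σ with ok := σ.ok && decide (σ.c < σ.N), s := σ.c }
  | some .acc => { σ with ok := σ.ok && decide (σ.c < σ.N), accs := σ.accs ++ [σ.c] }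
  | some .edge => { σ with ok := σ.ok && decide (σ.c < σ.N), q := σ.c }
  | some (.label o) =>
    { σ with ok := σ.ok && decide (σ.c < σ.N), edges := σ.edges ++ [(σ.q, o, σ.c)] }
  | some .tick => { σ with ok := σ.ok && decide (σ.c < σ.N) }

/-- The symbols other than ticks that may follow. -/
def follows : Option (DescSymbol α) → InputSymbol (DescSymbol α) → Bool
  | none, .letter .init => true
  | some .init, .letter .acc => true
  | some .init, .letter .edge => true
  | some .init, .rightEnd => true
  | some .acc, .letter .acc => true
  | some .acc, .letter .edge => true
  | some .acc, .rightEnd => true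
  | some .edge, .letter (.label _) => true
  | some (.label _), .letter .edge => true
  | some (.label _), .rightEnd => true
  | _, _ => false

/-- The letter of a symbol. -/
def toPhase : InputSymbol (DescSymbol α) → Option (DescSymbol α)
  | .letter b => some b
  | _ => none

/-- The test for ticks. -/
def isTick : InputSymbol (DescSymbol α) → Bool
  | .letter .tick => true
  | _ => false

/-- The effect of a symbol other than a tick. -/
def next (σ : ParseState α) (x : InputSymbol (DescSymbol α)) : ParseState α :=
  { σ.finish with phase := toPhase x, ok := σ.finish.ok && follows σ.phase x, c := 0 }

/-- The effect of a symbol. -/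
def step (σ : ParseState α) (x : InputSymbol (DescSymbol α)) : ParseState α :=
  bif isTick x then { σ with c := σ.c + 1 } else σ.next x

/-- The state after some letters. -/
def run (σ : ParseState α) (u : List (DescSymbol α)) : ParseState α :=
  u.foldl (fun σ b => σ.step (.letter b)) σ

/-- The state after the whole input. -/
def final (w : List (DescSymbol α)) : ParseState α := ((initial α).run w).step .rightEnd

theorem run_append (σ : ParseState α) (u v : List (DescSymbol α)) :
    σ.run (u ++ v) = (σ.run u).run v := List.foldl_append ..

/-- The description that has been read. -/
def word (N s : ℕ) (accs : List ℕ) (edges : List (ℕ × Option α × ℕ)) : List (DescSymbol α) :=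
  tally α N ++ .init :: tally α s ++ accs.flatMap (fun q => .acc :: tally α q) ++
    edges.flatMap (fun e => .edge :: tally α e.1 ++ .label e.2.1 :: tally α e.2.2)

/-- The states are in the range. -/
def Bounded (N s : ℕ) (accs : List ℕ) (edges : List (ℕ × Option α × ℕ)) : Prop :=
  s < N ∧ (∀ a ∈ accs, a < N) ∧ ∀ e ∈ edges, e.1 < N ∧ e.2.2 < N

/-- The letters that have been read, if there was no error. -/
def Parsed (σ : ParseState α) (u : List (DescSymbol α)) : Prop :=
  match σ.phase with
  | none => u = tally α σ.c ∧ σ.accs = [] ∧ σ.edges = []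
  | some .init => u = tally α σ.N ++ .init :: tally α σ.c ∧ σ.accs = [] ∧ σ.edges = []
  | some .acc => u = word σ.N σ.s σ.accs [] ++ .acc :: tally α σ.c ∧ σ.edges = [] ∧
      Bounded σ.N σ.s σ.accs σ.edges
  | some .edge => u = word σ.N σ.s σ.accs σ.edges ++ .edge :: tally α σ.c ∧
      Bounded σ.N σ.s σ.accs σ.edges
  | some (.label o) => u = word σ.N σ.s σ.accs σ.edges ++ .edge :: tally α σ.q ++
      .label o :: tally α σ.c ∧ σ.q < σ.N ∧ Bounded σ.N σ.s σ.accs σ.edges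
  | some .tick => False

theorem tally_succ (k : ℕ) : tally α (k + 1) = tally α k ++ [.tick] := List.replicate_succ'

theorem ok_of_finish {σ : ParseState α} (h : σ.finish.ok = true) : σ.ok = true := by
  obtain ⟨ph, ok, N, s, q, c, accs, edges⟩ := σ
  rcases ph with _ | _ | _ | _ | _ | o <;> simp_all [finish]

/-- Errors are never forgotten, so a positive verdict at the end makes the invariant `Parsed`
available for every prefix. -/
theorem ok_of_step {σ : ParseState α} {x} (h : (σ.step x).ok = true) : σ.ok = true := by
  unfold step at h
  cases hx : isTick x
  · simp only [hx, cond_false, next, Bool.and_eq_true] at h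
    exact ok_of_finish h.1
  · simpa [hx] using h

/-- At the end of the description of an object. -/
theorem Parsed.finish {σ : ParseState α} {u : List (DescSymbol α)} (h : σ.Parsed u)
    (hok : σ.finish.ok = true) (hf : follows σ.phase .rightEnd = true) :
    u = word σ.finish.N σ.finish.s σ.finish.accs σ.finish.edges ∧
      Bounded σ.finish.N σ.finish.s σ.finish.accs σ.finish.edges := by
  obtain ⟨ph, ok, N, s, q, c, accs, edges⟩ := σ
  rcases ph with _ | _ | _ | _ | _ | o
  · simp [follows] at hf
  · simp [follows] at hf
  · obtain ⟨rfl, h1, h2⟩ := h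
    dsimp only at h1 h2
    subst h1 h2
    simp only [ParseState.finish, Bool.and_eq_true, decide_eq_true_eq] at hok
    simp [ParseState.finish, word, Bounded, hok.2]
  · obtain ⟨rfl, h1, h2, h3, -⟩ := h
    dsimp only at h1 h2 h3
    subst h1
    simp only [ParseState.finish, Bool.and_eq_true, decide_eq_true_eq] at hok
    simp only [ParseState.finish, word, Bounded]
    refine ⟨by simp, h2, ?_, by simp⟩
    simp only [List.mem_append, List.mem_singleton]
    rintro a (ha | rfl)
    exacts [h3 a ha, hok.2]
  · simp [follows] at hf
  · obtain ⟨rfl, h1, h2, h3, h4⟩ := h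
    dsimp only at h1 h2 h3 h4
    simp only [ParseState.finish, Bool.and_eq_true, decide_eq_true_eq] at hok
    simp only [ParseState.finish, word, Bounded]
    refine ⟨by simp, h2, h3, ?_⟩
    simp only [List.mem_append, List.mem_singleton]
    rintro a (ha | rfl)
    exacts [h4 a ha, ⟨h1, hok.2⟩]

theorem Parsed.step {σ : ParseState α} {u : List (DescSymbol α)} (h : σ.Parsed u)
    {b : DescSymbol α} (hok : (σ.step (.letter b)).ok = true) :
    (σ.step (.letter b)).Parsed (u ++ [b]) := by
  rcases b with _ | _ | _ | _ | o
  · obtain ⟨ph, ok, N, s, q, c, accs, edges⟩ := σ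
    rcases ph with _ | _ | _ | _ | _ | o <;>
      simp_all [Parsed, ParseState.step, isTick, tally_succ]
    obtain ⟨-, rfl, h⟩ := h
    exact h
  -- A letter other than a tick closes the pending number. `follows` leaves few phases, and in those
  -- where an object is complete, `hfin` turns the number into data that are known to be in range.
  all_goals
    simp only [ParseState.step, isTick, cond_false, next, Bool.and_eq_true] at hok ⊢
    have hfin := h.finish hok.1
    obtain ⟨ph, ok, N, s, q, c, accs, edges⟩ := σ
  · rcases ph with _ | _ | _ | _ | _ | o <;> simp [follows] at hok
    simp_all [Parsed, toPhase, ParseState.finish, tally]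
  · rcases ph with _ | _ | _ | _ | _ | o <;> simp [follows] at hok
    · have := hfin rfl
      simp_all [Parsed, toPhase, ParseState.finish, tally]
    · have := hfin rfl
      simp_all [Parsed, toPhase, ParseState.finish, tally]
  · rcases ph with _ | _ | _ | _ | _ | o <;> simp [follows] at hok
    · have := hfin rfl
      simp_all [Parsed, toPhase, ParseState.finish, tally]
    · have := hfin rfl
      simp_all [Parsed, toPhase, ParseState.finish, tally]
    · have := hfin rfl
      simp_all [Parsed, toPhase, ParseState.finish, tally]
  · rcases ph with _ | _ | _ | _ | _ | o <;> simp [follows] at hok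
    simp_all [Parsed, toPhase, ParseState.finish, tally]

theorem parsed_run {u : List (DescSymbol α)} (h : ((initial α).run u).ok = true) :
    ((initial α).run u).Parsed u := by
  induction u using List.reverseRecOn with
  | nil => exact ⟨rfl, rfl, rfl⟩
  | append_singleton u b ih =>
    rw [run_append] at h ⊢
    exact (ih (ok_of_step h)).step h

/-- The lists of numbers in a description. -/
theorem encode_eq_word (D : NFADescription α) : D.encode =
    word D.numStates D.start (D.accepting.map (·.val))
      (D.transitions.map fun e => (e.1.val, e.2.1, e.2.2.val)) := by
  simp [encode, word, List.flatMap_map]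

theorem exists_encode {N s : ℕ} {accs : List ℕ} {edges : List (ℕ × Option α × ℕ)}
    (h : Bounded N s accs edges) : ∃ D : NFADescription α, D.encode = word N s accs edges := by
  obtain ⟨h1, h2, h3⟩ := h
  -- The value for numbers out of range is arbitrary; none occurs.
  set f : ℕ → Fin N := fun k => if hk : k < N then ⟨k, hk⟩ else ⟨s, h1⟩ with hf
  have hf' : ∀ k, k < N → (f k).val = k := fun k hk => by simp [hf, hk]
  refine ⟨⟨N, ⟨s, h1⟩, accs.map f, edges.map fun e => (f e.1, e.2.1, f e.2.2)⟩, ?_⟩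
  rw [encode_eq_word]
  congr 1
  · simp only [List.map_map]
    exact (List.map_congr_left fun a ha => hf' a (h2 a ha)).trans (List.map_id _)
  · simp only [List.map_map]
    refine (List.map_congr_left fun e he => ?_).trans (List.map_id _)
    obtain ⟨h4, h5⟩ := h3 e he
    simp [hf' _ h4, hf' _ h5]

/-- Soundness of the parser: the right end marker closes the last number, and the invariant then
exhibits the data, with all states in range. -/
theorem exists_encode_of_ok {w : List (DescSymbol α)} (h : (final w).ok = true) :
    ∃ D : NFADescription α, D.encode = w := by
  have h1 := parsed_run (ok_of_step h)
  simp only [final, step, isTick, cond_false, next, Bool.and_eq_true] at h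
  obtain ⟨h2, h3⟩ := h1.finish h.1 h.2
  obtain ⟨D, hD⟩ := exists_encode h3
  exact ⟨D, hD.trans h2.symm⟩

theorem run_tally (σ : ParseState α) (k : ℕ) : σ.run (tally α k) = { σ with c := σ.c + k } := by
  induction k with
  | zero => rfl
  | succ k ih =>
    rw [tally_succ, run_append, ih]
    rfl

/-- A description of an automaton without mistakes has been read, up to the end of the last
sequence of ticks. -/
def Complete (σ : ParseState α) (N s : ℕ) (accs : List ℕ) (edges : List (ℕ × Option α × ℕ)) : Prop :=
  σ.finish.ok = true ∧ σ.finish.N = N ∧ σ.finish.s = s ∧ σ.finish.accs = accs ∧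
    σ.finish.edges = edges ∧ follows σ.phase .rightEnd = true ∧
    follows σ.phase (.letter .edge) = true ∧
    (edges = [] → follows σ.phase (.letter .acc) = true)

theorem run_cons_tally (σ : ParseState α) {b : DescSymbol α} (hb : isTick (.letter b) = false)
    (k : ℕ) : σ.run (b :: tally α k) = { σ.next (.letter b) with c := k } := by
  rw [show b :: tally α k = [b] ++ tally α k from rfl, run_append, run_tally]
  simp [run, step, hb, next]

theorem Complete.acc {σ : ParseState α} {N s : ℕ} {accs : List ℕ} (h : σ.Complete N s accs [])
    {k : ℕ} (hk : k < N) : (σ.run (.acc :: tally α k)).Complete N s (accs ++ [k]) [] := by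
  obtain ⟨h1, h2, h3, h4, h5, h6, h7, h8⟩ := h
  rw [run_cons_tally _ rfl]
  refine ⟨?_, ?_, ?_, ?_, ?_, rfl, rfl, fun _ => rfl⟩ <;>
    simp_all [ParseState.finish, next, toPhase]

theorem Complete.edge {σ : ParseState α} {N s : ℕ} {accs : List ℕ}
    {edges : List (ℕ × Option α × ℕ)} (h : σ.Complete N s accs edges) {q p : ℕ} (o : Option α)
    (hq : q < N) (hp : p < N) : (σ.run (.edge :: tally α q ++ .label o :: tally α p)).Complete N s
      accs (edges ++ [(q, o, p)]) := by
  obtain ⟨h1, h2, h3, h4, h5, h6, h7, h8⟩ := h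
  rw [run_append, run_cons_tally _ rfl, run_cons_tally _ rfl]
  refine ⟨?_, ?_, ?_, ?_, ?_, rfl, rfl, fun h => by simp at h⟩ <;>
    simp_all [ParseState.finish, next, toPhase, follows]

/-- Completeness of the parser, adding entries at the right ends of the lists. An accepting state
may be appended only while there are no transitions, hence the nesting of the inductions. -/
theorem complete_run {N s : ℕ} {accs : List ℕ} {edges : List (ℕ × Option α × ℕ)}
    (h : Bounded N s accs edges) : ((initial α).run (word N s accs edges)).Complete N s accs edges := by
  obtain ⟨h1, h2, h3⟩ := h
  induction edges using List.reverseRecOn with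
  | nil =>
    clear h3
    induction accs using List.reverseRecOn with
    | nil =>
      rw [word]
      simp only [List.flatMap_nil, List.append_nil]
      rw [run_append, run_tally, run_cons_tally _ rfl]
      refine ⟨?_, ?_, ?_, ?_, ?_, rfl, rfl, fun _ => rfl⟩ <;>
        simp [ParseState.finish, next, toPhase, initial, follows, h1]
    | append_singleton accs a ih =>
      have := (ih fun a ha => h2 a (by simp [ha])).acc (h2 a (by simp))
      rw [← run_append] at this
      convert this using 2
      simp [word]
  | append_singleton edges e ih =>
    have h4 := h3 e (by simp)
    have := (ih fun e he => h3 e (by simp [he])).edge e.2.1 h4.1 h4.2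
    rw [← run_append] at this
    convert this using 2
    simp [word]

theorem final_encode (D : NFADescription α) : (final D.encode).ok = true ∧
    (final D.encode).s = D.start ∧ (final D.encode).accs = D.accepting.map (·.val) ∧
    (final D.encode).edges = D.transitions.map fun e => (e.1.val, e.2.1, e.2.2.val) := by
  have h := complete_run (α := α) (N := D.numStates) (s := D.start)
    (accs := D.accepting.map (·.val))
    (edges := D.transitions.map fun e => (e.1.val, e.2.1, e.2.2.val))
    ⟨D.start.2, by simp, by
      simp only [List.mem_map]
      rintro _ ⟨e, -, rfl⟩
      exact ⟨e.1.2, e.2.2.2⟩⟩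
  rw [← encode_eq_word] at h
  obtain ⟨h1, h2, h3, h4, h5, h6, h7, h8⟩ := h
  simp [final, step, isTick, next, h1, h3, h4, h5, h6]

end ParseState

/-! ### The program for the realizability problem -/

namespace DecisionProg

open LoopProg

variable {α : Type} {w : List (DescSymbol α)}

/-- The states during the parsing of the input. -/
noncomputable def parseState (w : List (DescSymbol α)) (σ : ParseState α) (k l : ℕ) :
    DecisionState α where
  val := ![0, w.length + 1, σ.N, σ.s, σ.q, σ.c, 0, 0, 0, 0, l, 0, 0, 0, 0, 0]
  pos := k
  ptr := 0
  mem := graphCells (w.length + 1) {a | a ∈ σ.accs} {e | e ∈ σ.edges}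
  reg := ⟨σ.phase, σ.ok, false, false⟩
  out := []

theorem ready_parseState {σ : ParseState α} {k l : ℕ} (hk : k ≤ w.length + 1) :
    Ready w (w.length + 1) (parseState w σ k l) := ⟨rfl, rfl, rfl, rfl, hk⟩

theorem exec_loop_dec {A B R C : Type} {K : ℕ} {w : List A} {a x y : Fin (K + 1)} (hay : a ≠ y)
    {s : LoopState B R C K} (ha : s.val a = 0) :
    exec w (LoopProg.loop a x (dec y)) s = s.set y (s.val y - s.val x) :=
  exec_loop_eq (fun n => s.set y (s.val y - (s.val x - n)))
    (by simp [LoopState.set_self]) (fun _ _ => by simp [Function.update_of_ne hay, ha])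
    fun n hn => by
      simp only [exec, LoopState.val_set, Function.update_of_ne hay.symm, Function.update_self]
      rw [LoopState.set_comm _ hay, LoopState.set_set]
      congr 2
      omega

/-- Record an error if the counter `5` is not less than the counter `2`. -/
def checkLt : DecisionProg α :=
  .seq (.copy 9 2) (.seq (.loop 6 5 (.dec 9)) (.seq
    (.ifz 9 (.loc fun _ r c => ({ r with ok := false }, c, .stay, .stay, none)) skip) (.copy 9 8)))

/-- The truncated difference `σ.N - σ.c` vanishes iff the number is out of range; the counter 9 is
cleared afterwards so that the state is again a `parseState`. -/
theorem exec_checkLt {σ : ParseState α} {k l : ℕ} (hk : k ≤ w.length + 1) :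
    exec w checkLt (parseState w σ k l) =
      parseState w { σ with ok := σ.ok && decide (σ.c < σ.N) } k l := by
  have h1 : exec w (.copy 9 2) (parseState w σ k l) = (parseState w σ k l).set 9 σ.N := rfl
  have h2 := exec_loop_dec (w := w) (a := 6) (x := 5) (y := 9) (by decide)
    (s := (parseState w σ k l).set 9 σ.N) rfl
  rw [LoopState.set_set, show ((parseState w σ k l).set 9 σ.N).val 9 -
    ((parseState w σ k l).set 9 σ.N).val 5 = σ.N - σ.c from rfl] at h2
  have h3 : ∀ (r : DecisionReg α) d, exec w (.copy 9 8)
      ({ (parseState w σ k l).set 9 d with reg := r } : DecisionState α) =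
      { parseState w σ k l with reg := r } := by
    intro r d
    simp only [exec, LoopState.set, parseState, LoopState.mk.injEq, and_true]
    funext j
    fin_cases j <;> rfl
  have h4 : ((parseState w σ k l).set 9 (σ.N - σ.c)).val 9 = σ.N - σ.c := by simp
  rw [checkLt, exec, h1, exec, h2, exec.eq_5, exec.eq_7, h4]
  split_ifs with h
  · rw [exec]
    have h5 : ((parseState w σ k l).set 9 (σ.N - σ.c)).localStep w
        ({ (parseState w σ k l).reg with ok := false }, (parseState w σ k l).mem 0,
          .stay, .stay, none) = { (parseState w σ k l).set 9 (σ.N - σ.c) with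
        reg := { (parseState w σ k l).reg with ok := false } } := by
      simp [LoopState.localStep, parseState, LoopState.set, OfflineTM.moveHead, hk]
    refine (congrArg _ h5).trans ((h3 _ _).trans ?_)
    simp [parseState, show ¬σ.c < σ.N by omega]
  · rw [exec_skip hk]
    refine (h3 (parseState w σ k l).reg _).trans ?_
    simp [parseState, show σ.c < σ.N by omega]

/-- Finish the description of an object. -/
noncomputable def finishProg : DecisionProg α :=
  .ite (fun _ r _ => match r.phase with | none => true | _ => false) (.copy 2 5)
    (.seq checkLt (.ite (fun _ r _ => match r.phase with | some .init => true | _ => false)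
      (.copy 3 5) (.ite (fun _ r _ => match r.phase with | some .acc => true | _ => false)
        (access 8 5 fun r c => (r, c.mark none true))
        (.ite (fun _ r _ => match r.phase with | some .edge => true | _ => false) (.copy 4 5)
          (access 4 5 fun r c => (r, match r.phase with
            | some (.label o) => c.mark (some o) true
            | _ => c))))))

/-- The bound `hc` keeps the column within a row of the array. The counter 8, which is zero,
addresses the row of the accepting marks. -/
theorem exec_finishProg {σ : ParseState α} {k l : ℕ} (hk : k ≤ w.length + 1)
    (hc : σ.c ≤ w.length) :
    exec w finishProg (parseState w σ k l) = parseState w σ.finish k l := by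
  obtain ⟨ph, ok, N, s, q, c, accs, edges⟩ := σ
  have hacc : ∀ (x y : Fin 16) (g : DecisionReg α → GraphCell α → DecisionReg α × GraphCell α) σ,
      exec w (access x y g) (parseState w σ k l) = _ := fun x y g σ =>
    exec_access (ready_parseState hk) x y g (parseState w σ k l).reg (parseState w σ k l).mem
  rcases ph with _ | _ | _ | _ | _ | o
  · simp only [finishProg, exec, parseState, cond_true, ParseState.finish,
      LoopState.set, LoopState.mk.injEq, and_true]
    funext j
    fin_cases j <;> rfl
  all_goals
    simp only [finishProg, exec, cond_false, exec_checkLt hk, show ∀ σ : ParseState α,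
      (parseState w σ k l).reg.phase = σ.phase from fun _ => rfl, cond_true, hacc]
  · simp only [Function.update_eq_self]
    rfl
  · simp only [parseState, ParseState.finish, LoopState.set, LoopState.mk.injEq, and_true]
    funext j
    fin_cases j <;> rfl
  · have h := update_graphCells_none (m := w.length + 1) (V := {a | a ∈ accs})
      (E := {e : ℕ × Option α × ℕ | e ∈ edges}) (x := 0) (y := c) rfl
    refine (congrArg (fun m => ({ parseState w
      ⟨some .acc, ok && decide (c < N), N, s, q, c, accs, edges⟩ k l with mem := m } :
        DecisionState α)) h).trans ?_
    simp only [parseState, ParseState.finish]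
    congr 2
    ext e
    simp [or_comm]
  · simp only [parseState, ParseState.finish, LoopState.set, LoopState.mk.injEq, and_true]
    funext j
    fin_cases j <;> rfl
  · have h := update_graphCells_some (m := w.length + 1) (V := {a | a ∈ accs})
      (E := {e : ℕ × Option α × ℕ | e ∈ edges}) (x := q) (y := c)
      (Nat.lt_succ_of_le hc) o true
    refine (congrArg (fun m => ({ parseState w
      ⟨some (.label o), ok && decide (c < N), N, s, q, c, accs, edges⟩ k l with mem := m } :
        DecisionState α)) h).trans ?_
    simp only [parseState, ParseState.finish]
    congr 2
    ext e
    simp [or_comm]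

/-- Read a symbol. -/
noncomputable def parseBody : DecisionProg α :=
  .seq (moveInput .right) (.ite (fun a _ _ => ParseState.isTick a) (.inc 5)
    (.seq finishProg (.seq (.loc fun a r c => ({ r with
      phase := ParseState.toPhase a
      ok := r.ok && ParseState.follows r.phase a }, c, .stay, .stay, none)) (.copy 5 8))))

theorem phase_finish (σ : ParseState α) : σ.finish.phase = σ.phase := by
  obtain ⟨ph, ok, N, s, q, c, accs, edges⟩ := σ
  rcases ph with _ | _ | _ | _ | _ | o <;> rfl

theorem exec_parseBody {σ : ParseState α} {k l : ℕ} (hk : k ≤ w.length) (hc : σ.c ≤ w.length) :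
    exec w parseBody (parseState w σ k l) =
      parseState w (σ.step (OfflineTM.inputAt w (k + 1))) (k + 1) l := by
  have h1 : exec w (moveInput .right) (parseState w σ k l) = parseState w σ (k + 1) l := by
    rw [exec_moveInput]
    simp only [parseState, OfflineTM.moveHead]
    congr 1
    omega
  rw [parseBody, exec, h1, exec, show (parseState w σ (k + 1) l).pos = k + 1 from rfl,
    ParseState.step]
  cases ParseState.isTick (OfflineTM.inputAt w (k + 1))
  · simp only [cond_false]
    rw [exec, exec_finishProg (by omega) hc, exec, exec,
      show (parseState w σ.finish (k + 1) l).pos = k + 1 from rfl]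
    generalize OfflineTM.inputAt w (k + 1) = a
    simp only [exec, LoopState.localStep, OfflineTM.moveHead, parseState, LoopState.set,
      ParseState.next, phase_finish, Function.update_eq_self, LoopState.mk.injEq, and_true,
      Option.toList, List.append_nil]
    refine ⟨?_, by omega⟩
    funext j
    fin_cases j <;> rfl
  · simp only [cond_true, exec, parseState, LoopState.set, LoopState.mk.injEq, and_true]
    funext j
    fin_cases j <;> rfl

/-- The state of the parser after some symbols. -/
def parseAfter (w : List (DescSymbol α)) : ℕ → ParseState α
  | 0 => .initial α
  | k + 1 => (parseAfter w k).step (OfflineTM.inputAt w (k + 1))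

/-- Each of these values counts ticks that have been read. The bound serves the access to the array
as well as the running time. -/
theorem parseAfter_bound (w : List (DescSymbol α)) (k : ℕ) : (parseAfter w k).c ≤ k ∧
    (parseAfter w k).N ≤ k ∧ (parseAfter w k).s ≤ k ∧ (parseAfter w k).q ≤ k := by
  induction k with
  | zero => simp [parseAfter, ParseState.initial]
  | succ k ih =>
    rw [parseAfter]
    generalize parseAfter w k = σ at ih
    rw [ParseState.step]
    cases ParseState.isTick (OfflineTM.inputAt w (k + 1))
    · obtain ⟨ph, ok, N, s, q, c, accs, edges⟩ := σ
      dsimp only at ih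
      rcases ph with _ | _ | _ | _ | _ | o <;>
        simp only [cond_false, ParseState.next, ParseState.finish] <;> omega
    · simp only [cond_true]; omega

theorem parseAfter_length (w : List (DescSymbol α)) :
    parseAfter w (w.length + 1) = ParseState.final w := by
  have h : ∀ k ≤ w.length, parseAfter w k = (ParseState.initial α).run (w.take k) := by
    intro k
    induction k with
    | zero => intro _; simp [parseAfter, ParseState.run]
    | succ k ih =>
      intro hk
      rw [parseAfter, ih (by omega), List.take_succ_eq_append_getElem (by omega),
        ParseState.run_append]
      rw [OfflineTM.inputAt, List.getElem?_eq_getElem (by omega)]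
      rfl
  rw [parseAfter, h _ le_rfl, List.take_length, ParseState.final, OfflineTM.inputAt,
    List.getElem?_eq_none (by omega)]

/-- Read the input. -/
noncomputable def parseProg : DecisionProg α := .loop 10 1 parseBody

theorem polyTime_parseBody : (parseBody : DecisionProg α).PolyTime := by
  refine .seq (Growth.polyTime (fun _ => False) trivial) (.ite
    (Growth.polyTime (p := .inc 5) (fun _ => True) trivial) (Growth.polyTime (fun _ => False) ?_) _)
  simp [Growth, finishProg, checkLt, growth_atCell, skip, moveInput]

theorem set_parseState (σ : ParseState α) (k l l' : ℕ) :
    (parseState w σ k l).set 10 l' = parseState w σ k l' := by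
  simp only [parseState, LoopState.set, LoopState.mk.injEq, and_true]
  funext j
  fin_cases j <;> rfl

theorem parse_step (w : List (DescSymbol α)) {j : ℕ} (hj : j < w.length + 1) :
    exec w parseBody ((parseState w (parseAfter w (w.length + 1 - (j + 1)))
      (w.length + 1 - (j + 1)) 0).set 10 j) =
    (parseState w (parseAfter w (w.length + 1 - j)) (w.length + 1 - j) 0).set 10 j := by
  have h := parseAfter_bound w (w.length - j)
  rw [set_parseState, set_parseState, show w.length + 1 - (j + 1) = w.length - j by omega,
    exec_parseBody (by omega) (by omega), show w.length + 1 - j = w.length - j + 1 by omega]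
  rfl

theorem exec_parseProg (w : List (DescSymbol α)) :
    exec w parseProg (parseState w (.initial α) 0 0) =
      parseState w (ParseState.final w) (w.length + 1) 0 := by
  rw [← parseAfter_length]
  exact exec_loop_eq (fun j => parseState w (parseAfter w (w.length + 1 - j))
    (w.length + 1 - j) 0) (by
      change parseState w (parseAfter w (w.length + 1 - (w.length + 1)))
        (w.length + 1 - (w.length + 1)) 0 = _
      rw [Nat.sub_self]; rfl) (fun _ _ => rfl) fun j hj => parse_step w hj

theorem parseState_val_le {σ : ParseState α} {k l b : ℕ} (hw : w.length + 1 ≤ b) (hN : σ.N ≤ b)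
    (hs : σ.s ≤ b) (hq : σ.q ≤ b) (hc : σ.c ≤ b) (hl : l ≤ b) (j : Fin 16) :
    (parseState w σ k l).val j ≤ b := by
  fin_cases j <;> first | assumption | exact Nat.zero_le _

/-- The counter 5 is both incremented and copied, which `Growth` excludes. Instead, the bound for
one round is applied along the trajectory, where no counter exceeds `w.length + 1`. -/
theorem time_parseProg : ∃ T, PolyBounded T ∧ ∀ w : List (DescSymbol α),
    time w parseProg (parseState w (.initial α) 0 0) ≤ T w.length := by
  obtain ⟨k, hk⟩ := polyTime_parseBody (α := α)
  have hi := PolyBounded.id.add (.const 1)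
  refine ⟨fun n => 5 * (n + 1) + 4 + (n + 1) * ((n + 1 + k) ^ k + 2),
    (((PolyBounded.const 5).mul hi).add (.const 4)).add
      (hi.mul (((hi.add (.const k)).pow k).add (.const 2))), fun w => ?_⟩
  have := time_loop_le (a := 10) (x := 1) (p := parseBody) (s := parseState w (.initial α) 0 0)
    (fun j => parseState w (parseAfter w (w.length + 1 - j)) (w.length + 1 - j) 0) (by
      change parseState w (parseAfter w (w.length + 1 - (w.length + 1)))
        (w.length + 1 - (w.length + 1)) 0 = _
      rw [Nat.sub_self]; rfl) (fun _ _ => rfl) (fun j hj => parse_step w hj)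
    (c := (w.length + 1 + k) ^ k) (fun j hj => by
      have hj' : j < w.length + 1 := hj
      have := parseAfter_bound w (w.length + 1 - (j + 1))
      rw [set_parseState]
      exact hk _ _ _ fun i => parseState_val_le le_rfl (by omega) (by omega) (by omega)
        (by omega) (by omega) i)
  refine this.trans (le_of_eq ?_)
  change 0 + 5 * (w.length + 1) + 4 + (w.length + 1) * _ = _
  rw [Nat.zero_add]

end DecisionProg

/-! ### The decision procedure: correctness and running time -/

namespace DecisionProg

open LoopProg

variable {n : ℕ} {w : List (DescSymbol (DyckLetter n))}

/-- Look for an edge from the initial state to an accepting state. -/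
def answer {α : Type} : DecisionProg α :=
  .loop 10 1 (.seq (access 3 10 fun r c => ({ r with test := c (some none) }, c))
    (access 8 10 fun r c => ({ r with test := false, found := r.found || (r.test && c none) }, c)))

/-- The state with a given answer. -/
def withAnswer {α : Type} (s : DecisionState α) (b : Bool) : DecisionState α :=
  { s with reg := { s.reg with found := b } }

open Classical in
theorem acts_answer {α : Type} {w : List (DescSymbol α)} {m : ℕ} {V : Set ℕ}
    {E : Set (ℕ × Option α × ℕ)} {s : DecisionState α} (h : Ready w m s)
    (hmem : s.mem = graphCells m V E) (ht : s.reg.test = false) (h8 : s.val 8 = 0)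
    (h10 : s.val 10 = 0) : Acts w answer (withAnswer s)
      (iterDown (fun p b => b || (decide ((s.val 3, none, p) ∈ E) && decide (p ∈ V))) m) := by
  refine Acts.loop (fun _ => h10) (fun _ => h.one) fun p hp b => ?_
  have h' : Ready w m (s.set 10 p) := h.set (by decide) (by decide) (by decide)
  have e1 := exec_access h' 3 10 (fun r c => ({ r with test := c (some none) }, c))
    { s.reg with found := b } (graphCells m V E)
  have e2 := exec_access h' 8 10
    (fun r c => ({ r with test := false, found := r.found || (r.test && c none) }, c))
    { s.reg with found := b, test := decide ((s.val 3, none, p) ∈ E) } (graphCells m V E)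
  rw [show (s.set 10 p).val 10 = p from rfl] at e1 e2
  rw [show (s.set 10 p).val 3 = s.val 3 from rfl] at e1
  rw [show (s.set 10 p).val 8 = 0 from h8, zero_mul, zero_add] at e2
  simp only [Function.update_eq_self, graphCells_some hp] at e1 e2
  have e0 : (withAnswer s b).set 10 p =
      { s.set 10 p with mem := graphCells m V E, reg := { s.reg with found := b } } := by
    rw [← hmem]; rfl
  change exec w _ (exec w _ ((withAnswer s b).set 10 p)) = (withAnswer s _).set 10 p
  rw [e0, e1, e2]
  simp only [withAnswer, LoopState.set, graphCells, ← ht, ← hmem]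

/-- The program for the realizability problem. -/
noncomputable def decisionProg (n : ℕ) : DecisionProg (DyckLetter n) :=
  .seq parseProg (.seq addLoops (.seq (saturate n) (.seq answer
    (.loc fun _ r c => (r, c, .stay, .stay, some (r.ok && r.found))))))

theorem initState_eq : initState Bool (⟨none, true, false, false⟩ : DecisionReg (DyckLetter n))
    (fun _ => false) (1 : Fin 16) w = parseState w (.initial _) 0 0 := by
  simp only [initState, parseState, ParseState.initial, LoopState.mk.injEq, and_true, true_and]
  constructor
  · funext j
    fin_cases j <;> rfl
  · funext i f
    rcases f with _ | o <;> simp [graphCells]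

theorem iterDown_or {G : ℕ → Bool} (k : ℕ) (b : Bool) :
    iterDown (fun p b => b || G p) k b = true ↔ b = true ∨ ∃ p < k, G p = true := by
  induction k generalizing b with
  | zero => simp [iterDown]
  | succ k ih =>
    rw [iterDown, ih, Bool.or_eq_true, or_assoc, Nat.exists_lt_succ_right, or_comm (a := G k = true)]

-- The verdict of the parser enters only when the answer is printed; the graph built from a
-- malformed input is harmless, because `ok` is false then.
open Classical in
theorem out_decisionProg (w : List (DescSymbol (DyckLetter n))) :
    ∃ b, (exec w (decisionProg n) (parseState w (.initial _) 0 0)).out = [b] ∧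
      (b = true ↔ (ParseState.final w).ok = true ∧ ∃ p < w.length + 1,
        ((ParseState.final w).s, none, p) ∈
          saturated (w.length + 1) {e | e ∈ (ParseState.final w).edges} ∧
        p ∈ (ParseState.final w).accs) := by
  set m := w.length + 1 with hm
  set σ := ParseState.final w
  set s := parseState w σ m 0 with hs
  set E : Set (ℕ × Option (DyckLetter n) × ℕ) := {e | e ∈ σ.edges} with hE
  set V : Set ℕ := {a | a ∈ σ.accs} with hV
  have hr : Ready w m s := ready_parseState le_rfl
  have h0 : s = withGraph m V s E := rfl
  have h1 := acts_addLoops (V := V) hr rfl E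
  have h2 := acts_saturate (V := V) hr rfl (fun i hi => by
    fin_cases i <;> first | rfl | exact absurd hi (by decide)) (iterDown (fun q E => E ∪ {(q, none, q)}) m E)
  have h3 := acts_answer (s := withGraph m V s (saturated m E)) (V := V) (E := saturated m E)
    (w := w) (m := m) ⟨rfl, rfl, rfl, rfl, le_rfl⟩ rfl rfl rfl rfl false
  obtain ⟨b, hb, h3⟩ : ∃ b, (b = true ↔ ∃ p < m, (σ.s, none, p) ∈ saturated m E ∧ p ∈ V) ∧
      exec w answer (withAnswer (withGraph m V s (saturated m E)) false) =
        withAnswer (withGraph m V s (saturated m E)) b := by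
    refine ⟨_, ?_, h3⟩
    rw [iterDown_or]
    simp only [Bool.and_eq_true, decide_eq_true_eq, Bool.false_eq_true, false_or]
    rfl
  refine ⟨σ.ok && b, ?_⟩
  rw [decisionProg, exec, exec_parseProg, exec, ← hs, h0, h1, exec, h2, exec]
  change (exec w _ (exec w answer (withAnswer (withGraph m V s (saturated m E)) false))).out = _ ∧ _
  rw [h3]
  exact ⟨rfl, by rw [Bool.and_eq_true, hb]; rfl⟩

/-- After parsing no counter is incremented any more, so `Growth` with the empty set bounds the rest
in terms of the values that the parser leaves behind. -/
theorem time_decisionProg : ∃ T, PolyBounded T ∧ ∀ w : List (DescSymbol (DyckLetter n)),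
    time w (decisionProg n) (parseState w (.initial _) 0 0) ≤ T w.length := by
  obtain ⟨T, hT, h⟩ := time_parseProg (α := DyckLetter n)
  have hG : (.seq addLoops (.seq (saturate n) (.seq answer
      (.loc fun _ r c => (r, c, .stay, .stay, some (r.ok && r.found))))) :
      DecisionProg (DyckLetter n)).PolyTime := by
    refine Growth.polyTime (fun _ => False) ?_
    simp [Growth, addLoops, saturate, sweep, saturateStep, answer, growth_atCell, growth_all]
    rintro p x y - rfl
    simp [Growth, growth_atCell]
  obtain ⟨k, hk⟩ := hG
  refine ⟨fun l => T l + (l + 1 + k) ^ k,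
    hT.add (((PolyBounded.id.add (.const 1)).add (.const k)).pow k), fun w => ?_⟩
  rw [decisionProg, time, exec_parseProg, ← parseAfter_length]
  have hb := parseAfter_bound w (w.length + 1)
  exact Nat.add_le_add (h w) (hk _ _ _ fun j => parseState_val_le le_rfl (by omega) (by omega)
    (by omega) (by omega) (by omega) j)

theorem wellFormed_access {α : Type} {x y : Fin 16}
    (g : DecisionReg α → GraphCell α → DecisionReg α × GraphCell α) (h1 : x ≠ 0) (h2 : y ≠ 0)
    (h3 : 6 ≠ x) (h4 : 7 ≠ y) : (access x y g).WellFormed :=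
  wellFormed_atCell g ⟨by decide, by decide, by decide, h1, h2, by decide, h3, by decide, h4⟩

theorem wellFormed_parseProg {α : Type} : (parseProg : DecisionProg α).WellFormed := by
  simp [parseProg, parseBody, finishProg, checkLt, WellFormed, NoWrite, wellFormed_access,
    noWrite_atCell, skip, moveInput]

theorem wellFormed_saturateStep {α : Type} (f : Option α × Option α) :
    (saturateStep f).WellFormed ∧ ∀ j, j ≠ 6 → j ≠ 7 → (saturateStep f).NoWrite j := by
  simp +contextual [saturateStep, WellFormed, NoWrite, wellFormed_access, noWrite_atCell]

theorem wellFormed_saturate (n : ℕ) : (saturate n).WellFormed := by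
  have h1 : ∀ p ∈ (patterns n).map saturateStep, p.WellFormed ∧
      ∀ j, j ≠ 6 → j ≠ 7 → p.NoWrite j := by
    intro p hp
    obtain ⟨f, -, rfl⟩ := List.mem_map.1 hp
    exact wellFormed_saturateStep f
  have h2 := wellFormed_all.2 fun p hp => (h1 p hp).1
  have h3 : ∀ j, j ≠ 6 → j ≠ 7 → (all ((patterns n).map saturateStep)).NoWrite j :=
    fun j h6 h7 => noWrite_all.2 fun p hp => (h1 p hp).2 j h6 h7
  simp [saturate, sweep, WellFormed, NoWrite, h2, h3]

theorem wellFormed_decisionProg (n : ℕ) : (decisionProg n).WellFormed := by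
  refine ⟨wellFormed_parseProg, ?_, wellFormed_saturate n, ?_, trivial⟩
  · simp [addLoops, WellFormed, wellFormed_access, noWrite_atCell]
  · simp [answer, WellFormed, NoWrite, wellFormed_access, noWrite_atCell]

/-- Numbers are written in unary, so an array with rows longer than the input has room for all
states. -/
theorem numStates_le_length_encode {α : Type} (D : NFADescription α) :
    D.numStates ≤ D.encode.length := by
  simp only [NFADescription.encode, NFADescription.tally, List.length_append,
    List.length_replicate]
  omega

theorem mem_NRR_iff_saturated (D : NFADescription (DyckLetter n)) :
    D ∈ NRR (dyckLanguage n) ↔ ∃ p < D.encode.length + 1,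
      ((ParseState.final D.encode).s, none, p) ∈
          saturated (D.encode.length + 1) {e | e ∈ (ParseState.final D.encode).edges} ∧
        p ∈ (ParseState.final D.encode).accs := by
  obtain ⟨-, h1, h2, h3⟩ := ParseState.final_encode D
  have hlen := numStates_le_length_encode D
  set E : Set (ℕ × Option (DyckLetter n) × ℕ) := {e | e ∈ (ParseState.final D.encode).edges} with hE
  have hmem : ∀ q o p, (q, o, p) ∈ E ↔ ∃ q' p', D.Edge q' o p' ∧ q'.val = q ∧ p'.val = p := by
    intro q o p
    simp only [hE, h3, Set.mem_ofPred_eq, List.mem_map, Prod.mk.injEq, NFADescription.Edge]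
    constructor
    · rintro ⟨⟨q', o', p'⟩, he, rfl, rfl, rfl⟩
      exact ⟨q', p', he, rfl, rfl⟩
    · rintro ⟨q', p', he, rfl, rfl⟩
      exact ⟨_, he, rfl, rfl, rfl⟩
  have hb : ∀ e ∈ E, e.1 < D.encode.length + 1 ∧ e.2.2 < D.encode.length + 1 := by
    rintro ⟨q, o, p⟩ he
    obtain ⟨q', p', -, rfl, rfl⟩ := (hmem _ _ _).1 he
    exact ⟨by have := q'.2; simp only; omega, by have := p'.2; simp only; omega⟩
  have hs : D.start.val < D.encode.length + 1 := by have := D.start.2; omega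
  -- Numbers that are not states touch no edge, so sending them to `D.start` is harmless.
  have hpath : ∀ q p : Fin D.numStates, DyckPath (fun q o p => (q, o, p) ∈ E) q.val p.val ↔
      DyckPath D.Edge q p := by
    intro q p
    constructor
    · intro h
      have := DyckPath.map (E' := D.Edge)
        (fun k => if hk : k < D.numStates then ⟨k, hk⟩ else D.start) (fun q o p he => ?_) h
      · simpa using this
      · obtain ⟨q', p', he', rfl, rfl⟩ := (hmem _ _ _).1 he
        simpa using he'
    · exact DyckPath.map (E' := fun q o p => (q, o, p) ∈ E) (·.val) fun q o p he => (hmem _ _ _).2 ⟨q, p, he, rfl, rfl⟩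
  rw [mem_NRR_dyckLanguage_iff, h1, h2]
  simp only [mem_saturated_iff hb hs, List.mem_map]
  constructor
  · rintro ⟨p, hp, h⟩
    exact ⟨p, by have := p.2; omega, (hpath _ _).2 h, p, hp, rfl⟩
  · rintro ⟨_, -, h, p, hp, rfl⟩
    exact ⟨p, hp, (hpath _ _).1 h⟩

end DecisionProg

/-! ### Membership in P and completeness -/

open DecisionProg in
/-- The realizability problem for the Dyck language is in **P**. -/
theorem inP_NRRProblem (n : ℕ) : InP (NRRProblem (dyckLanguage n)) := by
  obtain ⟨T, hT, h⟩ := time_decisionProg (n := n)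
  refine LoopProg.inP (⟨none, true, false, false⟩ : DecisionReg (DyckLetter n))
    (fun _ => false : GraphCell (DyckLetter n)) (x := (1 : Fin 16)) (by decide)
    (wellFormed_decisionProg n) hT (fun w => by rw [initState_eq]; exact h w) fun w => ?_
  rw [initState_eq]
  obtain ⟨b, hb, hb'⟩ := out_decisionProg w
  refine ⟨b, hb, hb'.trans ⟨?_, ?_⟩⟩
  · rintro ⟨h1, h2⟩
    obtain ⟨D, rfl⟩ := ParseState.exists_encode_of_ok h1
    exact ⟨D, (mem_NRR_iff_saturated D).2 h2, rfl⟩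
  · rintro ⟨D, hD, rfl⟩
    exact ⟨(ParseState.final_encode D).1, (mem_NRR_iff_saturated D).1 hD⟩

theorem mainTheorem1 : IsPComplete (NRRProblem (dyckLanguage 2)) :=
  ⟨inP_NRRProblem 2, fun _ _ _ h => logSpaceReducible_NRRProblem h⟩
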